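/- Let $n\in\mathbb N$. For measurable $g$ on $\mathbb R^n$ (real or vector valued) put $d_g(s)=|\{x:|g(x)|>s\}|$ and $g^*(t)=\inf\{s\ge 0: d_g(s)\le t\}$. For $1\le p<\infty$ and $1\le q<\infty$ let $\|g\|_{L^{p,q}}=\big(\frac qp\int_0^\infty (t^{1/p}g^*(t))^q\,\frac{dt}{t}\big)^{1/q}$, let $\|g\|_{L^{p,\infty}}=\sup_{t>0}t^{1/p}g^*(t)$, and let $L^{p,q}$ be the space of measurable $g$ (modulo equality a.e.) with $\|g\|_{L^{p,q}}<\infty$. Let $\mathbf A$ be an operator mapping real functions on $\mathbb R^n$ to vector fields on $\mathbb R^n$ such that $\mathbf A(0)=0$ and, for all $1<p_1<\infty$, $1\le q_1\le\infty$, $$\|\mathbf A(u_1)-\mathbf A(u_2)\|_{L^{p_1,q_1}}\le C_A(p_1,q_1)\,\|u_1-u_2\|_{L^{p_1,q_1}}\qquad (u_1,u_2\in L^{p_1,q_1}),$$ with finite constants $C_A(p_1,q_1)$, and such that $\operatorname{div}\mathbf A(u)=0$ in the sense of distributions for all $u\in L^{p_1,q_1}$. Consider the equation $$(-\Delta)^{\alpha/2}u+\mathbf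 A(u)\cdot\nabla u=f,\qquad \operatorname{div}\mathbf A(u)=0,\tag{1}$$ where $(-\Delta)^{\alpha/2}$ has Fourier symbol $|\xi|^\alpha$ and $f$ is a tempered distribution. A solution of (1) is understood weakly, with $\mathbf A(u)\cdot\nabla u=\operatorname{div}(u\,\mathbf A(u))$: for every $\varphi\in\mathcal S(\mathbb R^n)$, $$\int u\,(-\Delta)^{\alpha/2}\varphi\,dx-\int u\,\mathbf A(u)\cdot\nabla\varphi\,dx=\langle f,\varphi\rangle .$$ For a real function $g$ we write $g=(-\Delta)^{-\alpha/2}f$ if $\langle f,\varphi\rangle=\int g\,(-\Delta)^{\alpha/2}\varphi\,dx$ for every $\varphi\in\mathcal S(\mathbb R^n)$. Let $1<\alpha<\frac n2+1$. There is $\eta_0>0$, depending only on $\alpha$, $n$ and an upper bound for $C_A\big(\frac n{\alpha-1},\infty\big)$, with the following property. Let $\frac{n}{n+1-\alpha}<p<\infty$, let $f$ be such that $(-\Delta)^{-\alpha/2}f\in L^{\frac n{\alpha-1},\infty}\cap L^p(\mathbb R^n)$, and let $R>0$ satisfy $$\max\Big(\|(-\Delta)^{-\alpha/2}f\|_{L^{\frac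 n{\alpha-1},\infty}},\ \|(-\Delta)^{-\alpha/2}f\|_{L^p}\Big)\le R .$$ If $R\le\eta_0$, then equation (1) has a solution $u\in L^{\frac n{\alpha-1},\infty}\cap L^p(\mathbb R^n)$ with $$\|u-(-\Delta)^{-\alpha/2}f\|_{L^{\frac n{\alpha-1},\infty}}\le R,$$ and $u$ is the only solution of (1) in $L^{\frac n{\alpha-1},\infty}(\mathbb R^n)$ that satisfies this bound. -/

import Mathlib

open MeasureTheory
open scoped ENNReal NNReal SchwartzMap FourierTransform

noncomputable section

/-- The Euclidean space `ℝⁿ`. -/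
abbrev Rn (n : ℕ) : Type := EuclideanSpace ℝ (Fin n)

/-- Measurable scalar functions on `ℝⁿ`, modulo equality almost everywhere. -/
abbrev ScalarField (n : ℕ) : Type := Rn n →ₘ[(volume : Measure (Rn n))] ℝ

/-- Measurable vector fields on `ℝⁿ`, modulo equality almost everywhere. -/
abbrev VectorField (n : ℕ) : Type := Rn n →ₘ[(volume : Measure (Rn n))] Rn n

section Lorentz

variable {n : ℕ} {F : Type*} [NormedAddCommGroup F]

/-- The distribution function `d_g(s) = |{x : |g(x)| > s}|`. -/
def distribFun (g : Rn n → F) (s : ℝ≥0∞) : ℝ≥0∞ :=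
  volume {x | s < ‖g x‖ₑ}

/-- The decreasing rearrangement `g*(t) = inf {s ≥ 0 : d_g(s) ≤ t}`
(the infimum of an empty set of finite levels is `∞`). -/
def rearrangement (g : Rn n → F) (t : ℝ) : ℝ≥0∞ :=
  sInf {s : ℝ≥0∞ | distribFun g s ≤ ENNReal.ofReal t}

/-- The Lorentz quasi-norm `‖g‖_{L^{p,q}}`, for `1 ≤ p < ∞` and `1 ≤ q ≤ ∞`: it is
`sup_{t > 0} t^{1/p} g*(t)` if `q = ∞`, and `(q/p ∫₀^∞ (t^{1/p} g*(t))^q dt/t)^{1/q}`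
if `q < ∞`; thus `‖g‖_{L^{p,p}} = ‖g‖_{L^p}`. -/
def lorentzNorm (g : Rn n → F) (p : ℝ) (q : ℝ≥0∞) : ℝ≥0∞ :=
  if q = ∞ then
    ⨆ t : ℝ, ⨆ _ : 0 < t, ENNReal.ofReal t ^ (1 / p) * rearrangement g t
  else
    (ENNReal.ofReal (q.toReal / p) *
      ∫⁻ t in Set.Ioi (0 : ℝ),
        (ENNReal.ofReal t ^ (1 / p) * rearrangement g t) ^ q.toReal / ENNReal.ofReal t)
      ^ (1 / q.toReal)

/-- Membership in the Lorentz space `L^{p,q}(ℝⁿ)`. -/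
def MemLorentz (g : Rn n → F) (p : ℝ) (q : ℝ≥0∞) : Prop :=
  AEStronglyMeasurable g volume ∧ lorentzNorm g p q < ∞

end Lorentz

/-- The fractional Laplacian `(-Δ)^{α/2} φ` of a Schwartz function, given by the Fourier symbol
`|ξ|^α`. With Mathlib's normalization `𝓕 φ(ξ) = ∫ e^{-2πi⟨x,ξ⟩} φ(x) dx` the symbol reads
`(2π|ξ|)^α`. -/
def fracLaplacian {n : ℕ} (α : ℝ) (φ : 𝓢(Rn n, ℂ)) : Rn n → ℂ :=
  𝓕⁻ (fun ξ : Rn n => ((2 * Real.pi * ‖ξ‖) ^ α : ℝ) • 𝓕 (φ : Rn n → ℂ) ξ)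

/-- `g = (-Δ)^{-α/2} f` for a tempered distribution `f` and a function `g`: that is,
`(-Δ)^{α/2} g = f` in the sense of tempered distributions, the operator acting on `g` by
duality (`|ξ|^α ĝ = f̂`). -/
def IsInvFracLaplacian {n : ℕ} (α : ℝ) (f : 𝓢'(Rn n, ℂ)) (g : ScalarField n) : Prop :=
  ∀ φ : 𝓢(Rn n, ℂ),
    Integrable (fun x => g x • fracLaplacian α φ x) volume ∧
    f φ = ∫ x, g x • fracLaplacian α φ x

/-- The vector field `V` is divergence free in the sense of distributions:
`∫ V · ∇φ = 0` for every test function. -/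
def IsDivFree {n : ℕ} (V : VectorField n) : Prop :=
  ∀ φ : 𝓢(Rn n, ℂ),
    Integrable (fun x => fderiv ℝ (φ : Rn n → ℂ) x (V x)) volume ∧
    ∫ x, fderiv ℝ (φ : Rn n → ℂ) x (V x) = 0

/-- The assumptions on the operator `u ↦ A(u) = (A₁(u), …, Aₙ(u))`: `A(0) = 0`; for
`1 < p₁ < ∞` and `1 ≤ q₁ ≤ ∞` it is Lipschitz on `L^{p₁,q₁}(ℝⁿ)` with constant `C p₁ q₁`; and
`A(u)` is divergence free for `u` in these spaces. Nothing is asked of `A` outside the union of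
these spaces. -/
structure IsDriftOperator {n : ℕ} (A : ScalarField n → VectorField n)
    (C : ℝ → ℝ≥0∞ → ℝ≥0) : Prop where
  map_zero : A 0 = 0
  lipschitz : ∀ (p₁ : ℝ) (q₁ : ℝ≥0∞), 1 < p₁ → 1 ≤ q₁ →
    ∀ u₁ u₂ : ScalarField n, MemLorentz u₁ p₁ q₁ → MemLorentz u₂ p₁ q₁ →
      lorentzNorm (A u₁ - A u₂ : VectorField n) p₁ q₁
        ≤ (C p₁ q₁ : ℝ≥0∞) * lorentzNorm (u₁ - u₂ : ScalarField n) p₁ q₁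
  divFree : ∀ (p₁ : ℝ) (q₁ : ℝ≥0∞), 1 < p₁ → 1 ≤ q₁ →
    ∀ u : ScalarField n, MemLorentz u p₁ q₁ → IsDivFree (A u)

/-- `u` is a weak solution of `(-Δ)^{α/2} u + A(u) · ∇u = f`, `div A(u) = 0`, where
`A(u) · ∇u = div (u A(u))` is understood in the sense of tempered distributions. -/
structure IsWeakSolution {n : ℕ} (α : ℝ) (A : ScalarField n → VectorField n)
    (f : 𝓢'(Rn n, ℂ)) (u : ScalarField n) : Prop where
  integrable_linear : ∀ φ : 𝓢(Rn n, ℂ),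
    Integrable (fun x => u x • fracLaplacian α φ x) volume
  integrable_nonlinear : ∀ φ : 𝓢(Rn n, ℂ),
    Integrable (fun x => fderiv ℝ (φ : Rn n → ℂ) x (u x • A u x)) volume
  equation : ∀ φ : 𝓢(Rn n, ℂ),
    (∫ x, u x • fracLaplacian α φ x) - ∫ x, fderiv ℝ (φ : Rn n → ℂ) x (u x • A u x) = f φ
  divFree : IsDivFree (A u)

end

/-! Put b = (α-1)/n, the reciprocal of the critical exponent; α < n/2 + 1 says exactly that 2b < 1.
With g = (-Δ)^{-α/2} f, the equation becomes the fixed point problem u = g + B(u, A(u)), where B(w,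
V) = -(-Δ)^{-α/2} div(wV) (`driftTerm`) has a kernel of size |z|^{α-1-n}. Hölder's inequality in
weak spaces (`mNorm_mul_le`) adds reciprocal exponents, and the weak Hardy–Littlewood–Sobolev
inequality (`exists_mNorm_rieszPotential_le`) subtracts b. So a field V of reciprocal exponent b
makes w ↦ B(w, V) bounded on L^{1/q,∞} whenever 0 < q and q + b < 1. At q = b the nonlinearity is
quadratic, hence a contraction on a small ball (`exists_mild_solution`).

Weak solutions and fixed points coincide in the critical space. One direction is the identity
`integral_invDiv_smul_fracLaplacian`; for the other, the difference of the two sides is annihilated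
by (-Δ)^{α/2} and vanishes by the Liouville theorem `ae_eq_zero_of_fracLaplacian`. Both rest on the
fact that (-Δ)^{α/2}φ lies in L¹ ∩ L^∞ for Schwartz φ, and the first also on the kernel identity
`gradConst_mul_integral`.

For membership in L^p, the threshold η₀ must not depend on p although the operator bounds do.
Freezing V = A(u), u solves the linear equation u = g + Tu with T a contraction at the three fixed
reciprocal exponents b/2, b and 1/2. Truncating g and interpolating (`memLp_of_eq_add`) settles b/2
< 1/p < 1/2. For the remaining p, weak integrability of u at b/2 or 1/2 starts a bootstrap: if u has
reciprocal exponent x, then B(u, A(u)) has 2x - b, so the deviation from b doubles, and this uses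
only finiteness of constants. The condition p > n/(n+1-α) means 1/p + b < 1, which is open and lets
the last step overshoot 1/p; interpolating with b then gives strong L^p (`memLp_driftTerm`).

Estimates are made in `mNorm`, indexed by the reciprocal exponent: its triangle inequality has no
constant and extends to countable sums, and interpolation is along segments of exponents. -/

noncomputable section

/-! ### The Marcinkiewicz norm and the layer cake formula -/

section MarcinkiewiczNorm

variable {X : Type*} [MeasurableSpace X] {μ : Measure X}

/-- The Marcinkiewicz norm `sup_E |E|^{x-1} ∫_E f` of a nonnegative function, equivalent to the
weak `L^{1/x}` quasi-norm for `0 < x < 1`. -/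
def mNorm (μ : Measure X) (x : ℝ) (f : X → ℝ≥0∞) : ℝ≥0∞ :=
  ⨆ (E : Set X) (_ : MeasurableSet E) (_ : μ E ≠ 0) (_ : μ E ≠ ∞),
    (∫⁻ y in E, f y ∂μ) / μ E ^ (1 - x)

theorem setLIntegral_le_mNorm (x : ℝ) (f : X → ℝ≥0∞) {E : Set X} (hE : MeasurableSet E)
    (hE' : μ E ≠ ∞) : ∫⁻ y in E, f y ∂μ ≤ mNorm μ x f * μ E ^ (1 - x) := by
  by_cases h0 : μ E = 0
  · rw [setLIntegral_measure_zero _ _ h0]; exact zero_le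
  · have h1 : μ E ^ (1 - x) ≠ 0 := (ENNReal.rpow_pos (pos_iff_ne_zero.2 h0) hE').ne'
    have h2 : μ E ^ (1 - x) ≠ ∞ := by
      simp [ENNReal.rpow_eq_top_iff, h0, hE']
    rw [← ENNReal.div_le_iff h1 h2]
    exact le_iSup₂_of_le E hE (le_iSup₂_of_le h0 hE' le_rfl)

theorem mNorm_le {x : ℝ} {f : X → ℝ≥0∞} {K : ℝ≥0∞}
    (h : ∀ E, MeasurableSet E → μ E ≠ 0 → μ E ≠ ∞ → ∫⁻ y in E, f y ∂μ ≤ K * μ E ^ (1 - x)) :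
    mNorm μ x f ≤ K := by
  refine iSup₂_le fun E hE => iSup₂_le fun h0 hE' => ?_
  have h1 : μ E ^ (1 - x) ≠ 0 := (ENNReal.rpow_pos (pos_iff_ne_zero.2 h0) hE').ne'
  have h2 : μ E ^ (1 - x) ≠ ∞ := by
    simp [ENNReal.rpow_eq_top_iff, h0, hE']
  rw [ENNReal.div_le_iff h1 h2]
  exact h E hE h0 hE'

theorem mNorm_mono_ae {x : ℝ} {f g : X → ℝ≥0∞} (h : f ≤ᵐ[μ] g) : mNorm μ x f ≤ mNorm μ x g :=
  mNorm_le fun _ hE _ hE' => (lintegral_mono_ae (ae_restrict_of_ae h)).trans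
    (setLIntegral_le_mNorm x g hE hE')

theorem mNorm_congr_ae {x : ℝ} {f g : X → ℝ≥0∞} (h : f =ᵐ[μ] g) : mNorm μ x f = mNorm μ x g :=
  le_antisymm (mNorm_mono_ae h.le) (mNorm_mono_ae h.symm.le)

theorem mNorm_zero (x : ℝ) : mNorm μ x (fun _ => 0) = 0 :=
  le_antisymm (mNorm_le fun E _ _ _ => by simp) zero_le

theorem mNorm_add_le {x : ℝ} {f g : X → ℝ≥0∞} (hf : AEMeasurable f μ) :
    mNorm μ x (fun y => f y + g y) ≤ mNorm μ x f + mNorm μ x g :=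
  mNorm_le fun E hE _ hE' => by
    rw [lintegral_add_left' hf.restrict, add_mul]
    exact add_le_add (setLIntegral_le_mNorm x f hE hE') (setLIntegral_le_mNorm x g hE hE')

theorem mNorm_const_mul_le {x : ℝ} {f : X → ℝ≥0∞} (hf : AEMeasurable f μ) (c : ℝ≥0∞) :
    mNorm μ x (fun y => c * f y) ≤ c * mNorm μ x f :=
  mNorm_le fun E hE _ hE' => by
    rw [lintegral_const_mul'' _ hf.restrict, mul_assoc]
    gcongr
    exact setLIntegral_le_mNorm x f hE hE'

/-- Countable subadditivity takes the place of completeness of the weak space in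
`exists_fixedPoint_wNorm`. -/
theorem mNorm_tsum_le {x : ℝ} {f : ℕ → X → ℝ≥0∞} (hf : ∀ k, AEMeasurable (f k) μ) :
    mNorm μ x (fun y => ∑' k, f k y) ≤ ∑' k, mNorm μ x (f k) :=
  mNorm_le fun E hE _ hE' => by
    rw [lintegral_tsum fun k => (hf k).restrict, ← ENNReal.tsum_mul_right]
    exact ENNReal.tsum_le_tsum fun k => setLIntegral_le_mNorm x (f k) hE hE'

theorem mNorm_one_le (f : X → ℝ≥0∞) : mNorm μ 1 f ≤ ∫⁻ y, f y ∂μ :=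
  mNorm_le fun E _ _ _ => by simpa using setLIntegral_le_lintegral E f

/-- Interpolation between two Marcinkiewicz norms. -/
theorem mNorm_interp (f : X → ℝ≥0∞) {x y θ : ℝ} (h0 : 0 ≤ θ) (h1 : θ ≤ 1) :
    mNorm μ ((1 - θ) * x + θ * y) f ≤ mNorm μ x f ^ (1 - θ) * mNorm μ y f ^ θ :=
  mNorm_le fun E hE hE0 hE' => by
    have hx := setLIntegral_le_mNorm x f hE hE'
    have hy := setLIntegral_le_mNorm y f hE hE'
    calc ∫⁻ y in E, f y ∂μ = (∫⁻ y in E, f y ∂μ) ^ (1 - θ) * (∫⁻ y in E, f y ∂μ) ^ θ := by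
          rw [← ENNReal.rpow_add_of_nonneg _ _ (by linarith) h0]; simp
      _ ≤ (mNorm μ x f * μ E ^ (1 - x)) ^ (1 - θ) * (mNorm μ y f * μ E ^ (1 - y)) ^ θ := by
          gcongr
      _ = _ := by
          rw [ENNReal.mul_rpow_of_nonneg _ _ (by linarith : 0 ≤ 1 - θ),
            ENNReal.mul_rpow_of_nonneg _ _ h0, ← ENNReal.rpow_mul, ← ENNReal.rpow_mul,
            mul_mul_mul_comm, ← ENNReal.rpow_add _ _ hE0 hE']
          congr 2; ring

theorem mNorm_lt_top_of_mem_segment {f : X → ℝ≥0∞} {x y z : ℝ} (hz : z ∈ segment ℝ x y)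
    (hx : mNorm μ x f < ∞) (hy : mNorm μ y f < ∞) : mNorm μ z f < ∞ := by
  obtain ⟨a, b, ha, hb, hab, rfl⟩ := hz
  obtain rfl : a = 1 - b := by linarith
  refine (mNorm_interp f hb (by linarith)).trans_lt ?_
  exact ENNReal.mul_lt_top (ENNReal.rpow_lt_top_of_nonneg ha hx.ne)
    (ENNReal.rpow_lt_top_of_nonneg hb hy.ne)

/-- `mNorm` only tests sets of finite measure, while a level set could a priori be infinite;
σ-finiteness exhausts it from inside by finite pieces. -/
theorem measure_lt_le_of_forall_finite [SigmaFinite μ] {s : Set X} (hs : MeasurableSet s)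
    {K : ℝ≥0∞} (h : ∀ t ⊆ s, MeasurableSet t → μ t ≠ 0 → μ t ≠ ∞ → μ t ≤ K) : μ s ≤ K := by
  refine le_of_forall_lt fun r hr => ?_
  obtain ⟨t, ht, hts, hrt, htop⟩ := Measure.exists_subset_measure_lt_top hs hr
  exact hrt.trans_le (h t hts ht (by rintro h; simp [h] at hrt) htop.ne)

theorem mul_measure_rpow_le_mNorm {s : ℝ≥0∞} {t : ℝ} {f : X → ℝ≥0∞} {E : Set X}
    (hE : MeasurableSet E) (h0 : μ E ≠ 0) (hE' : μ E ≠ ∞) (h : ∀ y ∈ E, s ≤ f y) :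
    s * μ E ^ t ≤ mNorm μ t f := by
  have h1 : s * μ E ≤ mNorm μ t f * μ E ^ (1 - t) := by
    refine le_trans ?_ (setLIntegral_le_mNorm t f hE hE')
    rw [← setLIntegral_const]
    exact setLIntegral_mono' hE h
  have h3 : μ E ^ (1 - t) ≠ 0 := (ENNReal.rpow_pos (pos_iff_ne_zero.2 h0) hE').ne'
  have h2 : μ E ^ (1 - t) ≠ ∞ := by simp [ENNReal.rpow_eq_top_iff, h0, hE']
  rw [← ENNReal.mul_le_mul_iff_left h3 h2, mul_assoc, ← ENNReal.rpow_add _ _ h0 hE']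
  simpa using h1

/-- Chebyshev's inequality for the Marcinkiewicz norm. -/
theorem measure_lt_le_mNorm [SigmaFinite μ] {x : ℝ} (hx : 0 < x) {f : X → ℝ≥0∞}
    (hf : Measurable f) {s : ℝ≥0∞} (hs : s ≠ 0) (hs' : s ≠ ∞) :
    μ {y | s < f y} ≤ (mNorm μ x f / s) ^ (1 / x) := by
  refine measure_lt_le_of_forall_finite (measurableSet_lt measurable_const hf)
    fun t hts ht h0 htop => ?_
  have h := mul_measure_rpow_le_mNorm (s := s) (t := x) ht h0 htop
    (fun y hy => (hts hy : s < f y).le)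
  rw [one_div, ENNReal.le_rpow_inv_iff hx, ENNReal.le_div_iff_mul_le (.inl hs) (.inl hs'),
    mul_comm]
  exact h

theorem ae_lt_top_of_mNorm [SigmaFinite μ] {x : ℝ} {f : X → ℝ≥0∞} (hf : AEMeasurable f μ)
    (h : mNorm μ x f < ∞) : ∀ᵐ y ∂μ, f y < ∞ := by
  refine ae_of_forall_measure_lt_top_ae_restrict _ fun E hE hE' => ?_
  refine ae_lt_top' hf.restrict ?_
  by_cases h0 : μ E = 0
  · rw [setLIntegral_measure_zero _ _ h0]; exact ENNReal.zero_ne_top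
  refine ((setLIntegral_le_mNorm x f hE hE'.ne).trans_lt
    (ENNReal.mul_lt_top h (lt_top_iff_ne_top.2 ?_))).ne
  simp [ENNReal.rpow_eq_top_iff, h0, hE'.ne]

theorem ae_eq_zero_of_mNorm [SigmaFinite μ] {x : ℝ} {f : X → ℝ≥0∞} (hf : AEMeasurable f μ)
    (h : mNorm μ x f = 0) : ∀ᵐ y ∂μ, f y = 0 := by
  refine ae_of_forall_measure_lt_top_ae_restrict _ fun E hE hE' => ?_
  have := setLIntegral_le_mNorm x f hE hE'.ne
  rw [h, zero_mul, nonpos_iff_eq_zero, lintegral_eq_zero_iff' hf.restrict] at this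
  exact this

/-- The layer cake formula with a weight. -/
theorem lintegral_mul_eq_lintegral_setLIntegral [SFinite μ] {f k : X → ℝ≥0∞} (hf : Measurable f)
    (hk : Measurable k) : ∫⁻ y, f y * k y ∂μ =
      ∫⁻ s in Set.Ioi (0 : ℝ), ∫⁻ y in {y | ENNReal.ofReal s < k y}, f y ∂μ := by
  have hm : MeasurableSet {p : ℝ × X | ENNReal.ofReal p.1 < k p.2} :=
    measurableSet_lt (ENNReal.measurable_ofReal.comp measurable_fst) (hk.comp measurable_snd)
  have h1 : ∀ s : ℝ, ∫⁻ y in {y | ENNReal.ofReal s < k y}, f y ∂μ =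
      ∫⁻ y, {p : ℝ × X | ENNReal.ofReal p.1 < k p.2}.indicator (fun p => f p.2) (s, y) ∂μ := by
    intro s
    rw [← lintegral_indicator (measurableSet_lt measurable_const hk)]
    rfl
  simp_rw [h1]
  rw [lintegral_lintegral_swap]
  · refine lintegral_congr fun y => ?_
    have h2 : ∀ s : ℝ, {p : ℝ × X | ENNReal.ofReal p.1 < k p.2}.indicator (fun p => f p.2) (s, y) =
        {s : ℝ | ENNReal.ofReal s < k y}.indicator (fun _ => f y) s := fun s => rfl
    have hms : MeasurableSet {s : ℝ | ENNReal.ofReal s < k y} :=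
      measurableSet_lt ENNReal.measurable_ofReal measurable_const
    simp_rw [h2]
    rw [lintegral_indicator hms, setLIntegral_const, Measure.restrict_apply hms]
    congr 1
    rcases eq_or_ne (k y) ∞ with h | h
    · simp [h]
    · have : {s : ℝ | ENNReal.ofReal s < k y} ∩ Set.Ioi 0 = Set.Ioo 0 (k y).toReal := by
        ext s
        simp only [Set.mem_inter_iff, Set.mem_ofPred_eq, Set.mem_Ioi, Set.mem_Ioo]
        constructor
        · rintro ⟨h1, h2⟩
          exact ⟨h2, (ENNReal.ofReal_lt_iff_lt_toReal h2.le h).1 h1⟩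
        · rintro ⟨h1, h2⟩
          exact ⟨(ENNReal.ofReal_lt_iff_lt_toReal h1.le h).2 h2, h1⟩
      rw [this, Real.volume_Ioo, sub_zero, ENNReal.ofReal_toReal h]
  · exact ((hf.comp measurable_snd).indicator hm).aemeasurable

end MarcinkiewiczNorm

/-! ### Weak-type bounds, duality and Hölder's inequality -/

section WeakType

theorem lintegral_Ioc_rpow {γ M : ℝ} (hγ : γ < 1) (hM : 0 ≤ M) :
    ∫⁻ s in Set.Ioc (0 : ℝ) M, ENNReal.ofReal (s ^ (-γ)) = ENNReal.ofReal (M ^ (1 - γ) / (1 - γ)) := by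
  have hi : IntegrableOn (fun s : ℝ => s ^ (-γ)) (Set.Ioc 0 M) := by
    rw [← intervalIntegrable_iff_integrableOn_Ioc_of_le hM]
    exact intervalIntegral.intervalIntegrable_rpow' (by linarith)
  rw [← ofReal_integral_eq_lintegral_ofReal hi, ← intervalIntegral.integral_of_le hM,
    integral_rpow (.inl (by linarith)), Real.zero_rpow (by linarith)]
  · congr 2 <;> ring_nf
  · filter_upwards [ae_restrict_mem measurableSet_Ioc] with s hs
    exact Real.rpow_nonneg hs.1.le _

theorem lintegral_Ioi_rpow {κ c : ℝ} (hκ : 1 < κ) (hc : 0 < c) :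
    ∫⁻ s in Set.Ioi c, ENNReal.ofReal (s ^ (-κ)) = ENNReal.ofReal (c ^ (1 - κ) / (κ - 1)) := by
  have hi : IntegrableOn (fun s : ℝ => s ^ (-κ)) (Set.Ioi c) :=
    integrableOn_Ioi_rpow_of_lt (by linarith) hc
  rw [← ofReal_integral_eq_lintegral_ofReal hi, integral_Ioi_rpow_of_lt (by linarith) hc]
  · congr 1
    rw [show -κ + 1 = 1 - κ by ring, show κ - 1 = -(1 - κ) by ring, div_neg, neg_div]
  · filter_upwards [ae_restrict_mem measurableSet_Ioi] with s hs
    exact Real.rpow_nonneg (hc.le.trans (le_of_lt hs)) _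

variable {X : Type*} [MeasurableSpace X] {μ : Measure X} [SigmaFinite μ]

theorem div_ofReal_rpow {s : ℝ} (hs : 0 < s) (D : ℝ≥0∞) {γ : ℝ} (hγ : 0 ≤ γ) :
    (D / ENNReal.ofReal s) ^ γ = D ^ γ * ENNReal.ofReal (s ^ (-γ)) := by
  rw [ENNReal.div_rpow_of_nonneg _ _ hγ, Real.rpow_neg hs.le, ENNReal.ofReal_inv_of_pos
    (Real.rpow_pos_of_pos hs _), ENNReal.ofReal_rpow_of_pos hs, div_eq_mul_inv]

/-- Duality between a Marcinkiewicz norm and bounded functions in a weak space. -/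
theorem lintegral_mul_le_mNorm {f k : X → ℝ≥0∞} (hf : Measurable f) (hk : Measurable k)
    {x y γ M : ℝ} (hx : x ≤ 1) (hy : 0 < y) (hγ : γ = (1 - x) / y) (hγ1 : γ < 1) (hM : 0 ≤ M)
    (hkM : ∀ z, k z ≤ ENNReal.ofReal M) {D : ℝ≥0∞} (hD : D ≠ ∞) (hkD : mNorm μ y k ≤ D) :
    ∫⁻ z, f z * k z ∂μ ≤ mNorm μ x f * (D ^ γ * ENNReal.ofReal (M ^ (1 - γ) / (1 - γ))) := by
  have hγ0 : 0 ≤ γ := by rw [hγ]; exact div_nonneg (by linarith) hy.le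
  -- Layer cake in `k`: the set {k > s} is empty for s > M and has measure at most (D/s)^{1/y}
  -- otherwise. Testing `f` on it costs (D/s)^γ, which is integrable at 0 because γ < 1.
  rw [lintegral_mul_eq_lintegral_setLIntegral hf hk, ← lintegral_Ioc_rpow hγ1 hM,
    ← lintegral_const_mul' _ _ (ENNReal.rpow_ne_top_of_nonneg hγ0 hD),
    ← lintegral_const_mul _ (by fun_prop), ← lintegral_indicator measurableSet_Ioi,
    ← lintegral_indicator measurableSet_Ioc]
  refine lintegral_mono fun s => ?_
  by_cases hs : 0 < s
  swap
  · simp [Set.indicator, hs]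
  by_cases hsM : s ≤ M
  · rw [Set.indicator_of_mem (show s ∈ Set.Ioi 0 from hs),
      Set.indicator_of_mem (show s ∈ Set.Ioc 0 M from ⟨hs, hsM⟩)]
    have hs0 : ENNReal.ofReal s ≠ 0 := by simpa using hs
    have h1 : μ {z | ENNReal.ofReal s < k z} ≤ (D / ENNReal.ofReal s) ^ (1 / y) :=
      (measure_lt_le_mNorm hy hk hs0 ENNReal.ofReal_ne_top).trans (by gcongr)
    have h2 : (D / ENNReal.ofReal s) ^ (1 / y) ≠ ∞ :=
      ENNReal.rpow_ne_top_of_nonneg (by positivity) (ENNReal.div_ne_top hD hs0)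
    refine (setLIntegral_le_mNorm x f (measurableSet_lt measurable_const hk)
      (ne_top_of_le_ne_top h2 h1)).trans ?_
    rw [← div_ofReal_rpow hs D hγ0]
    gcongr
    calc _ ≤ ((D / ENNReal.ofReal s) ^ (1 / y)) ^ (1 - x) := by
          gcongr
      _ = _ := by rw [← ENNReal.rpow_mul, hγ]; congr 1; ring
  · rw [Set.indicator_of_mem (show s ∈ Set.Ioi 0 from hs)]
    have : {z | ENNReal.ofReal s < k z} = ∅ := by
      ext z
      simpa using (hkM z).trans (ENNReal.ofReal_le_ofReal (not_le.1 hsM).le)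
    simp [this]

theorem mNorm_le_of_weak_aux {f : X → ℝ≥0∞} (hf : Measurable f) {x K : ℝ} (hx : 0 < x)
    (hx1 : x < 1) (hK : 0 < K)
    (h : ∀ s : ℝ, 0 < s → μ {z | ENNReal.ofReal s < f z} ≤ (ENNReal.ofReal K / ENNReal.ofReal s) ^ (1 / x)) :
    mNorm μ x f ≤ ENNReal.ofReal (1 / (1 - x)) * ENNReal.ofReal K := by
  refine mNorm_le fun E hE h0 hE' => ?_
  set m := (μ E).toReal with hm
  have hm0 : 0 < m := ENNReal.toReal_pos h0 hE'
  have hμ : μ E = ENNReal.ofReal m := (ENNReal.ofReal_toReal hE').symm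
  -- The height at which the trivial bound |E| and the weak-type bound (K/s)^{1/x} coincide.
  set c := K * m ^ (-x) with hc
  have hc0 : 0 < c := by positivity
  have h1 : ∫⁻ y in E, f y ∂μ = ∫⁻ s in Set.Ioi (0 : ℝ), (μ.restrict E) {y | ENNReal.ofReal s < f y} := by
    have := lintegral_mul_eq_lintegral_setLIntegral (μ := μ.restrict E) (f := fun _ => 1)
      measurable_const hf
    simpa using this
  rw [h1, ← Set.Ioc_union_Ioi_eq_Ioi hc0.le,
    lintegral_union measurableSet_Ioi (Set.Ioc_disjoint_Ioi le_rfl)]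
  have hκ : 1 < 1 / x := by rw [lt_div_iff₀ hx]; linarith
  calc _ ≤ (∫⁻ s in Set.Ioc 0 c, ENNReal.ofReal m) +
        ∫⁻ s in Set.Ioi c, ENNReal.ofReal K ^ (1 / x) * ENNReal.ofReal (s ^ (-(1 / x))) := by
        refine add_le_add (lintegral_mono fun s => ?_) (setLIntegral_mono' measurableSet_Ioi
          fun s hs => ?_)
        · rw [← hμ, ← Measure.restrict_apply_univ E]
          exact measure_mono (Set.subset_univ _)
        · have hs0 : 0 < s := hc0.trans hs
          rw [← div_ofReal_rpow hs0 _ (by positivity)]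
          exact (Measure.restrict_apply_le _ _).trans (h s hs0)
    _ = ENNReal.ofReal (1 / (1 - x)) * ENNReal.ofReal K * μ E ^ (1 - x) := by
        rw [lintegral_const_mul' _ _ (by simp [ENNReal.rpow_eq_top_iff, hK]), lintegral_Ioi_rpow hκ hc0,
          setLIntegral_const, Real.volume_Ioc, sub_zero, hμ, ENNReal.ofReal_rpow_of_pos hK,
          ENNReal.ofReal_rpow_of_pos hm0, ← ENNReal.ofReal_mul hm0.le,
          ← ENNReal.ofReal_mul (by positivity),
          ← ENNReal.ofReal_mul (by have : 0 < 1 - x := by linarith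
                                   positivity), ← ENNReal.ofReal_mul (by have : 0 < 1 - x := by linarith
                                                                         positivity),
          ← ENNReal.ofReal_add (by positivity) (by
            have : 0 < 1 / x - 1 := by linarith
            positivity)]
        congr 1
        have e1 : c ^ (1 - 1 / x) = K ^ (1 - 1 / x) * m ^ (1 - x) := by
          rw [hc, Real.mul_rpow hK.le (by positivity), ← Real.rpow_mul hm0.le]
          congr 2; field_simp; ring
        have e2 : m * c = K * m ^ (1 - x) := by
          rw [hc, show 1 - x = 1 + -x by ring, Real.rpow_add hm0, Real.rpow_one]; ring
        have e3 : K ^ (1 / x) * K ^ (1 - 1 / x) = K := by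
          rw [← Real.rpow_add hK]; simp
        rw [e1, e2]
        have h4 : (1 - x) ≠ 0 := by linarith
        have h5 : 1 / x - 1 = (1 - x) / x := by field_simp
        calc _ = K * m ^ (1 - x) + (K ^ (1 / x) * K ^ (1 - 1 / x)) * m ^ (1 - x) / (1 / x - 1) := by ring
          _ = _ := by rw [e3, h5]; field_simp; ring

theorem mNorm_le_of_weak {f : X → ℝ≥0∞} (hf : Measurable f) {x : ℝ} {K : ℝ≥0∞} (hx : 0 < x)
    (hx1 : x < 1)
    (h : ∀ s : ℝ, 0 < s → μ {z | ENNReal.ofReal s < f z} ≤ (K / ENNReal.ofReal s) ^ (1 / x)) :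
    mNorm μ x f ≤ ENNReal.ofReal (1 / (1 - x)) * K := by
  have hc : ENNReal.ofReal (1 / (1 - x)) ≠ 0 := by
    have : 0 < 1 - x := by linarith
    simpa using this
  rw [mul_comm, ← ENNReal.div_le_iff hc ENNReal.ofReal_ne_top]
  -- Approximating `K` from above reduces to a constant that is positive and finite.
  refine le_of_forall_gt_imp_ge_of_dense fun K' hK' => ?_
  rw [ENNReal.div_le_iff hc ENNReal.ofReal_ne_top, mul_comm]
  rcases eq_or_ne K' ∞ with rfl | hfin
  · rw [ENNReal.mul_top hc]; exact le_top
  have hpos : 0 < K'.toReal := ENNReal.toReal_pos (bot_le.trans_lt hK').ne' hfin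
  rw [← ENNReal.ofReal_toReal hfin]
  refine mNorm_le_of_weak_aux hf hx hx1 hpos fun s hs => (h s hs).trans ?_
  rw [ENNReal.ofReal_toReal hfin]
  gcongr

/-- Hölder's inequality in weak spaces. -/
theorem mNorm_mul_le {f g : X → ℝ≥0∞} (hf : Measurable f) (hg : Measurable g) {x y : ℝ}
    (hx : 0 < x) (hy : 0 < y) (hxy : x + y < 1) :
    mNorm μ (x + y) (fun z => f z * g z) ≤
      ENNReal.ofReal (1 / (1 - (x + y))) * (2 * (mNorm μ x f * mNorm μ y g)) := by
  have hc : ENNReal.ofReal (1 / (1 - (x + y))) ≠ 0 := by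
    have : 0 < 1 - (x + y) := by linarith
    simpa using this
  by_cases hF0 : mNorm μ x f = 0
  · refine le_trans (le_of_eq ?_) zero_le
    rw [← mNorm_zero (μ := μ) (x + y)]
    refine mNorm_congr_ae ?_
    filter_upwards [ae_eq_zero_of_mNorm hf.aemeasurable hF0] with z hz
    simp [hz]
  by_cases hG0 : mNorm μ y g = 0
  · refine le_trans (le_of_eq ?_) zero_le
    rw [← mNorm_zero (μ := μ) (x + y)]
    refine mNorm_congr_ae ?_
    filter_upwards [ae_eq_zero_of_mNorm hg.aemeasurable hG0] with z hz
    simp [hz]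
  by_cases hF : mNorm μ x f = ∞
  · rw [hF, ENNReal.top_mul hG0, ENNReal.mul_top two_ne_zero, ENNReal.mul_top hc]; exact le_top
  by_cases hG : mNorm μ y g = ∞
  · rw [hG, ENNReal.mul_top hF0, ENNReal.mul_top two_ne_zero, ENNReal.mul_top hc]; exact le_top
  refine mNorm_le_of_weak (hf.mul hg) (by linarith) hxy fun s hs => ?_
  set F := (mNorm μ x f).toReal
  set G := (mNorm μ y g).toReal
  have hFp : 0 < F := ENNReal.toReal_pos hF0 hF
  have hGp : 0 < G := ENNReal.toReal_pos hG0 hG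
  have hFe : mNorm μ x f = ENNReal.ofReal F := (ENNReal.ofReal_toReal hF).symm
  have hGe : mNorm μ y g = ENNReal.ofReal G := (ENNReal.ofReal_toReal hG).symm
  -- With thresholds Fρ^{-x} and Gρ^{-y} both level sets have measure at most ρ; this ρ makes the
  -- product of the thresholds equal to s.
  set ρ := (F * G / s) ^ (1 / (x + y)) with hρ
  have hρp : 0 < ρ := by positivity
  have hρe : ρ ^ (x + y) = F * G / s := by
    rw [hρ, ← Real.rpow_mul (by positivity), one_div_mul_cancel (by positivity), Real.rpow_one]
  have h1 : μ {z | ENNReal.ofReal (F * ρ ^ (-x)) < f z} ≤ ENNReal.ofReal ρ := by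
    refine (measure_lt_le_mNorm hx hf (by simp; positivity) ENNReal.ofReal_ne_top).trans ?_
    rw [hFe, ← ENNReal.ofReal_div_of_pos (by positivity), ENNReal.ofReal_rpow_of_pos (by positivity)]
    refine ENNReal.ofReal_le_ofReal (le_of_eq ?_)
    rw [show F / (F * ρ ^ (-x)) = ρ ^ x by rw [Real.rpow_neg hρp.le]; field_simp,
      ← Real.rpow_mul hρp.le, mul_one_div_cancel hx.ne', Real.rpow_one]
  have h2 : μ {z | ENNReal.ofReal (G * ρ ^ (-y)) < g z} ≤ ENNReal.ofReal ρ := by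
    refine (measure_lt_le_mNorm hy hg (by simp; positivity) ENNReal.ofReal_ne_top).trans ?_
    rw [hGe, ← ENNReal.ofReal_div_of_pos (by positivity), ENNReal.ofReal_rpow_of_pos (by positivity)]
    refine ENNReal.ofReal_le_ofReal (le_of_eq ?_)
    rw [show G / (G * ρ ^ (-y)) = ρ ^ y by rw [Real.rpow_neg hρp.le]; field_simp,
      ← Real.rpow_mul hρp.le, mul_one_div_cancel hy.ne', Real.rpow_one]
  have hsub : {z | ENNReal.ofReal s < f z * g z} ⊆
      {z | ENNReal.ofReal (F * ρ ^ (-x)) < f z} ∪ {z | ENNReal.ofReal (G * ρ ^ (-y)) < g z} := by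
    intro z hz
    by_contra hcon
    simp only [Set.mem_union, Set.mem_ofPred_eq, not_or, not_lt] at hcon hz
    refine absurd hz (not_lt.2 ((mul_le_mul' hcon.1 hcon.2).trans ?_))
    rw [← ENNReal.ofReal_mul (by positivity)]
    refine ENNReal.ofReal_le_ofReal (le_of_eq ?_)
    calc _ = F * G * (ρ ^ (-x) * ρ ^ (-y)) := by ring
      _ = F * G * (ρ ^ (x + y))⁻¹ := by rw [← Real.rpow_add hρp, ← Real.rpow_neg hρp.le]; ring_nf
      _ = s := by rw [hρe]; field_simp
  refine (measure_mono hsub).trans ((measure_union_le _ _).trans ((add_le_add h1 h2).trans ?_))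
  rw [hFe, hGe, ← ENNReal.ofReal_mul hFp.le, ← ENNReal.ofReal_add hρp.le hρp.le,
    show (2 : ℝ≥0∞) = ENNReal.ofReal 2 by simp, ← ENNReal.ofReal_mul (by norm_num),
    ← ENNReal.ofReal_div_of_pos hs, ENNReal.ofReal_rpow_of_pos (by positivity)]
  refine ENNReal.ofReal_le_ofReal ?_
  rw [mul_div_assoc, Real.mul_rpow (by norm_num) (by positivity), ← hρ, ← two_mul]
  gcongr
  -- The factor 2 of the union bound is absorbed in 2^{1/(x+y)}, since x + y < 1.
  conv_lhs => rw [← Real.rpow_one 2]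
  exact Real.rpow_le_rpow_of_exponent_le (by norm_num) (by rw [le_div_iff₀ (by linarith)]; linarith)

end WeakType

/-! ### Comparison with the weak Lorentz quasi-norm -/

section LorentzEquiv

variable {n : ℕ} {F : Type*} [NormedAddCommGroup F]

theorem lorentzNorm_top (g : Rn n → F) (p : ℝ) : lorentzNorm g p ∞ =
    ⨆ t : ℝ, ⨆ _ : 0 < t, ENNReal.ofReal t ^ (1 / p) * rearrangement g t := by
  simp [lorentzNorm]

theorem distribFun_antitone (g : Rn n → F) : Antitone (distribFun g) :=
  fun _ _ h => measure_mono fun _ hx => h.trans_lt hx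

/-- For r < d_g(s) no level below s is admissible in the infimum defining g*(r), so g*(r) ≥ s; then
r increases to d_g(s). -/
theorem distribFun_le_lorentzNorm (g : Rn n → F) {p : ℝ} (hp : 0 < p) {s : ℝ≥0∞} (hs : s ≠ 0)
    (hs' : s ≠ ∞) : distribFun g s ≤ (lorentzNorm g p ∞ / s) ^ p := by
  refine le_of_forall_lt_imp_le_of_dense fun r hr => ?_
  rcases eq_or_ne r 0 with rfl | hr0
  · exact zero_le
  have hrt : r ≠ ∞ := (hr.trans_le le_top).ne
  have h1 : s ≤ rearrangement g r.toReal := by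
    refine le_sInf fun s' hs' => ?_
    by_contra hcon
    have : distribFun g s ≤ r := ((distribFun_antitone g (not_le.1 hcon).le).trans hs').trans
      (ENNReal.ofReal_toReal hrt).le
    exact absurd hr (not_lt.2 this)
  have h2 : r ^ (1 / p) * s ≤ lorentzNorm g p ∞ := by
    rw [lorentzNorm_top]
    refine le_trans ?_ (le_iSup₂_of_le r.toReal (ENNReal.toReal_pos hr0 hrt) le_rfl)
    rw [ENNReal.ofReal_toReal hrt]
    gcongr
  rw [← ENNReal.le_div_iff_mul_le (.inl hs) (.inl hs'), one_div, ENNReal.rpow_inv_le_iff hp] at h2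
  exact h2

theorem mNorm_le_lorentzNorm {g : Rn n → F} (hg : StronglyMeasurable g) {p : ℝ} (hp : 1 < p) :
    mNorm volume (1 / p) (fun y => ‖g y‖ₑ) ≤
      ENNReal.ofReal (1 / (1 - 1 / p)) * lorentzNorm g p ∞ := by
  refine mNorm_le_of_weak hg.enorm (by positivity) ?_ fun s hs => ?_
  · rw [div_lt_one (by linarith)]; exact hp
  · rw [one_div_one_div]
    exact distribFun_le_lorentzNorm g (by linarith) (by simpa using hs) ENNReal.ofReal_ne_top

theorem lorentzNorm_le_mNorm {g : Rn n → F} (hg : StronglyMeasurable g) {p : ℝ} (hp : 0 < p) :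
    lorentzNorm g p ∞ ≤ mNorm volume (1 / p) (fun y => ‖g y‖ₑ) := by
  rw [lorentzNorm_top]
  refine iSup₂_le fun t ht => ?_
  have ht0 : ENNReal.ofReal t ^ (1 / p) ≠ 0 :=
    (ENNReal.rpow_pos (by simpa using ht) ENNReal.ofReal_ne_top).ne'
  have htt : ENNReal.ofReal t ^ (1 / p) ≠ ∞ :=
    ENNReal.rpow_ne_top_of_nonneg (by positivity) ENNReal.ofReal_ne_top
  rw [mul_comm, ← ENNReal.le_div_iff_mul_le (.inl ht0) (.inl htt)]
  refine le_of_forall_gt_imp_ge_of_dense fun s hs => ?_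
  rcases eq_or_ne s ∞ with rfl | hs'
  · exact le_top
  have hs0 : s ≠ 0 := (bot_le.trans_lt hs).ne'
  refine sInf_le ?_
  refine (measure_lt_le_mNorm (μ := volume) (x := 1 / p) (by positivity) hg.enorm hs0 hs').trans ?_
  rw [ENNReal.div_lt_iff (.inl ht0) (.inl htt)] at hs
  rw [one_div_one_div, ← ENNReal.le_rpow_inv_iff hp, ← one_div]
  refine ENNReal.div_le_of_le_mul ?_
  rw [mul_comm]
  exact hs.le

end LorentzEquiv

/-! ### Riesz potentials on weak Lebesgue spaces -/

section RieszPotential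

variable {n : ℕ}

/-- The kernel `|z|^{β-n}` of the Riesz potential of order `β`. -/
def rieszKernel (β : ℝ) (z : Rn n) : ℝ≥0∞ := ENNReal.ofReal (‖z‖ ^ (β - n))

theorem measurable_rieszKernel (β : ℝ) : Measurable (rieszKernel (n := n) β) := by
  unfold rieszKernel; fun_prop

theorem rieszKernel_sub_comm (β : ℝ) (x y : Rn n) :
    rieszKernel β (x - y) = rieszKernel β (y - x) := by
  simp [rieszKernel, norm_sub_rev]

/-- The Riesz potential of order `β`, up to a multiplicative constant. -/
def rieszPotential (β : ℝ) (f : Rn n → ℝ≥0∞) (x : Rn n) : ℝ≥0∞ :=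
  ∫⁻ y, rieszKernel β (x - y) * f y

theorem measurable_rieszKernel_sub_mul (β : ℝ) {f : Rn n → ℝ≥0∞} (hf : Measurable f) :
    Measurable fun p : Rn n × Rn n => rieszKernel β (p.1 - p.2) * f p.2 :=
  ((measurable_rieszKernel β).comp (measurable_fst.sub measurable_snd)).mul
    (hf.comp measurable_snd)

theorem measurable_rieszPotential (β : ℝ) {f : Rn n → ℝ≥0∞} (hf : Measurable f) :
    Measurable (rieszPotential β f) :=
  (measurable_rieszKernel_sub_mul β hf).lintegral_prod_right'

theorem lintegral_mul_rieszPotential (β : ℝ) {f g : Rn n → ℝ≥0∞} (hf : Measurable f)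
    (hg : Measurable g) :
    ∫⁻ x, g x * rieszPotential β f x = ∫⁻ x, f x * rieszPotential β g x := by
  unfold rieszPotential
  have h1 : ∀ f g : Rn n → ℝ≥0∞, Measurable f → ∀ x, g x * ∫⁻ y, rieszKernel β (x - y) * f y =
      ∫⁻ y, g x * (rieszKernel β (x - y) * f y) := fun f g hf x =>
    (lintegral_const_mul _ ((measurable_rieszKernel_sub_mul β hf).comp
      (measurable_const.prodMk measurable_id))).symm
  simp_rw [h1 f g hf, h1 g f hg]
  rw [lintegral_lintegral_swap]
  · refine lintegral_congr fun x => lintegral_congr fun y => ?_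
    rw [rieszKernel_sub_comm]; ring
  · exact ((hg.comp measurable_fst).mul (measurable_rieszKernel_sub_mul β hf)).aemeasurable

/-- The superlevel set lies in a ball of radius s^{-1/(n-β)}. Hence the kernel has reciprocal
exponent 1 - β/n, uniformly in the centre `x`. -/
theorem measure_rieszKernel_lt {β : ℝ} (hβ : β < n) (x : Rn n) {s : ℝ} (hs : 0 < s) :
    volume {y : Rn n | ENNReal.ofReal s < rieszKernel β (x - y)} ≤
      ENNReal.ofReal (s ^ (-(n / (n - β)))) * volume (Metric.ball (0 : Rn n) 1) := by
  have hnβ : 0 < (n : ℝ) - β := by linarith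
  have hsub : {y : Rn n | ENNReal.ofReal s < rieszKernel β (x - y)} ⊆
      Metric.closedBall x (s ^ (-(1 / (n - β)))) := by
    intro y hy
    rw [Set.mem_ofPred_eq, rieszKernel, ENNReal.ofReal_lt_ofReal_iff_of_nonneg hs.le] at hy
    rw [Metric.mem_closedBall, dist_comm, dist_eq_norm]
    have hpos : 0 < ‖x - y‖ := by
      rcases (norm_nonneg (x - y)).eq_or_lt with h | h
      · rw [← h, Real.zero_rpow (by linarith)] at hy; linarith
      · exact h
    have h1 : ‖x - y‖ ^ ((n : ℝ) - β) < s⁻¹ := by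
      rw [show (n : ℝ) - β = -(β - n) by ring, Real.rpow_neg hpos.le]
      exact (inv_lt_inv₀ (Real.rpow_pos_of_pos hpos _) hs).2 hy
    calc ‖x - y‖ = (‖x - y‖ ^ ((n : ℝ) - β)) ^ (1 / (n - β) : ℝ) := by
          rw [← Real.rpow_mul hpos.le, mul_one_div_cancel hnβ.ne', Real.rpow_one]
      _ ≤ (s⁻¹) ^ (1 / (n - β) : ℝ) := by gcongr
      _ = _ := by rw [Real.inv_rpow hs.le, Real.rpow_neg hs.le]
  refine (measure_mono hsub).trans (le_of_eq ?_)
  rw [Measure.addHaar_closedBall _ _ (by positivity), finrank_euclideanSpace_fin]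
  congr 2
  rw [← Real.rpow_natCast, ← Real.rpow_mul hs.le]
  congr 1; ring

theorem exists_mNorm_rieszKernel_le {β : ℝ} (hβ : 0 < β) (hβn : β < n) :
    ∃ B : ℝ≥0, ∀ x : Rn n, mNorm volume (1 - β / n) (fun y => rieszKernel β (x - y)) ≤ B := by
  have hn : (0 : ℝ) < n := by linarith
  have hb : 0 < β / n := by positivity
  have hb1 : β / n < 1 := by rw [div_lt_one hn]; exact hβn
  set ω := volume (Metric.ball (0 : Rn n) 1) with hω
  have hωt : ω ≠ ∞ := measure_ball_lt_top.ne
  have hK : ENNReal.ofReal (1 / (1 - (1 - β / n))) * ω ^ (1 - β / n) ≠ ∞ :=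
    ENNReal.mul_ne_top ENNReal.ofReal_ne_top (ENNReal.rpow_ne_top_of_nonneg (by linarith) hωt)
  refine ⟨_, fun x => (mNorm_le_of_weak (K := ω ^ (1 - β / n)) ((measurable_rieszKernel β).comp
    (measurable_const.sub measurable_id)) (by linarith) (by linarith) fun s hs => ?_).trans
      (ENNReal.coe_toNNReal hK).ge⟩
  refine (measure_rieszKernel_lt hβn x hs).trans (le_of_eq ?_)
  have h1 : 0 < 1 - β / n := by linarith
  have h2 : (n : ℝ) - β ≠ 0 := by linarith
  rw [div_ofReal_rpow hs _ (by positivity), ← ENNReal.rpow_mul, mul_one_div_cancel h1.ne',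
    ENNReal.rpow_one, mul_comm]
  congr 3
  field_simp

/-- The Hardy–Littlewood–Sobolev inequality in weak spaces. -/
theorem exists_mNorm_rieszPotential_le {β x : ℝ} (hβ : 0 < β) (hβn : β < n) (hx : β / n < x)
    (hx1 : x ≤ 1) : ∃ C : ℝ≥0, ∀ f : Rn n → ℝ≥0∞, Measurable f →
      mNorm volume (x - β / n) (rieszPotential β f) ≤ C * mNorm volume x f := by
  obtain ⟨B, hB⟩ := exists_mNorm_rieszKernel_le hβ hβn
  have hn : (0 : ℝ) < n := by linarith
  set b := β / n with hb
  have hb0 : 0 < b := by positivity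
  have hb1 : b < 1 := by rw [hb, div_lt_one hn]; exact hβn
  set γ := (1 - x) / (1 - b) with hγ
  have hγ0 : 0 ≤ γ := div_nonneg (by linarith) (by linarith)
  have hγ1 : γ < 1 := by rw [hγ, div_lt_one (by linarith)]; linarith
  -- Test on E and move the potential onto the indicator by symmetry. The potential of 1_E is
  -- bounded by B|E|^b and has norm at most B|E| at 1 - b, so the duality estimate applies; γ < 1 is
  -- the hypothesis b < x.
  refine ⟨B * (1 / (1 - γ)).toNNReal, fun f hf => mNorm_le fun E hE hE0 hE' => ?_⟩
  have hind : Measurable (E.indicator (1 : Rn n → ℝ≥0∞)) := measurable_one.indicator hE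
  have hkE : ∀ G : Set (Rn n), MeasurableSet G → ∀ z, rieszPotential β (G.indicator 1) z =
      ∫⁻ y in G, rieszKernel β (z - y) := by
    intro G hG z
    rw [rieszPotential, ← lintegral_indicator hG]
    refine lintegral_congr fun y => ?_
    by_cases hy : y ∈ G <;> simp [hy]
  have hsup : ∀ G : Set (Rn n), MeasurableSet G → volume G ≠ ∞ → ∀ z,
      rieszPotential β (G.indicator 1) z ≤ B * volume G ^ b := by
    intro G hG hG' z
    rw [hkE G hG]
    refine (setLIntegral_le_mNorm (1 - b) _ hG hG').trans ?_
    rw [sub_sub_cancel]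
    gcongr
    exact hB z
  have hset : ∀ (G : Set (Rn n)) (g : Rn n → ℝ≥0∞), MeasurableSet G →
      ∫⁻ z in G, g z = ∫⁻ z, (G.indicator 1 z) * g z := by
    intro G g hG
    rw [← lintegral_indicator hG]
    refine lintegral_congr fun y => ?_
    by_cases hy : y ∈ G <;> simp [hy]
  -- Symmetry once more: the sup bound is applied to the potential of 1_G, integrated over E.
  have hw : mNorm volume (1 - b) (rieszPotential β (E.indicator 1)) ≤ B * volume E := by
    refine mNorm_le fun G hG hG0 hG' => ?_
    rw [hset G _ hG, lintegral_mul_rieszPotential β hind (measurable_one.indicator hG),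
      ← hset E _ hE, sub_sub_cancel]
    refine (setLIntegral_mono measurable_const fun z _ => hsup G hG hG' z).trans ?_
    rw [setLIntegral_const]
    exact le_of_eq (by ring)
  have hMfin : (B : ℝ≥0∞) * volume E ^ b ≠ ∞ :=
    ENNReal.mul_ne_top ENNReal.coe_ne_top (ENNReal.rpow_ne_top_of_nonneg hb0.le hE')
  have key := lintegral_mul_le_mNorm (μ := volume) hf (measurable_rieszPotential β hind) hx1
    (y := 1 - b) (by linarith) hγ hγ1 (M := ((B : ℝ≥0∞) * volume E ^ b).toReal)
    ENNReal.toReal_nonneg (fun z => by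
      rw [ENNReal.ofReal_toReal hMfin]; exact hsup E hE hE' z)
    (ENNReal.mul_ne_top ENNReal.coe_ne_top hE') hw
  rw [hset E _ hE, lintegral_mul_rieszPotential β hf hind]
  refine key.trans (le_of_eq ?_)
  rw [div_eq_mul_one_div, ENNReal.ofReal_mul (by positivity),
    ← ENNReal.ofReal_rpow_of_nonneg ENNReal.toReal_nonneg (by linarith), ENNReal.ofReal_toReal hMfin,
    ENNReal.mul_rpow_of_nonneg _ _ hγ0, ENNReal.mul_rpow_of_nonneg _ _ (by linarith : 0 ≤ 1 - γ),
    ← ENNReal.rpow_mul]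
  have e1 : (B : ℝ≥0∞) ^ γ * (B : ℝ≥0∞) ^ (1 - γ) = B := by
    rw [← ENNReal.rpow_add_of_nonneg _ _ hγ0 (by linarith)]; simp
  have e2 : volume E ^ γ * volume E ^ (b * (1 - γ)) = volume E ^ (1 - (x - b)) := by
    rw [← ENNReal.rpow_add _ _ hE0 hE']
    congr 1
    have : γ * (1 - b) = 1 - x := by rw [hγ]; exact div_mul_cancel₀ _ (by linarith)
    linarith
  have e3 : ((1 / (1 - γ)).toNNReal : ℝ≥0∞) = ENNReal.ofReal (1 / (1 - γ)) := rfl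
  rw [ENNReal.coe_mul, e3]
  calc _ = ((B : ℝ≥0∞) ^ γ * (B : ℝ≥0∞) ^ (1 - γ)) * ENNReal.ofReal (1 / (1 - γ)) *
        mNorm volume x f * (volume E ^ γ * volume E ^ (b * (1 - γ))) := by ring
    _ = _ := by rw [e1, e2]

end RieszPotential

/-! ### Convolution with dilated Schwartz kernels -/

section DilatedConvolution

variable {n : ℕ}

/-- The convolution of `φ` with the `L¹`-normalized dilation of `γ` by `t`. -/
def dilConv (γ φ : 𝓢(Rn n, ℂ)) (t : ℝ) (x : Rn n) : ℂ := ∫ z, γ z * φ (x - t • z)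

/-- Fubini links two descriptions: on the Fourier side cutoffs act exactly on symbols, while on the
convolution side L¹ and sup bounds are elementary. -/
theorem fourierInv_dilate_mul (γ φ : 𝓢(Rn n, ℂ)) (t : ℝ) (x : Rn n) :
    𝓕⁻ (fun ξ : Rn n => 𝓕 γ (t • ξ) * 𝓕 φ ξ) x = dilConv γ φ t x := by
  have h1 : ∀ z, φ (x - t • z) = ∫ ξ, Real.fourierChar (inner ℝ ξ (x - t • z)) • 𝓕 φ ξ := by
    intro z
    rw [← Real.fourierInv_eq, ← SchwartzMap.fourierInv_coe, FourierTransform.fourierInv_fourier_eq]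
  have h2 : ∀ ξ, 𝓕 γ (t • ξ) = ∫ z, Real.fourierChar (-(inner ℝ z (t • ξ))) • γ z := by
    intro ξ
    rw [← Real.fourier_eq, ← SchwartzMap.fourier_coe]
  rw [dilConv, Real.fourierInv_eq]
  simp_rw [h1, h2, Circle.smul_def, smul_eq_mul, ← integral_mul_const, ← integral_const_mul]
  rw [integral_integral_swap]
  · refine integral_congr_ae (.of_forall fun z => integral_congr_ae (.of_forall fun ξ => ?_))
    have : inner ℝ ξ (x - t • z) = inner ℝ ξ x + -(inner ℝ z (t • ξ)) := by
      rw [inner_sub_right, inner_smul_right, inner_smul_right, real_inner_comm ξ z]; ring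
    simp only [this, AddChar.map_add_eq_mul, Circle.coe_mul]
    ring
  · have hi : Integrable (fun p : Rn n × Rn n => 𝓕 φ p.1 * γ p.2) (volume.prod volume) :=
      (𝓕 φ).integrable.mul_prod γ.integrable
    refine hi.mono ?_ (.of_forall fun p => ?_)
    · refine Continuous.aestronglyMeasurable ?_
      have := (𝓕 φ).continuous
      have := γ.continuous
      have := Real.continuous_fourierChar
      simp only [Function.uncurry_def]
      fun_prop
    · simp only [Function.uncurry, norm_mul, Circle.norm_coe, one_mul]
      exact (mul_comm _ _).le

theorem measurable_dilConv (γ φ : 𝓢(Rn n, ℂ)) :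
    StronglyMeasurable fun p : ℝ × Rn n => dilConv γ φ p.1 p.2 := by
  have h : Continuous fun q : (ℝ × Rn n) × Rn n => γ q.2 * φ (q.1.2 - q.1.1 • q.2) := by
    have := φ.continuous
    have := γ.continuous
    fun_prop
  exact h.stronglyMeasurable.integral_prod_right

/-- Young's inequality; the point is that the bound does not depend on `t`. -/
theorem lintegral_dilConv_le (γ φ : 𝓢(Rn n, ℂ)) (t : ℝ) :
    ∫⁻ x, ‖dilConv γ φ t x‖ₑ ≤ (∫⁻ z, ‖γ z‖ₑ) * ∫⁻ x, ‖φ x‖ₑ := by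
  have hφ := φ.continuous
  have hγ := γ.continuous
  calc ∫⁻ x, ‖dilConv γ φ t x‖ₑ ≤ ∫⁻ x, ∫⁻ z, ‖γ z‖ₑ * ‖φ (x - t • z)‖ₑ := by
        refine lintegral_mono fun x => (enorm_integral_le_lintegral_enorm _).trans (le_of_eq ?_)
        simp_rw [enorm_mul]
    _ = ∫⁻ z, ∫⁻ x, ‖γ z‖ₑ * ‖φ (x - t • z)‖ₑ := by
        refine lintegral_lintegral_swap (Continuous.aemeasurable ?_)
        rw [Function.uncurry_def]
        have h1 : Continuous fun p : Rn n × Rn n => γ p.2 * φ (p.1 - t • p.2) := by fun_prop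
        simpa only [← enorm_mul] using h1.enorm
    _ = _ := by
        rw [← lintegral_mul_const _ (by fun_prop)]
        refine lintegral_congr fun z => ?_
        rw [lintegral_const_mul _ (Continuous.measurable (by fun_prop)), lintegral_sub_right_eq_self (fun x => ‖φ x‖ₑ)]

theorem lintegral_enorm_schwartz_lt_top (φ : 𝓢(Rn n, ℂ)) : ∫⁻ x, ‖φ x‖ₑ < ∞ :=
  φ.integrable.2

end DilatedConvolution

/-! ### Radial cutoffs and their Mellin integrals -/

section Cutoff

/-- A smooth function on the half-line, equal to `s ^ (2k)` near the origin and vanishing for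
`s ≥ 2`. -/
def cutoffProfile (k : ℕ) (s : ℝ) : ℝ := (s ^ 2) ^ k * Real.smoothTransition (2 - s ^ 2)

theorem cutoffProfile_nonneg (k : ℕ) (s : ℝ) : 0 ≤ cutoffProfile k s :=
  mul_nonneg (by positivity) (Real.smoothTransition.nonneg _)

theorem cutoffProfile_le (k : ℕ) (s : ℝ) : cutoffProfile k s ≤ (s ^ 2) ^ k :=
  mul_le_of_le_one_right (by positivity) (Real.smoothTransition.le_one _)

theorem cutoffProfile_eq_zero (k : ℕ) {s : ℝ} (hs : 2 ≤ s ^ 2) : cutoffProfile k s = 0 := by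
  rw [cutoffProfile, Real.smoothTransition.zero_of_nonpos (by linarith), mul_zero]

theorem cutoffProfile_eq (k : ℕ) {s : ℝ} (hs : s ^ 2 ≤ 1) : cutoffProfile k s = (s ^ 2) ^ k := by
  rw [cutoffProfile, Real.smoothTransition.one_of_one_le (by linarith), mul_one]

theorem continuous_cutoffProfile (k : ℕ) : Continuous (cutoffProfile k) := by
  have := Real.smoothTransition.continuous
  unfold cutoffProfile
  fun_prop

variable {n : ℕ}

theorem contDiff_cutoffProfile_norm (k : ℕ) :
    ContDiff ℝ (⊤ : ℕ∞) fun ξ : Rn n => ((cutoffProfile k ‖ξ‖ : ℝ) : ℂ) := by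
  have h : ContDiff ℝ (⊤ : ℕ∞) fun ξ : Rn n => ‖ξ‖ ^ 2 := contDiff_norm_sq ℝ
  refine Complex.ofRealCLM.contDiff.comp ?_
  exact (h.pow k).mul (Real.smoothTransition.contDiff.comp (contDiff_const.sub h))

theorem hasCompactSupport_cutoffProfile_norm (k : ℕ) :
    HasCompactSupport fun ξ : Rn n => ((cutoffProfile k ‖ξ‖ : ℝ) : ℂ) := by
  refine HasCompactSupport.intro (isCompact_closedBall 0 2) fun ξ hξ => ?_
  rw [cutoffProfile_eq_zero, Complex.ofReal_zero]
  rw [mem_closedBall_zero_iff, not_le] at hξ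
  nlinarith

/-- The radial cutoff `ξ ↦ cutoffProfile k ‖ξ‖` as a Schwartz function. -/
def radialCutoff (n k : ℕ) : 𝓢(Rn n, ℂ) :=
  (hasCompactSupport_cutoffProfile_norm k).toSchwartzMap (contDiff_cutoffProfile_norm k)

theorem radialCutoff_apply (k : ℕ) (ξ : Rn n) : radialCutoff n k ξ = (cutoffProfile k ‖ξ‖ : ℝ) := rfl

theorem integrableOn_cutoffProfile {α : ℝ} {k : ℕ} (hk : α < 2 * k) :
    IntegrableOn (fun s : ℝ => s ^ (-α - 1) * cutoffProfile k s) (Set.Ioi 0) := by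
  have hi : IntegrableOn (fun s : ℝ => s ^ (2 * k - α - 1)) (Set.Ioc 0 2) := by
    rw [← intervalIntegrable_iff_integrableOn_Ioc_of_le (by norm_num)]
    exact intervalIntegral.intervalIntegrable_rpow' (by linarith)
  have hm : Measurable fun s : ℝ => s ^ (-α - 1) * cutoffProfile k s :=
    (measurable_id.pow_const _).mul (continuous_cutoffProfile k).measurable
  rw [← Set.Ioc_union_Ioi_eq_Ioi (show (0 : ℝ) ≤ 2 by norm_num)]
  refine IntegrableOn.union ?_ ?_
  · refine hi.mono' hm.aestronglyMeasurable ?_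
    filter_upwards [ae_restrict_mem measurableSet_Ioc] with s hs
    rw [Real.norm_of_nonneg (mul_nonneg (Real.rpow_nonneg hs.1.le _) (cutoffProfile_nonneg k s))]
    calc s ^ (-α - 1) * cutoffProfile k s ≤ s ^ (-α - 1) * (s ^ 2) ^ k := by
          gcongr
          · exact Real.rpow_nonneg hs.1.le _
          · exact cutoffProfile_le k s
      _ = _ := by
          rw [← pow_mul, ← Real.rpow_natCast, ← Real.rpow_add hs.1]
          congr 1; push_cast; ring
  · refine (integrableOn_zero (μ := volume) (s := Set.Ioi (2 : ℝ))).congr_fun (fun s hs => ?_)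
      measurableSet_Ioi
    have hs' : (2 : ℝ) < s := hs
    rw [cutoffProfile_eq_zero k (by nlinarith), mul_zero]

theorem integral_cutoffProfile_pos {α : ℝ} {k : ℕ} (hk : α < 2 * k) :
    0 < ∫ s in Set.Ioi (0 : ℝ), s ^ (-α - 1) * cutoffProfile k s := by
  have h0 : ∀ s ∈ Set.Ioi (0 : ℝ), 0 ≤ s ^ (-α - 1) * cutoffProfile k s := fun s hs =>
    mul_nonneg (Real.rpow_nonneg (le_of_lt hs) _) (cutoffProfile_nonneg k s)
  rw [setIntegral_pos_iff_support_of_nonneg_ae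
    ((ae_restrict_iff' measurableSet_Ioi).2 (.of_forall h0)) (integrableOn_cutoffProfile hk)]
  refine lt_of_lt_of_le ?_ (measure_mono (s := Set.Ioo (0 : ℝ) 1) ?_)
  · simp
  · intro s hs
    refine ⟨?_, hs.1⟩
    rw [Function.mem_support, cutoffProfile_eq k (by nlinarith [hs.1, hs.2])]
    have := hs.1
    positivity

/-- Scaling s = tr; the factor r^α so produced is the symbol of the fractional Laplacian. At r = 0
both sides vanish because 0 < α < 2k forces k ≥ 1. -/
theorem integral_cutoffProfile_dilate {α : ℝ} (hα : 0 < α) {k : ℕ} (hk : α < 2 * k) {r : ℝ}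
    (hr : 0 ≤ r) : ∫ t in Set.Ioi (0 : ℝ), t ^ (-α - 1) * cutoffProfile k (t * r) =
      r ^ α * ∫ s in Set.Ioi (0 : ℝ), s ^ (-α - 1) * cutoffProfile k s := by
  rcases hr.eq_or_lt with rfl | hr
  · have hk0 : k ≠ 0 := by rintro rfl; norm_num at hk; linarith
    simp [cutoffProfile, hk0, Real.zero_rpow hα.ne']
  have h := integral_comp_mul_right_Ioi (fun s : ℝ => s ^ (-α - 1) * cutoffProfile k s) 0 hr
  rw [zero_mul, smul_eq_mul] at h
  have h2 : ∫ t in Set.Ioi (0 : ℝ), t ^ (-α - 1) * cutoffProfile k (t * r) =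
      r ^ (α + 1) * ∫ t in Set.Ioi (0 : ℝ), (t * r) ^ (-α - 1) * cutoffProfile k (t * r) := by
    rw [← integral_const_mul]
    refine setIntegral_congr_fun measurableSet_Ioi fun t ht => ?_
    have ht' : (0 : ℝ) < t := ht
    rw [Real.mul_rpow ht'.le hr.le, show -α - 1 = -(α + 1) by ring, Real.rpow_neg hr.le]
    field_simp
  rw [h2, h, ← mul_assoc]
  congr 1
  rw [Real.rpow_add hr, Real.rpow_one]
  field_simp

theorem integrableOn_cutoffProfile_dilate {α : ℝ} (hα : 0 < α) {k : ℕ} (hk : α < 2 * k) {r : ℝ}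
    (hr : 0 ≤ r) :
    IntegrableOn (fun t : ℝ => t ^ (-α - 1) * cutoffProfile k (t * r)) (Set.Ioi 0) := by
  rcases hr.eq_or_lt with rfl | hr
  · have hk0 : k ≠ 0 := by rintro rfl; norm_num at hk; linarith
    simp [cutoffProfile, hk0]
  have h := (integrableOn_Ioi_comp_mul_right_iff
    (fun s : ℝ => s ^ (-α - 1) * cutoffProfile k s) 0 hr).2
      (by rw [zero_mul]; exact integrableOn_cutoffProfile hk)
  refine IntegrableOn.congr_fun (h.const_mul (r ^ (α + 1))) (fun t ht => ?_) measurableSet_Ioi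
  have ht' : (0 : ℝ) < t := ht
  rw [Real.mul_rpow ht'.le hr.le, show -α - 1 = -(α + 1) by ring, Real.rpow_neg hr.le]
  field_simp

end Cutoff

/-! ### The fractional Laplacian maps Schwartz functions into L¹ ∩ L^∞ -/

section FractionalLaplacian

variable {n : ℕ}

/-- The symbol of the fractional Laplacian times the Fourier transform of `φ`. -/
def fracSymbol (α : ℝ) (φ : 𝓢(Rn n, ℂ)) (ξ : Rn n) : ℂ :=
  ((2 * Real.pi * ‖ξ‖) ^ α : ℝ) • 𝓕 (φ : Rn n → ℂ) ξ

theorem fracLaplacian_eq (α : ℝ) (φ : 𝓢(Rn n, ℂ)) : fracLaplacian α φ = 𝓕⁻ (fracSymbol α φ) := rfl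

theorem integrable_norm_rpow_mul_schwartz {s : ℝ} (hs : 0 ≤ s) (φ : 𝓢(Rn n, ℂ)) :
    Integrable fun ξ : Rn n => ‖ξ‖ ^ s * ‖φ ξ‖ := by
  obtain ⟨k, hk⟩ := exists_nat_ge s
  have hφ := φ.continuous
  refine ((φ.integrable_pow_mul volume 0).add (φ.integrable_pow_mul volume k)).mono
    (Continuous.aestronglyMeasurable ?_) (.of_forall fun ξ => ?_)
  · exact (Real.continuous_rpow_const hs |>.comp continuous_norm).mul hφ.norm
  · rw [Real.norm_of_nonneg (by positivity), Pi.add_apply, Real.norm_of_nonneg (by positivity),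
      ← add_mul, pow_zero]
    gcongr
    rcases le_total ‖ξ‖ 1 with h | h
    · exact (Real.rpow_le_one (norm_nonneg _) h hs).trans (by simp)
    · calc ‖ξ‖ ^ s ≤ ‖ξ‖ ^ (k : ℝ) := Real.rpow_le_rpow_of_exponent_le h hk
        _ ≤ _ := by rw [Real.rpow_natCast]; linarith

theorem continuous_fracSymbol {α : ℝ} (hα : 0 ≤ α) (φ : 𝓢(Rn n, ℂ)) :
    Continuous (fracSymbol α φ) := by
  have h1 : Continuous fun ξ : Rn n => (2 * Real.pi * ‖ξ‖) ^ α :=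
    (Real.continuous_rpow_const hα).comp (by fun_prop)
  exact h1.smul (𝓕 φ).continuous

theorem integrable_fracSymbol {α : ℝ} (hα : 0 ≤ α) (φ : 𝓢(Rn n, ℂ)) :
    Integrable (fracSymbol α φ) := by
  refine ((integrable_norm_rpow_mul_schwartz hα (𝓕 φ)).const_mul ((2 * Real.pi) ^ α)).mono
    (continuous_fracSymbol hα φ).aestronglyMeasurable (.of_forall fun ξ => le_of_eq ?_)
  rw [fracSymbol, norm_smul, Real.norm_of_nonneg (by positivity),
    Real.mul_rpow (by positivity) (norm_nonneg _), Real.norm_of_nonneg (by positivity)]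
  ring_nf
  rfl

theorem continuous_fracLaplacian {α : ℝ} (hα : 0 ≤ α) (φ : 𝓢(Rn n, ℂ)) :
    Continuous (fracLaplacian α φ) := by
  rw [fracLaplacian_eq]
  have h := VectorFourier.fourierIntegral_continuous (μ := (volume : Measure (Rn n)))
    Real.continuous_fourierChar (L := innerₗ (Rn n)) continuous_inner (integrable_fracSymbol hα φ)
  have h2 : 𝓕⁻ (fracSymbol α φ) = fun x => 𝓕 (fracSymbol α φ) (-x) := by
    ext x; exact Real.fourierInv_eq_fourier_neg _ _
  rw [h2]
  exact h.comp continuous_neg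

theorem enorm_fracLaplacian_le {α : ℝ} (φ : 𝓢(Rn n, ℂ)) (x : Rn n) :
    ‖fracLaplacian α φ x‖ₑ ≤ ∫⁻ ξ, ‖fracSymbol α φ ξ‖ₑ := by
  rw [fracLaplacian_eq, Real.fourierInv_eq]
  refine (enorm_integral_le_lintegral_enorm _).trans (le_of_eq (lintegral_congr fun ξ => ?_))
  rw [Circle.smul_def, enorm_smul, show ‖(Real.fourierChar (inner ℝ ξ x) : ℂ)‖ₑ = 1 by
    rw [← ofReal_norm, Circle.norm_coe, ENNReal.ofReal_one], one_mul]

theorem fourier_radialCutoff (k : ℕ) (ξ : Rn n) :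
    𝓕 (𝓕⁻ (radialCutoff n k)) ξ = (cutoffProfile k ‖ξ‖ : ℝ) := by
  rw [FourierTransform.fourier_fourierInv_eq, radialCutoff_apply]

theorem cutoffProfile_dilate (k : ℕ) (t r : ℝ) :
    cutoffProfile k (t * r) = t ^ (2 * k) * ((r ^ 2) ^ k * cutoffProfile 0 (t * r)) := by
  simp only [cutoffProfile, mul_pow, pow_zero, one_mul, ← pow_mul]
  ring

/-- The fractional Laplacian is an average of frequency-localized dilations. -/
theorem integral_dilConv_radialCutoff {α : ℝ} (hα : 0 < α) {k : ℕ} (hk : α < 2 * k)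
    (φ : 𝓢(Rn n, ℂ)) (x : Rn n) :
    ∫ t in Set.Ioi (0 : ℝ), ((t ^ (-α - 1) : ℝ) : ℂ) * dilConv (𝓕⁻ (radialCutoff n k)) φ t x =
      (((2 * Real.pi) ^ (-α) * ∫ s in Set.Ioi (0 : ℝ), s ^ (-α - 1) * cutoffProfile k s : ℝ) : ℂ) *
        fracLaplacian α φ x := by
  set d := ∫ s in Set.Ioi (0 : ℝ), s ^ (-α - 1) * cutoffProfile k s with hd
  have hφ : Continuous ⇑(𝓕 φ : 𝓢(Rn n, ℂ)) := (𝓕 φ).continuous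
  have hc := continuous_cutoffProfile k
  have hch := Real.continuous_fourierChar
  have hint : Integrable (fun p : ℝ × Rn n => (Real.fourierChar (inner ℝ p.2 x) : ℂ) *
      (((p.1 ^ (-α - 1) * cutoffProfile k (p.1 * ‖p.2‖) : ℝ) : ℂ) * 𝓕 φ p.2))
      ((volume.restrict (Set.Ioi 0)).prod volume) := by
    have hmeas : Measurable (fun p : ℝ × Rn n => (Real.fourierChar (inner ℝ p.2 x) : ℂ) *
      (((p.1 ^ (-α - 1) * cutoffProfile k (p.1 * ‖p.2‖) : ℝ) : ℂ) * 𝓕 φ p.2)) := by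
      have h1 : Measurable fun p : ℝ × Rn n => (Real.fourierChar (inner ℝ p.2 x) : ℂ) :=
        Continuous.measurable (by fun_prop)
      have h2 : Measurable fun p : ℝ × Rn n => cutoffProfile k (p.1 * ‖p.2‖) :=
        Continuous.measurable (by fun_prop)
      have h3 : Measurable fun p : ℝ × Rn n => 𝓕 φ p.2 := Continuous.measurable (by fun_prop)
      exact h1.mul ((Complex.measurable_ofReal.comp ((measurable_fst.pow_const _).mul h2)).mul h3)
    have hn : ∀ p : ℝ × Rn n, 0 < p.1 → ‖(Real.fourierChar (inner ℝ p.2 x) : ℂ) *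
      (((p.1 ^ (-α - 1) * cutoffProfile k (p.1 * ‖p.2‖) : ℝ) : ℂ) * 𝓕 φ p.2)‖ =
        (p.1 ^ (-α - 1) * cutoffProfile k (p.1 * ‖p.2‖)) * ‖𝓕 φ p.2‖ := by
      intro p hp
      rw [norm_mul, norm_mul, Circle.norm_coe, one_mul, Complex.norm_real, Real.norm_of_nonneg
        (mul_nonneg (Real.rpow_nonneg hp.le _) (cutoffProfile_nonneg _ _))]
    rw [integrable_prod_iff' hmeas.aestronglyMeasurable]
    constructor
    · refine .of_forall fun ξ => ?_
      have h1 : Integrable (fun t : ℝ => ((t ^ (-α - 1) * cutoffProfile k (t * ‖ξ‖) : ℝ) : ℂ))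
          (volume.restrict (Set.Ioi 0)) := Complex.ofRealCLM.integrable_comp
        (integrableOn_cutoffProfile_dilate hα hk (norm_nonneg ξ))
      exact (h1.mul_const (𝓕 φ ξ)).const_mul (Real.fourierChar (inner ℝ ξ x) : ℂ)
    · refine ((integrable_norm_rpow_mul_schwartz hα.le (𝓕 φ)).const_mul d).congr
        (.of_forall fun ξ => ?_)
      simp only
      rw [setIntegral_congr_fun (g := fun t => t ^ (-α - 1) * cutoffProfile k (t * ‖ξ‖) * ‖𝓕 φ ξ‖)
        measurableSet_Ioi (fun t ht => hn (t, ξ) ht), integral_mul_const,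
        integral_cutoffProfile_dilate hα hk (norm_nonneg ξ)]
      ring
  calc _ = ∫ t in Set.Ioi (0 : ℝ), ∫ ξ, (Real.fourierChar (inner ℝ ξ x) : ℂ) *
      (((t ^ (-α - 1) * cutoffProfile k (t * ‖ξ‖) : ℝ) : ℂ) * 𝓕 φ ξ) := by
        refine setIntegral_congr_fun measurableSet_Ioi fun t ht => ?_
        have ht' : (0 : ℝ) < t := ht
        rw [← fourierInv_dilate_mul, Real.fourierInv_eq, ← integral_const_mul]
        refine integral_congr_ae (.of_forall fun ξ => ?_)
        simp only [fourier_radialCutoff, Circle.smul_def, norm_smul, smul_eq_mul,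
          Real.norm_of_nonneg ht'.le]
        push_cast; ring
    _ = ∫ ξ, ∫ t in Set.Ioi (0 : ℝ), (Real.fourierChar (inner ℝ ξ x) : ℂ) *
      (((t ^ (-α - 1) * cutoffProfile k (t * ‖ξ‖) : ℝ) : ℂ) * 𝓕 φ ξ) :=
        integral_integral_swap hint
    _ = _ := by
        rw [fracLaplacian_eq, Real.fourierInv_eq, ← integral_const_mul]
        refine integral_congr_ae (.of_forall fun ξ => ?_)
        simp only
        rw [integral_const_mul, integral_mul_const, integral_complex_ofReal,
          integral_cutoffProfile_dilate hα hk (norm_nonneg ξ), Circle.smul_def, smul_eq_mul,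
          fracSymbol, Real.mul_rpow (by positivity) (norm_nonneg _), Complex.real_smul, ← hd,
          Real.rpow_neg (by positivity), SchwartzMap.fourier_coe]
        have hp : (((2 * Real.pi) ^ α : ℝ) : ℂ) ≠ 0 :=
          Complex.ofReal_ne_zero.2 (by positivity)
        push_cast at hp ⊢
        field_simp

/-- The factor |tξ|^{2k} of the cutoff is divided: t^{2k} comes out as a gain for small `t`, and
|ξ|^{2k} is moved onto `φ`. -/
theorem dilConv_radialCutoff (k : ℕ) (φ : 𝓢(Rn n, ℂ)) {t : ℝ} (ht : 0 ≤ t) (x : Rn n) :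
    dilConv (𝓕⁻ (radialCutoff n k)) φ t x = ((t ^ (2 * k) : ℝ) : ℂ) *
      dilConv (𝓕⁻ (radialCutoff n 0))
        (𝓕⁻ (SchwartzMap.smulLeftCLM ℂ (fun ξ : Rn n => (‖ξ‖ ^ 2) ^ k) (𝓕 φ))) t x := by
  rw [← fourierInv_dilate_mul, ← fourierInv_dilate_mul, Real.fourierInv_eq, Real.fourierInv_eq,
    ← integral_const_mul]
  refine integral_congr_ae (.of_forall fun ξ => ?_)
  have hg : Function.HasTemperateGrowth fun ξ : Rn n => (‖ξ‖ ^ 2) ^ k :=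
    (Function.hasTemperateGrowth_norm_sq (Rn n)).pow k
  simp only [radialCutoff_apply, Circle.smul_def, norm_smul, smul_eq_mul,
    Real.norm_of_nonneg ht, FourierTransform.fourier_fourierInv_eq,
    SchwartzMap.smulLeftCLM_apply_apply hg, cutoffProfile_dilate k, Complex.real_smul]
  push_cast; ring

/-- The symbol |ξ|^α need not be smooth at the origin, so Schwartz decay is not available. In the
average over dilations the pieces have L¹ norm of order t^{2k-α-1} for t ≤ 1 and t^{-α-1} for t > 1,
both integrable. Together with boundedness this permits pairing with any function of weak reciprocal
exponent in (0, 1]. -/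
theorem integrable_fracLaplacian {α : ℝ} (hα : 0 < α) (φ : 𝓢(Rn n, ℂ)) :
    Integrable (fracLaplacian α φ) := by
  refine ⟨(continuous_fracLaplacian hα.le φ).aestronglyMeasurable, ?_⟩
  obtain ⟨k, hk⟩ := exists_nat_gt α
  replace hk : α < 2 * k := by linarith
  set γ : 𝓢(Rn n, ℂ) := 𝓕⁻ (radialCutoff n k)
  set c := (2 * Real.pi) ^ (-α) * ∫ s in Set.Ioi (0 : ℝ), s ^ (-α - 1) * cutoffProfile k s with hc
  have hc0 : 0 < c := mul_pos (by positivity) (integral_cutoffProfile_pos hk)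
  have hcE : ENNReal.ofReal c ≠ 0 := by simpa using hc0
  set φ' : 𝓢(Rn n, ℂ) := 𝓕⁻ (SchwartzMap.smulLeftCLM ℂ (fun ξ : Rn n => (‖ξ‖ ^ 2) ^ k) (𝓕 φ))
  set γ' : 𝓢(Rn n, ℂ) := 𝓕⁻ (radialCutoff n 0)
  set A := (∫⁻ z, ‖γ z‖ₑ) * ∫⁻ x, ‖φ x‖ₑ
  set A' := (∫⁻ z, ‖γ' z‖ₑ) * ∫⁻ x, ‖φ' x‖ₑ
  have hA : A < ∞ := ENNReal.mul_lt_top (lintegral_enorm_schwartz_lt_top _)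
    (lintegral_enorm_schwartz_lt_top _)
  have hA' : A' < ∞ := ENNReal.mul_lt_top (lintegral_enorm_schwartz_lt_top _)
    (lintegral_enorm_schwartz_lt_top _)
  suffices h : ENNReal.ofReal c * ∫⁻ x, ‖fracLaplacian α φ x‖ₑ < ∞ from
    ENNReal.lt_top_of_mul_ne_top_right h.ne hcE
  have hmeas : Measurable fun p : Rn n × ℝ => ENNReal.ofReal (p.2 ^ (-α - 1)) *
      ‖dilConv γ φ p.2 p.1‖ₑ := by
    have h1 := (measurable_dilConv γ φ).measurable.comp measurable_swap
    exact (ENNReal.measurable_ofReal.comp (measurable_snd.pow_const _)).mul h1.enorm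
  calc ENNReal.ofReal c * ∫⁻ x, ‖fracLaplacian α φ x‖ₑ
      = ∫⁻ x, ‖∫ t in Set.Ioi (0 : ℝ), ((t ^ (-α - 1) : ℝ) : ℂ) * dilConv γ φ t x‖ₑ := by
        rw [← lintegral_const_mul _ (continuous_fracLaplacian hα.le φ).enorm.measurable]
        refine lintegral_congr fun x => ?_
        rw [integral_dilConv_radialCutoff hα hk, enorm_mul, ← hc, ← ofReal_norm (c : ℂ),
          Complex.norm_real, Real.norm_of_nonneg hc0.le]
    _ ≤ ∫⁻ x, ∫⁻ t in Set.Ioi (0 : ℝ), ENNReal.ofReal (t ^ (-α - 1)) * ‖dilConv γ φ t x‖ₑ := by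
        refine lintegral_mono fun x => (enorm_integral_le_lintegral_enorm _).trans (le_of_eq ?_)
        refine setLIntegral_congr_fun measurableSet_Ioi fun t ht => ?_
        rw [enorm_mul, ← ofReal_norm ((t ^ (-α - 1) : ℝ) : ℂ), Complex.norm_real,
          Real.norm_of_nonneg (Real.rpow_nonneg (le_of_lt ht) _)]
    _ = ∫⁻ t in Set.Ioi (0 : ℝ), ∫⁻ x, ENNReal.ofReal (t ^ (-α - 1)) * ‖dilConv γ φ t x‖ₑ :=
        lintegral_lintegral_swap hmeas.aemeasurable
    _ = ∫⁻ t in Set.Ioi (0 : ℝ), ENNReal.ofReal (t ^ (-α - 1)) * ∫⁻ x, ‖dilConv γ φ t x‖ₑ := by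
        refine lintegral_congr fun t => lintegral_const_mul' _ _ ENNReal.ofReal_ne_top
    _ ≤ (∫⁻ t in Set.Ioc (0 : ℝ) 1, ENNReal.ofReal (t ^ (-(α + 1 - 2 * k))) * A') +
        ∫⁻ t in Set.Ioi (1 : ℝ), ENNReal.ofReal (t ^ (-(α + 1))) * A := by
        rw [← Set.Ioc_union_Ioi_eq_Ioi (show (0 : ℝ) ≤ 1 by norm_num),
          lintegral_union measurableSet_Ioi (Set.Ioc_disjoint_Ioi le_rfl)]
        refine add_le_add (setLIntegral_mono' measurableSet_Ioc fun t ht => ?_)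
          (setLIntegral_mono' measurableSet_Ioi fun t _ => ?_)
        · have h1 : ∫⁻ x, ‖dilConv γ φ t x‖ₑ ≤ ENNReal.ofReal (t ^ (2 * k)) * A' := by
            refine le_trans (le_of_eq ?_) (mul_le_mul_right (lintegral_dilConv_le γ' φ' t) _)
            rw [← lintegral_const_mul' _ _ ENNReal.ofReal_ne_top]
            refine lintegral_congr fun x => ?_
            rw [dilConv_radialCutoff k φ ht.1.le, enorm_mul,
              ← ofReal_norm ((t ^ (2 * k) : ℝ) : ℂ), Complex.norm_real,
              Real.norm_of_nonneg (pow_nonneg ht.1.le _)]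
          refine (mul_le_mul_right h1 _).trans (le_of_eq ?_)
          rw [← mul_assoc, ← ENNReal.ofReal_mul (Real.rpow_nonneg ht.1.le _),
            ← Real.rpow_natCast, ← Real.rpow_add ht.1]
          congr 3
          push_cast; ring
        · rw [show -α - 1 = -(α + 1) by ring]
          gcongr
          exact lintegral_dilConv_le γ φ t
    _ < ∞ := by
        rw [lintegral_mul_const' _ _ hA'.ne, lintegral_mul_const' _ _ hA.ne,
          lintegral_Ioc_rpow (by linarith) zero_le_one, lintegral_Ioi_rpow (by linarith) one_pos]
        exact ENNReal.add_lt_top.2 ⟨ENNReal.mul_lt_top ENNReal.ofReal_lt_top hA',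
          ENNReal.mul_lt_top ENNReal.ofReal_lt_top hA⟩

end FractionalLaplacian

/-! ### Fourier transform of the first Gaussian moment -/

section GaussianMoments

variable {n : ℕ}

theorem integrable_gaussian {b : ℝ} (hb : 0 < b) :
    Integrable fun z : Rn n => Real.exp (-b * ‖z‖ ^ 2) := by
  have h := (GaussianFourier.integrable_cexp_neg_mul_sq_norm_add (V := Rn n) (b := (b : ℂ))
    (by simpa using hb) 0 0).norm
  refine h.congr (.of_forall fun z => ?_)
  simp only [Complex.norm_exp]
  congr 1
  simp [← Complex.ofReal_pow, ← Complex.ofReal_mul]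

theorem integrable_inner_mul_gaussian {b : ℝ} (hb : 0 < b) (v : Rn n) :
    Integrable fun z : Rn n => inner ℝ z v * Real.exp (-b * ‖z‖ ^ 2) := by
  refine ((integrable_gaussian (n := n) (half_pos hb)).const_mul ((1 + 1 / (2 * b)) * ‖v‖)).mono
    (Continuous.aestronglyMeasurable (by fun_prop)) (.of_forall fun z => ?_)
  rw [norm_mul, norm_mul, Real.norm_of_nonneg (Real.exp_pos _).le,
    Real.norm_of_nonneg (Real.exp_pos _).le,
    Real.norm_of_nonneg (show 0 ≤ (1 + 1 / (2 * b)) * ‖v‖ by positivity)]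
  have h1 : ‖z‖ ≤ (1 + 1 / (2 * b)) * Real.exp (b / 2 * ‖z‖ ^ 2) := by
    have h3 : ‖z‖ ≤ (1 + 1 / (2 * b)) * (b / 2 * ‖z‖ ^ 2 + 1) := by
      have : (1 + 1 / (2 * b)) * (b / 2 * ‖z‖ ^ 2 + 1) - ‖z‖ =
          b / 2 * ‖z‖ ^ 2 + (‖z‖ / 2 - 1) ^ 2 + 1 / (2 * b) := by
        field_simp; ring
      have : 0 ≤ b / 2 * ‖z‖ ^ 2 + (‖z‖ / 2 - 1) ^ 2 + 1 / (2 * b) := by positivity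
      linarith
    refine h3.trans ?_
    gcongr
    exact Real.add_one_le_exp _
  calc ‖inner ℝ z v‖ * Real.exp (-b * ‖z‖ ^ 2) ≤ (‖z‖ * ‖v‖) * Real.exp (-b * ‖z‖ ^ 2) := by
        gcongr; exact norm_inner_le_norm z v
    _ ≤ ((1 + 1 / (2 * b)) * Real.exp (b / 2 * ‖z‖ ^ 2) * ‖v‖) * Real.exp (-b * ‖z‖ ^ 2) := by
        gcongr
    _ = (1 + 1 / (2 * b)) * ‖v‖ * (Real.exp (b / 2 * ‖z‖ ^ 2) * Real.exp (-b * ‖z‖ ^ 2)) := by ring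
    _ = _ := by rw [← Real.exp_add]; congr 2; ring

theorem hasLineDerivAt_gaussian_wave (b : ℝ) (ξ z v : Rn n) :
    HasLineDerivAt ℝ (fun z : Rn n => Complex.exp (-b * ‖z‖ ^ 2 + 2 * Real.pi * Complex.I * inner ℝ ξ z))
      ((-2 * b * inner ℝ z v + 2 * Real.pi * Complex.I * inner ℝ ξ v) *
        Complex.exp (-b * ‖z‖ ^ 2 + 2 * Real.pi * Complex.I * inner ℝ ξ z)) z v := by
  change HasDerivAt (fun t : ℝ => Complex.exp
    (-b * ‖z + t • v‖ ^ 2 + 2 * Real.pi * Complex.I * inner ℝ ξ (z + t • v))) _ 0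
  have h0 : ∀ t : ℝ, Complex.exp (-b * ‖z + t • v‖ ^ 2 + 2 * Real.pi * Complex.I * inner ℝ ξ (z + t • v)) =
      Complex.exp (((-b * ‖z‖ ^ 2 + 2 * Real.pi * Complex.I * inner ℝ ξ z) +
        (t : ℂ) * (-2 * b * inner ℝ z v + 2 * Real.pi * Complex.I * inner ℝ ξ v)) +
          (t : ℂ) ^ 2 * (-b * ‖v‖ ^ 2)) := by
    intro t
    have h1 : ‖z + t • v‖ ^ 2 = ‖z‖ ^ 2 + 2 * t * inner ℝ z v + t ^ 2 * ‖v‖ ^ 2 := by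
      rw [norm_add_sq_real, inner_smul_right, norm_smul, mul_pow, Real.norm_eq_abs, sq_abs]; ring
    rw [← Complex.ofReal_pow ‖z + t • v‖, h1, inner_add_right, inner_smul_right]
    congr 1
    push_cast; ring
  simp_rw [h0]
  have ht : HasDerivAt (fun t : ℝ => (t : ℂ)) 1 0 := Complex.ofRealCLM.hasDerivAt
  have h2 := (((ht.mul_const (-2 * b * inner ℝ z v + 2 * Real.pi * Complex.I * inner ℝ ξ v : ℂ)).const_add
    (-b * ‖z‖ ^ 2 + 2 * Real.pi * Complex.I * inner ℝ ξ z : ℂ)).fun_add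
      ((ht.fun_pow 2).mul_const (-b * ‖v‖ ^ 2 : ℂ))).cexp
  convert h2 using 1
  rw [Complex.ofReal_zero]
  ring_nf

theorem integrable_gaussian_wave {b : ℝ} (hb : 0 < b) (ξ : Rn n) :
    Integrable fun z : Rn n => Complex.exp (-b * ‖z‖ ^ 2 + 2 * Real.pi * Complex.I * inner ℝ ξ z) :=
  GaussianFourier.integrable_cexp_neg_mul_sq_norm_add (V := Rn n) (b := (b : ℂ))
    (by simpa using hb) _ _

theorem gaussian_wave_eq (b : ℝ) (ξ z : Rn n) :
    Complex.exp (-b * ‖z‖ ^ 2 + 2 * Real.pi * Complex.I * inner ℝ ξ z) =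
      (Real.exp (-b * ‖z‖ ^ 2) : ℂ) * Real.fourierChar (inner ℝ ξ z) := by
  rw [Complex.exp_add, Real.fourierChar_apply]
  push_cast
  congr 2
  ring

/-- The directional derivative of exp(-b|z|² + 2πi ξ·z) integrates to zero; this expresses the first
moment through the known Fourier transform of the Gaussian. -/
theorem integral_inner_mul_gaussian_wave {b : ℝ} (hb : 0 < b) (ξ v : Rn n) :
    ∫ z : Rn n, ((inner ℝ z v * Real.exp (-b * ‖z‖ ^ 2) : ℝ) : ℂ) * Real.fourierChar (inner ℝ ξ z) =
      Complex.I * ((Real.pi * inner ℝ ξ v / b *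
        ((Real.pi / b) ^ ((n : ℝ) / 2) * Real.exp (-(Real.pi ^ 2 * ‖ξ‖ ^ 2 / b))) : ℝ) : ℂ) := by
  set g := fun z : Rn n => Complex.exp (-b * ‖z‖ ^ 2 + 2 * Real.pi * Complex.I * inner ℝ ξ z) with hg
  set J := ∫ z : Rn n, ((inner ℝ z v * Real.exp (-b * ‖z‖ ^ 2) : ℝ) : ℂ) *
    Real.fourierChar (inner ℝ ξ z) with hJ
  have hgi : Integrable g := integrable_gaussian_wave hb ξ
  have hmi : Integrable fun z : Rn n => ((inner ℝ z v * Real.exp (-b * ‖z‖ ^ 2) : ℝ) : ℂ) *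
      Real.fourierChar (inner ℝ ξ z) := by
    have h1 : Integrable (fun z : Rn n => ((inner ℝ z v * Real.exp (-b * ‖z‖ ^ 2) : ℝ) : ℂ)) :=
      Complex.ofRealCLM.integrable_comp (integrable_inner_mul_gaussian hb v)
    have hch := Real.continuous_fourierChar
    refine h1.mono (Continuous.aestronglyMeasurable (by fun_prop)) (.of_forall fun z => ?_)
    rw [norm_mul, Circle.norm_coe, mul_one]
  have hd : ∀ z, (-2 * b * inner ℝ z v + 2 * Real.pi * Complex.I * inner ℝ ξ v) * g z =
      (-2 * b : ℂ) * (((inner ℝ z v * Real.exp (-b * ‖z‖ ^ 2) : ℝ) : ℂ) * Real.fourierChar (inner ℝ ξ z)) +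
        (2 * Real.pi * Complex.I * inner ℝ ξ v : ℂ) * g z := by
    intro z
    rw [hg]
    simp only [gaussian_wave_eq]
    push_cast; ring
  have hzero : ∫ z, (-2 * b * inner ℝ z v + 2 * Real.pi * Complex.I * inner ℝ ξ v) * g z = 0 := by
    have h := integral_bilinear_hasLineDerivAt_right_eq_neg_left_of_integrable
      (μ := (volume : Measure (Rn n))) (B := ContinuousLinearMap.mul ℝ ℂ)
      (f := fun _ => 1) (f' := fun _ => 0) (g := g) (v := v)
      (g' := fun z => (-2 * b * inner ℝ z v + 2 * Real.pi * Complex.I * inner ℝ ξ v) * g z)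
      (by simp) (by
        simp only [ContinuousLinearMap.mul_apply', one_mul]
        simp_rw [hd]
        exact (hmi.const_mul _).add (hgi.const_mul _)) (by simpa using hgi)
      (fun z _ => by simpa using (hasFDerivAt_const (1 : ℂ) z).hasLineDerivAt v)
      (fun z _ => hasLineDerivAt_gaussian_wave b ξ z v)
    simpa using h
  have hG : ∫ z, g z = (((Real.pi / b) ^ ((n : ℝ) / 2) * Real.exp (-(Real.pi ^ 2 * ‖ξ‖ ^ 2 / b)) : ℝ) : ℂ) := by
    rw [hg, GaussianFourier.integral_cexp_neg_mul_sq_norm_add (by simpa using hb),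
      finrank_euclideanSpace_fin, Complex.ofReal_mul, Complex.ofReal_cpow (by positivity)]
    push_cast
    congr 2
    have hb' : (b : ℂ) ≠ 0 := Complex.ofReal_ne_zero.2 hb.ne'
    field_simp
    rw [Complex.I_sq]; ring
  simp_rw [hd] at hzero
  rw [integral_add (hmi.const_mul _) (hgi.const_mul _), integral_const_mul, integral_const_mul,
    hG, ← hJ] at hzero
  have hb' : (b : ℂ) ≠ 0 := Complex.ofReal_ne_zero.2 hb.ne'
  have : J = (2 * Real.pi * Complex.I * inner ℝ ξ v : ℂ) *
      (((Real.pi / b) ^ ((n : ℝ) / 2) * Real.exp (-(Real.pi ^ 2 * ‖ξ‖ ^ 2 / b)) : ℝ) : ℂ) / (2 * b) := by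
    field_simp
    linear_combination -hzero / 2
  rw [this]
  push_cast
  field_simp

end GaussianMoments

/-! ### Gamma integrals -/

section GammaIntegrals

/-- A nonzero Bochner integral can only come from an integrable function, so the explicit value
gives integrability. -/
theorem integrableOn_rpow_mul_exp_neg {a r : ℝ} (ha : 0 < a) (hr : 0 < r) :
    IntegrableOn (fun t : ℝ => t ^ (a - 1) * Real.exp (-(r * t))) (Set.Ioi 0) :=
  Integrable.of_integral_ne_zero (by
    rw [Real.integral_rpow_mul_exp_neg_mul_Ioi ha hr]
    exact (mul_pos (by positivity) (Real.Gamma_pos_of_pos ha)).ne')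

/-- The substitution b ↦ 1/b in the Gamma integral. -/
theorem integral_rpow_mul_exp_neg_div {s r : ℝ} (hs : 0 < s) (hr : 0 < r) :
    ∫ b in Set.Ioi (0 : ℝ), b ^ (-s - 1) * Real.exp (-(r / b)) = (1 / r) ^ s * Real.Gamma s := by
  rw [← Real.integral_rpow_mul_exp_neg_mul_Ioi hs hr, ← integral_comp_rpow_Ioi _ (p := -1) (by norm_num)]
  refine setIntegral_congr_fun measurableSet_Ioi fun b hb => ?_
  have hb' : (0 : ℝ) < b := hb
  simp only [abs_neg, abs_one, one_mul, smul_eq_mul]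
  rw [← Real.rpow_mul hb'.le, ← mul_assoc, ← Real.rpow_add hb', Real.rpow_neg_one]
  congr 1
  · ring_nf
  · rw [div_inv_eq_mul]

theorem integrableOn_rpow_mul_exp_neg_div {s r : ℝ} (hs : 0 < s) (hr : 0 < r) :
    IntegrableOn (fun b : ℝ => b ^ (-s - 1) * Real.exp (-(r / b))) (Set.Ioi 0) :=
  Integrable.of_integral_ne_zero (by
    rw [integral_rpow_mul_exp_neg_div hs hr]
    exact (mul_pos (by positivity) (Real.Gamma_pos_of_pos hs)).ne')

end GammaIntegrals

/-! ### The kernel of the gradient of (-Δ)^{-α/2} -/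

section GradientKernel

variable {n : ℕ}

/-- Up to a constant, the derivative in direction `v` of the kernel of `(-Δ)^{-α/2}`. -/
def gradKernel (α : ℝ) (v z : Rn n) : ℝ := ‖z‖ ^ (α - 2 - n) * inner ℝ z v

theorem enorm_gradKernel_le {α : ℝ} (v z : Rn n) :
    ‖gradKernel α v z‖ₑ ≤ rieszKernel (α - 1) z * ‖v‖ₑ := by
  rcases eq_or_ne z 0 with rfl | hz
  · simp [gradKernel]
  have hz' : 0 < ‖z‖ := norm_pos_iff.2 hz
  rw [rieszKernel, ← ofReal_norm, ← ofReal_norm, ← ENNReal.ofReal_mul (by positivity)]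
  refine ENNReal.ofReal_le_ofReal ?_
  rw [gradKernel, norm_mul, Real.norm_of_nonneg (by positivity)]
  calc _ ≤ ‖z‖ ^ (α - 2 - n) * (‖z‖ * ‖v‖) := by gcongr; exact norm_inner_le_norm z v
    _ = ‖z‖ ^ (α - 1 - n) * ‖v‖ := by
      rw [show α - 1 - (n : ℝ) = (α - 2 - n) + 1 by ring, Real.rpow_add hz', Real.rpow_one]; ring

/-- Finite at every point, not only almost everywhere: the kernel is in a weak space uniformly in
its centre, and `k` is in L¹ ∩ L^∞. -/
theorem rieszPotential_lt_top {β : ℝ} (hβ : 0 < β) (hβn : β < n) {k : Rn n → ℝ≥0∞}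
    (hk : Measurable k) (hk1 : ∫⁻ x, k x ≠ ∞) {M : ℝ≥0∞} (hM : M ≠ ∞) (hkM : ∀ x, k x ≤ M)
    (y : Rn n) : rieszPotential β k y < ∞ := by
  obtain ⟨B, hB⟩ := exists_mNorm_rieszKernel_le hβ hβn
  have hn : (0 : ℝ) < n := by linarith
  have hb0 : 0 < β / n := by positivity
  have hb1 : β / n < 1 := by rw [div_lt_one hn]; exact hβn
  refine (lintegral_mul_le_mNorm (μ := volume) ((measurable_rieszKernel β).comp
    (measurable_const.sub measurable_id)) hk (x := 1 - β / n) (y := 1) (by linarith) one_pos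
    rfl (by linarith) (M := M.toReal) ENNReal.toReal_nonneg
    (fun z => by rw [ENNReal.ofReal_toReal hM]; exact hkM z) hk1 (mNorm_one_le k)).trans_lt ?_
  refine ENNReal.mul_lt_top ((hB y).trans_lt ENNReal.coe_lt_top)
    (ENNReal.mul_lt_top (ENNReal.rpow_lt_top_of_nonneg ?_ hk1) ENNReal.ofReal_lt_top)
  apply div_nonneg <;> linarith

theorem rieszPotential_fracLaplacian_lt_top {α β : ℝ} (hα : 0 < α) (hβ : 0 < β) (hβn : β < n)
    (φ : 𝓢(Rn n, ℂ)) (y : Rn n) : rieszPotential β (fun x => ‖fracLaplacian α φ x‖ₑ) y < ∞ :=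
  rieszPotential_lt_top hβ hβn (continuous_fracLaplacian hα.le φ).enorm.measurable
    (integrable_fracLaplacian hα φ).2.ne (integrable_fracSymbol hα.le φ).2.ne
    (enorm_fracLaplacian_le φ) y

theorem measurable_gradKernel_sub (α : ℝ) (v y : Rn n) :
    Measurable fun x => gradKernel α v (x - y) := by
  have h1 : Measurable fun x : Rn n => ‖x - y‖ ^ (α - 2 - n) := by fun_prop
  have h2 : Measurable fun x : Rn n => (inner ℝ (x - y) v : ℝ) := by fun_prop
  exact h1.mul h2

theorem lintegral_gradKernel_mul_le (α : ℝ) (v y : Rn n) {k : Rn n → ℝ≥0∞} (hk : Measurable k) :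
    ∫⁻ x, ‖gradKernel α v (x - y)‖ₑ * k x ≤ ‖v‖ₑ * rieszPotential (α - 1) k y := by
  have hk' : Measurable fun x => rieszKernel (α - 1) (y - x) * k x :=
    ((measurable_rieszKernel _).comp (measurable_const.sub measurable_id)).mul hk
  rw [rieszPotential, ← lintegral_const_mul _ hk']
  refine lintegral_mono fun x => ?_
  rw [rieszKernel_sub_comm, ← mul_assoc, mul_comm ‖v‖ₑ]
  exact mul_le_mul_left (enorm_gradKernel_le v _) _

theorem integrable_gradKernel_mul_fracLaplacian {α : ℝ} (hα : 1 < α) (hαn : α - 1 < n)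
    (φ : 𝓢(Rn n, ℂ)) (v y : Rn n) :
    Integrable fun x => (gradKernel α v (x - y) : ℂ) * fracLaplacian α φ x := by
  have hα0 : 0 < α := by linarith
  have hψ := (continuous_fracLaplacian hα0.le φ).measurable
  have hm : Measurable fun x => (gradKernel α v (x - y) : ℂ) * fracLaplacian α φ x :=
    (Complex.measurable_ofReal.comp (measurable_gradKernel_sub α v y)).mul hψ
  refine ⟨hm.aestronglyMeasurable, ?_⟩
  have h := rieszPotential_fracLaplacian_lt_top hα0 (β := α - 1) (by linarith) hαn φ y
  have hlt : ‖v‖ₑ * rieszPotential (α - 1) (fun x => ‖fracLaplacian α φ x‖ₑ) y < ∞ :=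
    ENNReal.mul_lt_top enorm_lt_top h
  refine lt_of_le_of_lt (le_trans (le_of_eq ?_) (lintegral_gradKernel_mul_le α v y hψ.enorm)) hlt
  refine lintegral_congr fun x => ?_
  rw [enorm_mul, ← ofReal_norm, Complex.norm_real, ofReal_norm]

/-- Subordination: the singular kernel is a superposition of Gaussian moments, whose Fourier
transforms are explicit. -/
theorem integral_gaussian_eq_gradKernel {α : ℝ} (hαn : α < n + 2) (v z : Rn n) :
    ∫ b in Set.Ioi (0 : ℝ), b ^ ((n + 2 - α) / 2 - 1) * (inner ℝ z v * Real.exp (-b * ‖z‖ ^ 2)) =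
      Real.Gamma ((n + 2 - α) / 2) * gradKernel α v z := by
  rcases eq_or_ne z 0 with rfl | hz
  · simp [gradKernel]
  have hz' : 0 < ‖z‖ := norm_pos_iff.2 hz
  have h := Real.integral_rpow_mul_exp_neg_mul_Ioi (a := (n + 2 - α) / 2) (r := ‖z‖ ^ 2)
    (by linarith) (by positivity)
  calc _ = inner ℝ z v * ∫ b in Set.Ioi (0 : ℝ), b ^ ((n + 2 - α) / 2 - 1) *
        Real.exp (-(‖z‖ ^ 2 * b)) := by
        rw [← integral_const_mul]
        refine integral_congr_ae (.of_forall fun b => ?_)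
        simp only
        rw [show -b * ‖z‖ ^ 2 = -(‖z‖ ^ 2 * b) by ring]; ring
    _ = _ := by
        rw [h, gradKernel, one_div, Real.inv_rpow (by positivity), ← Real.rpow_natCast,
          ← Real.rpow_mul hz'.le, ← Real.rpow_neg hz'.le]
        rw [show -(((2 : ℕ) : ℝ) * ((n + 2 - α) / 2)) = α - 2 - n by push_cast; ring]
        ring

theorem integrableOn_gaussian_inner {α : ℝ} (hαn : α < n + 2) (v z : Rn n) :
    IntegrableOn (fun b : ℝ => b ^ ((n + 2 - α) / 2 - 1) *
      (inner ℝ z v * Real.exp (-b * ‖z‖ ^ 2))) (Set.Ioi 0) := by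
  rcases eq_or_ne z 0 with rfl | hz
  · simp
  have hz' : 0 < ‖z‖ := norm_pos_iff.2 hz
  refine ((integrableOn_rpow_mul_exp_neg (a := (n + 2 - α) / 2) (r := ‖z‖ ^ 2)
    (by linarith) (by positivity)).const_mul (inner ℝ z v)).congr (.of_forall fun b => ?_)
  simp only
  rw [show -b * ‖z‖ ^ 2 = -(‖z‖ ^ 2 * b) by ring]; ring

theorem fderiv_schwartz_eq (φ : 𝓢(Rn n, ℂ)) (y v : Rn n) :
    fderiv ℝ (φ : Rn n → ℂ) y v = ∫ ξ : Rn n, (Real.fourierChar (inner ℝ ξ y) : ℂ) *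
      (2 * Real.pi * Complex.I * inner ℝ ξ v * 𝓕 φ ξ) := by
  have hg : Function.HasTemperateGrowth fun ξ : Rn n => inner ℝ ξ v := by fun_prop
  rw [← SchwartzMap.lineDerivOp_apply_eq_fderiv]
  conv_lhs => rw [← FourierTransform.fourierInv_fourier_eq (F := 𝓢(Rn n, ℂ)) (LineDeriv.lineDerivOp v φ)]
  rw [SchwartzMap.fourierInv_coe, Real.fourierInv_eq]
  refine integral_congr_ae (.of_forall fun ξ => ?_)
  simp only [SchwartzMap.fourier_lineDerivOp_eq, Circle.smul_def, smul_eq_mul,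
    smul_apply, SchwartzMap.smulLeftCLM_apply_apply hg, Complex.real_smul]
  ring

theorem integral_gaussian_mul_fracLaplacian {α b : ℝ} (hα : 0 ≤ α) (hb : 0 < b) (φ : 𝓢(Rn n, ℂ))
    (v y : Rn n) :
    ∫ x, ((inner ℝ (x - y) v * Real.exp (-b * ‖x - y‖ ^ 2) : ℝ) : ℂ) * fracLaplacian α φ x =
      ∫ ξ, (Real.fourierChar (inner ℝ ξ y) : ℂ) * fracSymbol α φ ξ * (Complex.I *
        ((Real.pi * inner ℝ ξ v / b * ((Real.pi / b) ^ ((n : ℝ) / 2) *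
          Real.exp (-(Real.pi ^ 2 * ‖ξ‖ ^ 2 / b))) : ℝ) : ℂ)) := by
  have hsub : ∫ x, ((inner ℝ (x - y) v * Real.exp (-b * ‖x - y‖ ^ 2) : ℝ) : ℂ) * fracLaplacian α φ x =
      ∫ z, ((inner ℝ z v * Real.exp (-b * ‖z‖ ^ 2) : ℝ) : ℂ) * fracLaplacian α φ (z + y) := by
    rw [← integral_add_right_eq_self _ y]
    simp
  have hG : Integrable (fun z : Rn n => ((inner ℝ z v * Real.exp (-b * ‖z‖ ^ 2) : ℝ) : ℂ)) :=
    Complex.ofRealCLM.integrable_comp (integrable_inner_mul_gaussian hb v)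
  have hch := Real.continuous_fourierChar
  have hsy := continuous_fracSymbol hα φ
  calc _ = ∫ z, ∫ ξ, (((inner ℝ z v * Real.exp (-b * ‖z‖ ^ 2) : ℝ) : ℂ) *
        fracSymbol α φ ξ) * (Real.fourierChar (inner ℝ ξ (z + y)) : ℂ) := by
        rw [hsub]
        refine integral_congr_ae (.of_forall fun z => ?_)
        simp only
        rw [fracLaplacian_eq, Real.fourierInv_eq, ← integral_const_mul]
        refine integral_congr_ae (.of_forall fun ξ => ?_)
        simp only [Circle.smul_def, smul_eq_mul]
        ring
    _ = ∫ ξ, ∫ z, (((inner ℝ z v * Real.exp (-b * ‖z‖ ^ 2) : ℝ) : ℂ) *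
        fracSymbol α φ ξ) * (Real.fourierChar (inner ℝ ξ (z + y)) : ℂ) := by
        refine integral_integral_swap ((hG.mul_prod (integrable_fracSymbol hα φ)).mono
          (Continuous.aestronglyMeasurable ?_) (.of_forall fun p => ?_))
        · rw [Function.uncurry_def]; fun_prop
        · simp only [Function.uncurry]
          rw [norm_mul, Circle.norm_coe, mul_one]
    _ = _ := by
        refine integral_congr_ae (.of_forall fun ξ => ?_)
        simp only
        rw [← integral_inner_mul_gaussian_wave hb, ← integral_const_mul]
        refine integral_congr_ae (.of_forall fun z => ?_)
        simp only [inner_add_right, AddChar.map_add_eq_mul, Circle.coe_mul]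
        ring

/-- The powers of b combine to b^{-α/2-1}, so the Gamma integral yields a multiple of |ξ|^{-α}. It
cancels the fractional Laplacian and leaves, up to i, the symbol of the derivative along `v`. -/
theorem integral_gaussian_symbol {α : ℝ} (hα : 0 < α) (v ξ : Rn n) :
    ∫ b in Set.Ioi (0 : ℝ), b ^ ((n + 2 - α) / 2 - 1) * ((2 * Real.pi * ‖ξ‖) ^ α *
      (Real.pi * inner ℝ ξ v / b * ((Real.pi / b) ^ ((n : ℝ) / 2) *
        Real.exp (-(Real.pi ^ 2 * ‖ξ‖ ^ 2 / b))))) =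
      Real.Gamma (α / 2) * Real.pi ^ ((n : ℝ) / 2) * 2 ^ (α - 1) * (2 * Real.pi * inner ℝ ξ v) ∧
    IntegrableOn (fun b : ℝ => b ^ ((n + 2 - α) / 2 - 1) * ((2 * Real.pi * ‖ξ‖) ^ α *
      (Real.pi * inner ℝ ξ v / b * ((Real.pi / b) ^ ((n : ℝ) / 2) *
        Real.exp (-(Real.pi ^ 2 * ‖ξ‖ ^ 2 / b)))))) (Set.Ioi 0) := by
  rcases eq_or_ne ξ 0 with rfl | hξ
  · simp
  have hξ' : 0 < ‖ξ‖ := norm_pos_iff.2 hξ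
  have hr : 0 < Real.pi ^ 2 * ‖ξ‖ ^ 2 := by positivity
  have hcongr : ∀ b ∈ Set.Ioi (0 : ℝ), (2 * Real.pi * ‖ξ‖) ^ α * Real.pi * inner ℝ ξ v *
      Real.pi ^ ((n : ℝ) / 2) * (b ^ (-(α / 2) - 1) * Real.exp (-(Real.pi ^ 2 * ‖ξ‖ ^ 2 / b))) =
      b ^ ((n + 2 - α) / 2 - 1) * ((2 * Real.pi * ‖ξ‖) ^ α *
      (Real.pi * inner ℝ ξ v / b * ((Real.pi / b) ^ ((n : ℝ) / 2) *
        Real.exp (-(Real.pi ^ 2 * ‖ξ‖ ^ 2 / b))))) := by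
    intro b hb
    have hb' : (0 : ℝ) < b := hb
    have e : b ^ (-(α / 2) - 1) = b ^ ((n + 2 - α) / 2 - 1) * b⁻¹ * (b ^ ((n : ℝ) / 2))⁻¹ := by
      rw [← Real.rpow_neg_one b, ← Real.rpow_neg hb'.le, ← Real.rpow_add hb', ← Real.rpow_add hb']
      congr 1; ring
    rw [e, Real.div_rpow Real.pi_pos.le hb'.le]
    field_simp
  constructor
  · rw [← setIntegral_congr_fun measurableSet_Ioi hcongr, integral_const_mul,
      integral_rpow_mul_exp_neg_div (by positivity) hr]
    have e1 : (1 / (Real.pi ^ 2 * ‖ξ‖ ^ 2)) ^ (α / 2) = ((Real.pi * ‖ξ‖) ^ α)⁻¹ := by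
      rw [one_div, ← mul_pow, Real.inv_rpow (by positivity), ← Real.rpow_natCast,
        ← Real.rpow_mul (by positivity)]
      congr 2; push_cast; ring
    have e2 : (2 * Real.pi * ‖ξ‖) ^ α = 2 ^ (α - 1) * 2 * (Real.pi * ‖ξ‖) ^ α := by
      rw [mul_assoc, Real.mul_rpow (by norm_num) (by positivity)]
      congr 1
      rw [← Real.rpow_add_one (by norm_num)]; congr 1; ring
    rw [e1, e2]
    have : (Real.pi * ‖ξ‖) ^ α ≠ 0 := by positivity
    field_simp
  · exact IntegrableOn.congr_fun ((integrableOn_rpow_mul_exp_neg_div (by positivity) hr).const_mul _)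
      hcongr measurableSet_Ioi

/-- The integrand keeps the sign of `c`, so no cancellation occurs. The inner L¹ norms needed for
Fubini are then the already computed kernels. -/
theorem integral_norm_eq_norm_integral {f p : ℝ → ℝ} {c : ℝ} {S : Set ℝ} (hS : MeasurableSet S)
    (hp : ∀ b ∈ S, 0 ≤ p b) (hf : ∀ b ∈ S, f b = c * p b) :
    ∫ b in S, ‖f b‖ = ‖∫ b in S, f b‖ := by
  rw [setIntegral_congr_fun hS hf, integral_const_mul, norm_mul,
    Real.norm_of_nonneg (setIntegral_nonneg hS hp), ← integral_const_mul]
  refine setIntegral_congr_fun hS fun b hb => ?_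
  simp only [hf b hb, norm_mul, Real.norm_of_nonneg (hp b hb)]

/-- Insert the subordination formula, pass to the Fourier side for each Gaussian, and integrate in
b. Using the gradient kernel instead of that of (-Δ)^{-α/2} requires only α - 1 < n, which covers n
= 1, where α > n. -/
theorem integral_gradKernel_mul_fracLaplacian {α : ℝ} (hα : 1 < α) (hαn : α - 1 < n)
    (φ : 𝓢(Rn n, ℂ)) (v y : Rn n) :
    (Real.Gamma ((n + 2 - α) / 2) : ℂ) *
        ∫ x, (gradKernel α v (x - y) : ℂ) * fracLaplacian α φ x =
      ((Real.Gamma (α / 2) * Real.pi ^ ((n : ℝ) / 2) * 2 ^ (α - 1) : ℝ) : ℂ) *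
        fderiv ℝ (φ : Rn n → ℂ) y v := by
  have hα0 : 0 < α := by linarith
  have hαn2 : α < n + 2 := by linarith
  have hψ := continuous_fracLaplacian hα0.le φ
  have hsy := continuous_fracSymbol hα0.le φ
  set κ := Real.Gamma (α / 2) * Real.pi ^ ((n : ℝ) / 2) * 2 ^ (α - 1) with hκ
  set w : Rn n → ℝ → ℝ := fun z b => b ^ ((n + 2 - α) / 2 - 1) *
      (inner ℝ z v * Real.exp (-b * ‖z‖ ^ 2)) with hw
  set s : Rn n → ℝ → ℝ := fun ξ b => b ^ ((n + 2 - α) / 2 - 1) * ((2 * Real.pi * ‖ξ‖) ^ α *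
      (Real.pi * inner ℝ ξ v / b * ((Real.pi / b) ^ ((n : ℝ) / 2) *
        Real.exp (-(Real.pi ^ 2 * ‖ξ‖ ^ 2 / b))))) with hs
  have hsym : ∀ ξ, ∫ b in Set.Ioi (0 : ℝ), s ξ b = κ * (2 * Real.pi * inner ℝ ξ v) := fun ξ =>
    (integral_gaussian_symbol hα0 v ξ).1
  clear_value κ
  have hΓ : 0 < Real.Gamma ((n + 2 - α) / 2) := Real.Gamma_pos_of_pos (by linarith)
  -- The b-integral of the norm is Γ((n+2-α)/2) times the absolute kernel, whose product with
  -- (-Δ)^{α/2}φ is integrable.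
  have hint1 : Integrable (fun p : Rn n × ℝ => (w (p.1 - y) p.2 : ℂ) * fracLaplacian α φ p.1)
      (volume.prod (volume.restrict (Set.Ioi 0))) := by
    have hm : Measurable fun p : Rn n × ℝ => (w (p.1 - y) p.2 : ℂ) * fracLaplacian α φ p.1 := by
      refine (Complex.measurable_ofReal.comp ?_).mul (hψ.measurable.comp measurable_fst)
      refine (measurable_snd.pow_const _).mul (Continuous.measurable ?_)
      fun_prop
    rw [integrable_prod_iff hm.aestronglyMeasurable]
    refine ⟨.of_forall fun x => ?_, ?_⟩
    · have h1 : Integrable (fun b => (w (x - y) b : ℂ)) (volume.restrict (Set.Ioi 0)) :=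
        Complex.ofRealCLM.integrable_comp (integrableOn_gaussian_inner hαn2 v (x - y))
      exact h1.mul_const (fracLaplacian α φ x)
    · refine ((integrable_gradKernel_mul_fracLaplacian hα hαn φ v y).norm.const_mul
        (Real.Gamma ((n + 2 - α) / 2))).congr (.of_forall fun x => ?_)
      simp only [norm_mul, Complex.norm_real]
      rw [integral_mul_const, ← mul_assoc]
      congr 1
      rw [integral_norm_eq_norm_integral (c := inner ℝ (x - y) v)
        (p := fun b => b ^ ((n + 2 - α) / 2 - 1) * Real.exp (-b * ‖x - y‖ ^ 2)) measurableSet_Ioi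
        (fun b hb => mul_nonneg (Real.rpow_nonneg (le_of_lt hb) _) (Real.exp_pos _).le)
        (fun b hb => by simp only [hw]; ring), integral_gaussian_eq_gradKernel hαn2, norm_mul,
        Real.norm_of_nonneg hΓ.le]
  -- On the Fourier side the b-integral of the norm is a multiple of |ξ·v| |φ̂(ξ)|.
  have hint2 : Integrable (fun p : ℝ × Rn n => (Real.fourierChar (inner ℝ p.2 y) : ℂ) *
      ((s p.2 p.1 : ℂ) * (Complex.I * 𝓕 φ p.2))) ((volume.restrict (Set.Ioi 0)).prod volume) := by
    have hch := Real.continuous_fourierChar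
    have hFφ : Continuous ⇑(𝓕 φ : 𝓢(Rn n, ℂ)) := (𝓕 φ).continuous
    have hm : Measurable fun p : ℝ × Rn n => (Real.fourierChar (inner ℝ p.2 y) : ℂ) *
      ((s p.2 p.1 : ℂ) * (Complex.I * 𝓕 φ p.2)) := by
      refine (Continuous.measurable (by fun_prop)).mul ((Complex.measurable_ofReal.comp ?_).mul
        (Continuous.measurable (by fun_prop)))
      rw [hs]
      fun_prop
    rw [integrable_prod_iff' hm.aestronglyMeasurable]
    refine ⟨.of_forall fun ξ => ?_, ?_⟩
    · have h1 : Integrable (fun b => (s ξ b : ℂ)) (volume.restrict (Set.Ioi 0)) :=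
        Complex.ofRealCLM.integrable_comp (integral_gaussian_symbol hα0 v ξ).2
      exact (h1.mul_const (Complex.I * 𝓕 φ ξ)).const_mul (Real.fourierChar (inner ℝ ξ y) : ℂ)
    · have heq : ∀ ξ, ∫ b in Set.Ioi (0 : ℝ), ‖(Real.fourierChar (inner ℝ ξ y) : ℂ) *
          ((s ξ b : ℂ) * (Complex.I * 𝓕 φ ξ))‖ = ‖κ * (2 * Real.pi * inner ℝ ξ v)‖ * ‖𝓕 φ ξ‖ := by
        intro ξ
        simp only [norm_mul (_ : ℂ), Circle.norm_coe, Complex.norm_real, Complex.norm_I, one_mul]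
        rw [integral_mul_const]
        congr 1
        rw [integral_norm_eq_norm_integral (c := inner ℝ ξ v)
          (p := fun b => b ^ ((n + 2 - α) / 2 - 1) * ((2 * Real.pi * ‖ξ‖) ^ α *
            (Real.pi / b * ((Real.pi / b) ^ ((n : ℝ) / 2) *
              Real.exp (-(Real.pi ^ 2 * ‖ξ‖ ^ 2 / b))))))
          measurableSet_Ioi (fun b hb => ?_) (fun b hb => by simp only [hs]; ring), hsym]
        have hb' : (0 : ℝ) < b := hb
        positivity
      simp_rw [heq]
      refine ((integrable_norm_rpow_mul_schwartz zero_le_one (𝓕 φ)).const_mul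
        (‖κ‖ * (2 * Real.pi) * ‖v‖)).mono (Continuous.aestronglyMeasurable (by fun_prop))
        (.of_forall fun ξ => ?_)
      rw [norm_mul, norm_norm, norm_norm, norm_mul, norm_mul (2 * Real.pi),
        Real.norm_of_nonneg (show 0 ≤ 2 * Real.pi by positivity), Real.rpow_one,
        Real.norm_of_nonneg (show 0 ≤ ‖κ‖ * (2 * Real.pi) * ‖v‖ * (‖ξ‖ * ‖𝓕 φ ξ‖) by positivity)]
      calc _ ≤ ‖κ‖ * (2 * Real.pi * (‖ξ‖ * ‖v‖)) * ‖𝓕 φ ξ‖ := by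
            gcongr; exact norm_inner_le_norm ξ v
        _ = _ := by ring
  calc _ = ∫ x, ∫ b in Set.Ioi (0 : ℝ), (w (x - y) b : ℂ) * fracLaplacian α φ x := by
        rw [← integral_const_mul]
        refine integral_congr_ae (.of_forall fun x => ?_)
        simp only
        rw [integral_mul_const, integral_complex_ofReal, integral_gaussian_eq_gradKernel hαn2]
        push_cast; ring
    _ = ∫ b in Set.Ioi (0 : ℝ), ∫ x, (w (x - y) b : ℂ) * fracLaplacian α φ x :=
        integral_integral_swap hint1
    _ = ∫ b in Set.Ioi (0 : ℝ), ∫ ξ, (Real.fourierChar (inner ℝ ξ y) : ℂ) *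
          ((s ξ b : ℂ) * (Complex.I * 𝓕 φ ξ)) := by
        refine setIntegral_congr_fun measurableSet_Ioi fun b hb => ?_
        have h1 := integral_gaussian_mul_fracLaplacian hα0.le hb φ v y
        have h2 : ∀ x, (w (x - y) b : ℂ) * fracLaplacian α φ x =
            ((b ^ ((n + 2 - α) / 2 - 1) : ℝ) : ℂ) *
              (((inner ℝ (x - y) v * Real.exp (-b * ‖x - y‖ ^ 2) : ℝ) : ℂ) *
                fracLaplacian α φ x) := by
          intro x; simp only [hw]; push_cast; ring
        simp_rw [h2]
        rw [integral_const_mul, h1, ← integral_const_mul]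
        refine integral_congr_ae (.of_forall fun ξ => ?_)
        simp only [fracSymbol, Complex.real_smul, hs, SchwartzMap.fourier_coe]
        push_cast; ring
    _ = ∫ ξ, ∫ b in Set.Ioi (0 : ℝ), (Real.fourierChar (inner ℝ ξ y) : ℂ) *
          ((s ξ b : ℂ) * (Complex.I * 𝓕 φ ξ)) := integral_integral_swap hint2
    _ = _ := by
        rw [fderiv_schwartz_eq, ← integral_const_mul]
        refine integral_congr_ae (.of_forall fun ξ => ?_)
        simp only
        rw [integral_const_mul, integral_mul_const, integral_complex_ofReal, hsym]
        push_cast; ring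

end GradientKernel

/-! ### The operator -(-Δ)^{-α/2} div -/

section InverseDivergence

variable {n : ℕ}

/-- The constant normalizing `gradKernel`. -/
def gradConst (n : ℕ) (α : ℝ) : ℝ :=
  Real.Gamma ((n + 2 - α) / 2) / (Real.Gamma (α / 2) * Real.pi ^ ((n : ℝ) / 2) * 2 ^ (α - 1))

theorem gradConst_mul_integral {α : ℝ} (hα : 1 < α) (hαn : α - 1 < n)
    (φ : 𝓢(Rn n, ℂ)) (v y : Rn n) :
    (gradConst n α : ℂ) * ∫ x, (gradKernel α v (x - y) : ℂ) * fracLaplacian α φ x =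
      fderiv ℝ (φ : Rn n → ℂ) y v := by
  have h := integral_gradKernel_mul_fracLaplacian hα hαn φ v y
  have hκ : 0 < Real.Gamma (α / 2) * Real.pi ^ ((n : ℝ) / 2) * 2 ^ (α - 1) := by
    have := Real.Gamma_pos_of_pos (show 0 < α / 2 by linarith)
    positivity
  rw [gradConst]
  generalize Real.Gamma (α / 2) * Real.pi ^ ((n : ℝ) / 2) * 2 ^ (α - 1) = κ at *
  have hκ' : (κ : ℂ) ≠ 0 := Complex.ofReal_ne_zero.2 hκ.ne'
  push_cast
  rw [div_mul_eq_mul_div, h, mul_div_cancel_left₀ _ hκ']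

/-- The operator `-(-Δ)^{-α/2} div`, as an integral operator. -/
def invDiv (α : ℝ) (V : Rn n → Rn n) (x : Rn n) : ℝ :=
  gradConst n α * ∫ y, gradKernel α (V y) (x - y)

theorem measurable_gradKernel_comp (α : ℝ) {V : Rn n → Rn n} (hV : Measurable V) :
    Measurable fun p : Rn n × Rn n => gradKernel α (V p.2) (p.1 - p.2) := by
  have h1 : Measurable fun p : Rn n × Rn n => ‖p.1 - p.2‖ ^ (α - 2 - n) := by fun_prop
  have h2 : Measurable fun p : Rn n × Rn n => (inner ℝ (p.1 - p.2) (V p.2) : ℝ) := by fun_prop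
  exact h1.mul h2

theorem stronglyMeasurable_invDiv (α : ℝ) {V : Rn n → Rn n} (hV : Measurable V) :
    StronglyMeasurable (invDiv α V) :=
  ((measurable_gradKernel_comp α hV).stronglyMeasurable.integral_prod_right').const_mul _

theorem lintegral_enorm_gradKernel_le (α : ℝ) (V : Rn n → Rn n) (x : Rn n) :
    ∫⁻ y, ‖gradKernel α (V y) (x - y)‖ₑ ≤ rieszPotential (α - 1) (fun y => ‖V y‖ₑ) x :=
  lintegral_mono fun y => enorm_gradKernel_le (V y) (x - y)

theorem enorm_invDiv_le (α : ℝ) (V : Rn n → Rn n) (x : Rn n) :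
    ‖invDiv α V x‖ₑ ≤ ‖gradConst n α‖ₑ * rieszPotential (α - 1) (fun y => ‖V y‖ₑ) x := by
  rw [invDiv, enorm_mul]
  gcongr
  exact (enorm_integral_le_lintegral_enorm _).trans (lintegral_enorm_gradKernel_le α V x)

theorem integrable_gradKernel {α : ℝ} {V : Rn n → Rn n} (hV : Measurable V) {x : Rn n}
    (h : rieszPotential (α - 1) (fun y => ‖V y‖ₑ) x < ∞) :
    Integrable fun y => gradKernel α (V y) (x - y) := by
  have hp : Measurable fun y : Rn n => (x, y) := by fun_prop
  exact ⟨((measurable_gradKernel_comp α hV).comp hp).aestronglyMeasurable,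
    (lintegral_enorm_gradKernel_le α V x).trans_lt h⟩

theorem gradKernel_add (α : ℝ) (v w z : Rn n) :
    gradKernel α (v + w) z = gradKernel α v z + gradKernel α w z := by
  simp only [gradKernel, inner_add_right, mul_add]

theorem invDiv_congr_ae (α : ℝ) {V W : Rn n → Rn n} (h : V =ᵐ[volume] W) :
    invDiv α V = invDiv α W := by
  ext x
  rw [invDiv, invDiv]
  congr 1
  refine integral_congr_ae ?_
  filter_upwards [h] with y hy
  rw [hy]

/-- Boundedness of `-(-Δ)^{-α/2} div` on weak Lebesgue spaces. -/
theorem exists_mNorm_invDiv_le {α x : ℝ} (hα : 1 < α) (hαn : α - 1 < n) (hx : (α - 1) / n < x)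
    (hx1 : x ≤ 1) : ∃ C : ℝ≥0, ∀ V : Rn n → Rn n, Measurable V →
      mNorm volume (x - (α - 1) / n) (fun y => ‖invDiv α V y‖ₑ) ≤
        C * mNorm volume x (fun y => ‖V y‖ₑ) := by
  obtain ⟨C, hC⟩ := exists_mNorm_rieszPotential_le (β := α - 1) (by linarith) hαn hx hx1
  refine ⟨‖gradConst n α‖₊ * C, fun V hV => ?_⟩
  refine (mNorm_mono_ae (.of_forall (enorm_invDiv_le α V))).trans ?_
  refine (mNorm_const_mul_le (measurable_rieszPotential _ hV.enorm).aemeasurable _).trans ?_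
  rw [ENNReal.coe_mul, mul_assoc]
  exact mul_le_mul_right (hC _ hV.enorm) _

theorem ae_rieszPotential_lt_top {α x : ℝ} (hα : 1 < α) (hαn : α - 1 < n) (hx : (α - 1) / n < x)
    (hx1 : x ≤ 1) {V : Rn n → Rn n} (hV : Measurable V)
    (h : mNorm volume x (fun y => ‖V y‖ₑ) < ∞) :
    ∀ᵐ y, rieszPotential (α - 1) (fun y => ‖V y‖ₑ) y < ∞ := by
  obtain ⟨C, hC⟩ := exists_mNorm_rieszPotential_le (β := α - 1) (by linarith) hαn hx hx1
  exact ae_lt_top_of_mNorm (measurable_rieszPotential _ hV.enorm).aemeasurable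
    ((hC _ hV.enorm).trans_lt (ENNReal.mul_lt_top ENNReal.coe_lt_top h))

/-- Additivity needs convergent integrals; these are guaranteed where the Riesz potentials of both
fields are finite, hence almost everywhere. -/
theorem invDiv_add_ae {α x : ℝ} (hα : 1 < α) (hαn : α - 1 < n) (hx : (α - 1) / n < x)
    (hx1 : x ≤ 1) {V W : Rn n → Rn n} (hV : Measurable V) (hW : Measurable W)
    (h : mNorm volume x (fun y => ‖V y‖ₑ) < ∞) (h' : mNorm volume x (fun y => ‖W y‖ₑ) < ∞) :
    invDiv α (fun y => V y + W y) =ᵐ[volume] fun y => invDiv α V y + invDiv α W y := by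
  filter_upwards [ae_rieszPotential_lt_top hα hαn hx hx1 hV h,
    ae_rieszPotential_lt_top hα hαn hx hx1 hW h'] with y h1 h2
  simp only [invDiv, gradKernel_add]
  rw [integral_add (integrable_gradKernel hV h1) (integrable_gradKernel hW h2), mul_add]

theorem lintegral_mul_fracLaplacian_lt_top {α x : ℝ} (hα : 0 < α) (hx : 0 < x) (hx1 : x ≤ 1)
    {f : Rn n → ℝ≥0∞} (hf : Measurable f) (h : mNorm volume x f < ∞) (φ : 𝓢(Rn n, ℂ)) :
    ∫⁻ y, f y * ‖fracLaplacian α φ y‖ₑ < ∞ := by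
  have hψ := (continuous_fracLaplacian hα.le φ).enorm.measurable
  have h1 := (integrable_fracLaplacian hα φ).2
  have hM : ∫⁻ ξ, ‖fracSymbol α φ ξ‖ₑ ≠ ∞ := (integrable_fracSymbol hα.le φ).2.ne
  refine (lintegral_mul_le_mNorm (μ := volume) hf hψ hx1 one_pos rfl
    (by rw [div_one]; linarith) (M := (∫⁻ ξ, ‖fracSymbol α φ ξ‖ₑ).toReal) ENNReal.toReal_nonneg
    (fun z => by rw [ENNReal.ofReal_toReal hM]; exact enorm_fracLaplacian_le φ z) h1.ne
    (mNorm_one_le _)).trans_lt ?_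
  exact ENNReal.mul_lt_top h (ENNReal.mul_lt_top (ENNReal.rpow_lt_top_of_nonneg
    (by rw [div_one]; linarith) h1.ne) ENNReal.ofReal_lt_top)

theorem integrable_smul_fracLaplacian {α x : ℝ} (hα : 0 < α) (hx : 0 < x) (hx1 : x ≤ 1)
    {f : Rn n → ℝ} (hf : StronglyMeasurable f) (h : mNorm volume x (fun y => ‖f y‖ₑ) < ∞)
    (φ : 𝓢(Rn n, ℂ)) : Integrable fun y => f y • fracLaplacian α φ y := by
  refine ⟨hf.aestronglyMeasurable.smul (continuous_fracLaplacian hα.le φ).aestronglyMeasurable, ?_⟩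
  refine lt_of_le_of_lt (le_of_eq ?_) (lintegral_mul_fracLaplacian_lt_top hα hx hx1 hf.enorm h φ)
  exact lintegral_congr fun y => enorm_smul _ _

/-- `invDiv α V` solves `(-Δ)^{α/2} w = -div V` in the sense of distributions. -/
theorem integral_invDiv_smul_fracLaplacian {α x : ℝ} (hα : 1 < α) (hαn : α - 1 < n)
    (hx : (α - 1) / n < x) (hx1 : x ≤ 1) {V : Rn n → Rn n} (hV : Measurable V)
    (h : mNorm volume x (fun y => ‖V y‖ₑ) < ∞) (φ : 𝓢(Rn n, ℂ)) :
    Integrable (fun y => fderiv ℝ (φ : Rn n → ℂ) y (V y)) ∧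
      ∫ y, invDiv α V y • fracLaplacian α φ y = ∫ y, fderiv ℝ (φ : Rn n → ℂ) y (V y) := by
  have hα0 : 0 < α := by linarith
  have hb : 0 < (α - 1) / n := by
    have : 0 < α - 1 := by linarith
    have : (0 : ℝ) < n := by linarith
    positivity
  have hψ := (continuous_fracLaplacian hα0.le φ).measurable
  obtain ⟨C, hC⟩ := exists_mNorm_rieszPotential_le (β := α - 1) (by linarith) hαn hx hx1
  have hI := (hC _ hV.enorm).trans_lt (ENNReal.mul_lt_top ENNReal.coe_lt_top h)
  have hfin := lintegral_mul_fracLaplacian_lt_top (α := α) hα0 (by linarith) (by linarith)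
    (measurable_rieszPotential (α - 1) hV.enorm) hI φ
  -- The double integral converges absolutely because the potential of |V| lies in a weak space and
  -- (-Δ)^{α/2}φ in L¹ ∩ L^∞; Fubini then reduces the claim to the kernel identity.
  have hint : Integrable (fun p : Rn n × Rn n =>
      (gradKernel α (V p.2) (p.1 - p.2) : ℂ) * fracLaplacian α φ p.1) (volume.prod volume) := by
    have hm : Measurable fun p : Rn n × Rn n =>
        (gradKernel α (V p.2) (p.1 - p.2) : ℂ) * fracLaplacian α φ p.1 :=
      (Complex.measurable_ofReal.comp (measurable_gradKernel_comp α hV)).mul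
        (hψ.comp measurable_fst)
    refine ⟨hm.aestronglyMeasurable, ?_⟩
    rw [hasFiniteIntegral_def, lintegral_prod _ hm.enorm.aemeasurable]
    refine lt_of_le_of_lt (lintegral_mono fun y => ?_) hfin
    have he : ∀ z, ‖(gradKernel α (V z) (y - z) : ℂ) * fracLaplacian α φ y‖ₑ =
        ‖gradKernel α (V z) (y - z)‖ₑ * ‖fracLaplacian α φ y‖ₑ := by
      intro z
      rw [enorm_mul, ← ofReal_norm, Complex.norm_real, ofReal_norm]
    simp_rw [he]
    rw [lintegral_mul_const' _ _ enorm_ne_top]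
    gcongr
    exact lintegral_enorm_gradKernel_le α V y
  have hgrad : ∀ y, fderiv ℝ (φ : Rn n → ℂ) y (V y) = (gradConst n α : ℂ) *
      ∫ x, (gradKernel α (V y) (x - y) : ℂ) * fracLaplacian α φ x := fun y =>
    (gradConst_mul_integral hα hαn φ (V y) y).symm
  simp_rw [hgrad]
  refine ⟨hint.integral_prod_right.const_mul _, ?_⟩
  rw [integral_const_mul, ← integral_integral_swap hint, ← integral_const_mul]
  refine integral_congr_ae (.of_forall fun y => ?_)
  simp only
  rw [integral_mul_const, integral_complex_ofReal, invDiv, Complex.real_smul]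
  push_cast; ring

end InverseDivergence

/-! ### A Liouville theorem for the fractional Laplacian -/

section Liouville

variable {n : ℕ}

/-- The bound D^{1-x} M^x has a positive power of M: uniform smallness of `k` with bounded L¹ norm
makes the pairing small. -/
theorem enorm_integral_smul_le {x : ℝ} (hx : 0 < x) (hx1 : x ≤ 1) {h : Rn n → ℝ}
    (hh : StronglyMeasurable h) {k : Rn n → ℂ} (hk : Measurable k) {M : ℝ} (hM : 0 ≤ M)
    (hkM : ∀ y, ‖k y‖ ≤ M) {D : ℝ≥0∞} (hD : D ≠ ∞) (hkD : ∫⁻ y, ‖k y‖ₑ ≤ D) :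
    ∫⁻ y, ‖h y • k y‖ₑ ≤ mNorm volume x (fun y => ‖h y‖ₑ) *
      (D ^ (1 - x) * ENNReal.ofReal (M ^ x / x)) := by
  have h1 := lintegral_mul_le_mNorm (μ := volume) hh.enorm hk.enorm hx1 one_pos (γ := 1 - x)
    (by rw [div_one]) (by linarith) hM
    (fun y => by rw [← ofReal_norm]; exact ENNReal.ofReal_le_ofReal (hkM y)) hD
    ((mNorm_one_le _).trans hkD)
  rw [sub_sub_cancel] at h1
  simpa only [enorm_smul] using h1

theorem stronglyMeasurable_dilConv (γ φ : 𝓢(Rn n, ℂ)) (t : ℝ) : StronglyMeasurable (dilConv γ φ t) :=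
  (measurable_dilConv γ φ).comp_measurable (measurable_const.prodMk measurable_id)

/-- `φ` is Lipschitz and `γ` has a finite first moment, so the mollification error is linear in t.
-/
theorem exists_norm_dilConv_sub_le (γ φ : 𝓢(Rn n, ℂ)) (hγ : ∫ z, γ z = 1) :
    ∃ L : ℝ, 0 ≤ L ∧ ∀ t : ℝ, 0 ≤ t → ∀ x, ‖dilConv γ φ t x - φ x‖ ≤ t * L := by
  obtain ⟨C, hC0, hC⟩ := φ.decay 0 1
  have hlip : ∀ x y, ‖φ x - φ y‖ ≤ C * ‖x - y‖ := fun x y =>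
    Convex.norm_image_sub_le_of_norm_fderiv_le (𝕜 := ℝ) (fun z _ => φ.differentiableAt)
      (fun z _ => by simpa [norm_iteratedFDeriv_one] using hC z) convex_univ (Set.mem_univ y)
      (Set.mem_univ x)
  have hi : Integrable fun z : Rn n => ‖z‖ * ‖γ z‖ := by
    simpa using γ.integrable_pow_mul volume 1
  refine ⟨C * ∫ z, ‖z‖ * ‖γ z‖, by positivity, fun t ht x => ?_⟩
  have hb : Integrable fun z => γ z * φ (x - t • z) := by
    obtain ⟨B, -, hB⟩ := φ.decay 0 0
    have := φ.continuous
    refine γ.integrable.mul_bdd (c := B) (Continuous.aestronglyMeasurable (by fun_prop))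
      (.of_forall fun z => by simpa using hB (x - t • z))
  have h1 : dilConv γ φ t x - φ x = ∫ z, γ z * (φ (x - t • z) - φ x) := by
    simp_rw [mul_sub]
    rw [integral_sub hb (γ.integrable.mul_const _), integral_mul_const, hγ, one_mul, dilConv]
  rw [h1, ← integral_const_mul, ← integral_const_mul]
  refine norm_integral_le_of_norm_le ((hi.const_mul C).const_mul t) (.of_forall fun z => ?_)
  rw [norm_mul]
  calc ‖γ z‖ * ‖φ (x - t • z) - φ x‖ ≤ ‖γ z‖ * (C * ‖x - t • z - x‖) := by
        gcongr; exact hlip _ _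
    _ = _ := by
        rw [sub_sub_cancel_left, norm_neg, norm_smul, Real.norm_of_nonneg ht]; ring

/-- Bound `γ` by its supremum and rescale: for large t the convolution spreads out and is of size
t^{-n}. -/
theorem exists_norm_dilConv_le (γ φ : 𝓢(Rn n, ℂ)) :
    ∃ L : ℝ, 0 ≤ L ∧ ∀ t : ℝ, 0 < t → ∀ x, ‖dilConv γ φ t x‖ ≤ (t ^ n)⁻¹ * L := by
  obtain ⟨B, hB0, hB⟩ := γ.decay 0 0
  refine ⟨B * ∫ z, ‖φ z‖, by positivity, fun t ht x => ?_⟩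
  have hi : Integrable fun z : Rn n => B * ‖φ (x - t • z)‖ := by
    have h1 : Integrable fun z => ‖φ (x - z)‖ := φ.integrable.norm.comp_sub_left x
    exact (h1.comp_smul ht.ne').const_mul B
  refine (norm_integral_le_of_norm_le hi (.of_forall fun z => ?_)).trans (le_of_eq ?_)
  · rw [norm_mul]
    gcongr
    simpa using hB z
  · rw [integral_const_mul, Measure.integral_comp_smul volume (fun z => ‖φ (x - z)‖) t,
      integral_sub_left_eq_self (fun z => ‖φ z‖), finrank_euclideanSpace_fin, smul_eq_mul,
      abs_of_pos (by positivity)]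
    ring

theorem integral_fourierInv_radialCutoff : ∫ z, (𝓕⁻ (radialCutoff n 0)) z = 1 := by
  have h := fourier_radialCutoff (n := n) 0 0
  rw [SchwartzMap.fourier_coe, Real.fourier_eq] at h
  simpa [cutoffProfile, Real.smoothTransition.one_of_one_le] using h

/-- Frequency-localized functions are in the range of the fractional Laplacian. -/
theorem exists_fracLaplacian_eq_dilConv_sub (α : ℝ) (θ : 𝓢(Rn n, ℂ)) {ε : ℝ} (hε : 0 < ε)
    (hε1 : ε ≤ 1) : ∃ φ : 𝓢(Rn n, ℂ), fracLaplacian α φ =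
      fun x => dilConv (𝓕⁻ (radialCutoff n 0)) θ ε x - dilConv (𝓕⁻ (radialCutoff n 0)) θ ε⁻¹ x := by
  -- Both cutoffs are 1 for |ξ| ≤ ε and 0 for |ξ| > 2/ε. Their difference is carried by an annulus,
  -- where dividing by the symbol preserves smoothness.
  set a : Rn n → ℂ := fun ξ => radialCutoff n 0 (ε • ξ) - radialCutoff n 0 (ε⁻¹ • ξ) with ha
  have ha0 : ∀ ξ : Rn n, ‖ξ‖ ≤ ε → a ξ = 0 := by
    intro ξ hξ
    have h1 : ‖ε • ξ‖ ≤ 1 := by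
      rw [norm_smul, Real.norm_of_nonneg hε.le]; nlinarith [norm_nonneg ξ]
    have h2 : ‖ε⁻¹ • ξ‖ ≤ 1 := by
      rw [norm_smul, Real.norm_of_nonneg (by positivity), inv_mul_le_iff₀ hε]; linarith
    simp only [ha, radialCutoff_apply]
    rw [cutoffProfile_eq _ (by nlinarith [norm_nonneg (ε • ξ)]),
      cutoffProfile_eq _ (by nlinarith [norm_nonneg (ε⁻¹ • ξ)])]
    simp
  have ha1 : ∀ ξ : Rn n, 2 / ε < ‖ξ‖ → a ξ = 0 := by
    intro ξ hξ
    rw [div_lt_iff₀ hε] at hξ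
    have hinv : 1 ≤ ε⁻¹ := (one_le_inv₀ hε).2 hε1
    have h1 : 2 ≤ ‖ε • ξ‖ := by
      rw [norm_smul, Real.norm_of_nonneg hε.le]; linarith
    have h2 : 2 ≤ ‖ε⁻¹ • ξ‖ := by
      rw [norm_smul, Real.norm_of_nonneg (by positivity)]
      nlinarith [norm_nonneg ξ]
    simp only [ha, radialCutoff_apply]
    rw [cutoffProfile_eq_zero _ (by nlinarith), cutoffProfile_eq_zero _ (by nlinarith)]
    simp
  have hac : ContDiff ℝ (⊤ : ℕ∞) a :=
    (((radialCutoff n 0).smooth ⊤).comp (contDiff_const_smul ε)).sub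
      (((radialCutoff n 0).smooth ⊤).comp (contDiff_const_smul ε⁻¹))
  set G : Rn n → ℂ := fun ξ => ((2 * Real.pi * ‖ξ‖) ^ (-α) : ℝ) • (a ξ * 𝓕 θ ξ) with hG
  have hGs : HasCompactSupport G := by
    refine HasCompactSupport.intro (isCompact_closedBall 0 (2 / ε)) fun ξ hξ => ?_
    rw [mem_closedBall_zero_iff, not_le] at hξ
    simp [hG, ha1 ξ hξ]
  have hGc : ContDiff ℝ (⊤ : ℕ∞) G := by
    rw [contDiff_iff_contDiffAt]
    intro ξ
    rcases eq_or_ne ξ 0 with rfl | hξ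
    · refine (contDiffAt_const (c := (0 : ℂ))).congr_of_eventuallyEq ?_
      filter_upwards [Metric.ball_mem_nhds (0 : Rn n) hε] with ξ hξ
      rw [mem_ball_zero_iff] at hξ
      simp [hG, ha0 ξ hξ.le]
    · have h1 : ContDiffAt ℝ (⊤ : ℕ∞) (fun ξ : Rn n => (2 * Real.pi * ‖ξ‖) ^ (-α)) ξ := by
        refine ContDiffAt.rpow_const_of_ne (contDiffAt_const.mul (contDiffAt_norm ℝ hξ)) ?_
        have : 0 < ‖ξ‖ := norm_pos_iff.2 hξ
        positivity
      exact h1.smul (hac.contDiffAt.mul ((𝓕 θ).smooth ⊤).contDiffAt)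
  refine ⟨𝓕⁻ (hGs.toSchwartzMap hGc), ?_⟩
  ext x
  have hsym : fracSymbol α (𝓕⁻ (hGs.toSchwartzMap hGc)) =
      fun ξ => 𝓕 (𝓕⁻ (radialCutoff n 0)) (ε • ξ) * 𝓕 θ ξ -
        𝓕 (𝓕⁻ (radialCutoff n 0)) (ε⁻¹ • ξ) * 𝓕 θ ξ := by
    ext ξ
    rw [fracSymbol, ← SchwartzMap.fourier_coe, FourierTransform.fourier_fourierInv_eq,
      FourierTransform.fourier_fourierInv_eq]
    change ((2 * Real.pi * ‖ξ‖) ^ α : ℝ) • G ξ = _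
    rw [← sub_mul]
    change _ = a ξ * 𝓕 θ ξ
    rcases eq_or_ne ξ 0 with rfl | hξ
    · simp [hG, ha0 0 (by simpa using hε.le)]
    · have : 0 < ‖ξ‖ := norm_pos_iff.2 hξ
      rw [hG]
      simp only
      rw [smul_smul, ← Real.rpow_add (by positivity), add_neg_cancel, Real.rpow_zero, one_smul]
  have hdil : ∀ t : ℝ, Integrable fun ξ : Rn n => 𝓕 (𝓕⁻ (radialCutoff n 0)) (t • ξ) * 𝓕 θ ξ := by
    intro t
    obtain ⟨B, -, hB⟩ := (radialCutoff n 0).decay 0 0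
    simp only [FourierTransform.fourier_fourierInv_eq]
    have := (radialCutoff n 0).continuous
    refine (𝓕 θ).integrable.bdd_mul (c := B) (Continuous.aestronglyMeasurable (by fun_prop))
      (.of_forall fun z => by simpa using hB (t • z))
  rw [fracLaplacian_eq, hsym, ← fourierInv_dilate_mul, ← fourierInv_dilate_mul, Real.fourierInv_eq,
    Real.fourierInv_eq, Real.fourierInv_eq, ← integral_sub]
  · simp_rw [smul_sub]
  · simpa using (Real.fourierIntegral_convergent_iff (-x)).2 (hdil ε)
  · simpa using (Real.fourierIntegral_convergent_iff (-x)).2 (hdil ε⁻¹)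

/-- `θ` is replaced by its band-pass truncation, which is in the range of (-Δ)^{α/2} and so is
annihilated by `h`. The remainder stays bounded in L¹ and is uniformly O(ε + εⁿ), so its pairing
with `h` tends to 0. Positivity of `x` is what excludes constants. -/
theorem integral_smul_schwartz_eq_zero {α x : ℝ} (hn : n ≠ 0) (hα : 0 < α) (hx : 0 < x) (hx1 : x ≤ 1)
    {h : Rn n → ℝ} (hh : StronglyMeasurable h) (hfin : mNorm volume x (fun y => ‖h y‖ₑ) < ∞)
    (hzero : ∀ φ : 𝓢(Rn n, ℂ), ∫ y, h y • fracLaplacian α φ y = 0) (θ : 𝓢(Rn n, ℂ)) :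
    ∫ y, h y • θ y = 0 := by
  set γ : 𝓢(Rn n, ℂ) := 𝓕⁻ (radialCutoff n 0)
  obtain ⟨L, hL0, hL⟩ := exists_norm_dilConv_sub_le γ θ integral_fourierInv_radialCutoff
  obtain ⟨L', hL'0, hL'⟩ := exists_norm_dilConv_le γ θ
  set D₁ := (∫⁻ z, ‖γ z‖ₑ) * ∫⁻ x, ‖θ x‖ₑ
  set D := (∫⁻ x, ‖θ x‖ₑ) + (D₁ + D₁)
  have hD₁ : D₁ < ∞ := ENNReal.mul_lt_top (lintegral_enorm_schwartz_lt_top _)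
    (lintegral_enorm_schwartz_lt_top _)
  have hD : D < ∞ := ENNReal.add_lt_top.2 ⟨lintegral_enorm_schwartz_lt_top _,
    ENNReal.add_lt_top.2 ⟨hD₁, hD₁⟩⟩
  set N := mNorm volume x (fun y => ‖h y‖ₑ)
  have hbound : ∀ ε : ℝ, 0 < ε → ε ≤ 1 → ‖∫ y, h y • θ y‖ₑ ≤
      N * (D ^ (1 - x) * ENNReal.ofReal ((ε * L + ε ^ n * L') ^ x / x)) := by
    intro ε hε hε1
    obtain ⟨φ, hφ⟩ := exists_fracLaplacian_eq_dilConv_sub α θ hε hε1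
    set k : Rn n → ℂ := fun y => θ y - (dilConv γ θ ε y - dilConv γ θ ε⁻¹ y) with hk
    have hkm : Measurable k := θ.continuous.measurable.sub
      ((stronglyMeasurable_dilConv γ θ ε).measurable.sub (stronglyMeasurable_dilConv γ θ ε⁻¹).measurable)
    have hkM : ∀ y, ‖k y‖ ≤ ε * L + ε ^ n * L' := by
      intro y
      have e : k y = -(dilConv γ θ ε y - θ y) + dilConv γ θ ε⁻¹ y := by rw [hk]; ring
      rw [e]
      refine (norm_add_le _ _).trans (add_le_add ?_ ?_)
      · rw [norm_neg]; exact hL ε hε.le y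
      · simpa using hL' ε⁻¹ (by positivity) y
    have hkD : ∫⁻ y, ‖k y‖ₑ ≤ D := by
      calc ∫⁻ y, ‖k y‖ₑ ≤ ∫⁻ y, (‖θ y‖ₑ + (‖dilConv γ θ ε y‖ₑ + ‖dilConv γ θ ε⁻¹ y‖ₑ)) :=
            lintegral_mono fun y => (enorm_sub_le).trans (by gcongr; exact enorm_sub_le)
        _ = (∫⁻ y, ‖θ y‖ₑ) + ((∫⁻ y, ‖dilConv γ θ ε y‖ₑ) + ∫⁻ y, ‖dilConv γ θ ε⁻¹ y‖ₑ) := by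
            rw [lintegral_add_left θ.continuous.enorm.measurable,
              lintegral_add_left (stronglyMeasurable_dilConv γ θ ε).enorm]
        _ ≤ D := add_le_add le_rfl
            (add_le_add (lintegral_dilConv_le γ θ _) (lintegral_dilConv_le γ θ _))
    have hlin := enorm_integral_smul_le hx hx1 hh hkm (by positivity) hkM hD.ne hkD
    have hki : Integrable fun y => h y • k y :=
      ⟨hh.aestronglyMeasurable.smul hkm.aestronglyMeasurable, hlin.trans_lt
        (ENNReal.mul_lt_top hfin (ENNReal.mul_lt_top (ENNReal.rpow_lt_top_of_nonneg
          (by linarith) hD.ne) ENNReal.ofReal_lt_top))⟩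
    have heq : ∫ y, h y • θ y = ∫ y, h y • k y := by
      rw [← add_zero (∫ y, h y • k y), ← hzero φ, ← integral_add hki
        (integrable_smul_fracLaplacian hα hx hx1 hh hfin φ)]
      refine integral_congr_ae (.of_forall fun y => ?_)
      simp only [hφ, hk, ← smul_add]
      congr 1
      ring
    rw [heq]
    exact (enorm_integral_le_lintegral_enorm _).trans hlin
  have hlim : Filter.Tendsto (fun ε : ℝ => N * (D ^ (1 - x) *
      ENNReal.ofReal ((ε * L + ε ^ n * L') ^ x / x))) (nhdsWithin 0 (Set.Ioi 0)) (nhds 0) := by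
    have h1 : Continuous fun ε : ℝ => (ε * L + ε ^ n * L') ^ x / x :=
      ((Real.continuous_rpow_const hx.le).comp (by fun_prop)).div_const _
    have h2 : Filter.Tendsto (fun ε : ℝ => ENNReal.ofReal ((ε * L + ε ^ n * L') ^ x / x))
        (nhdsWithin 0 (Set.Ioi 0)) (nhds 0) := by
      have h3 := (ENNReal.continuous_ofReal.comp h1).tendsto 0
      simp only [Function.comp, zero_mul, zero_pow hn, add_zero, Real.zero_rpow hx.ne',
        zero_div, ENNReal.ofReal_zero] at h3
      exact h3.mono_left nhdsWithin_le_nhds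
    have hDx : D ^ (1 - x) ≠ ∞ := ENNReal.rpow_ne_top_of_nonneg (by linarith) hD.ne
    have h4 := ENNReal.Tendsto.const_mul (ENNReal.Tendsto.const_mul h2 (.inr hDx)) (.inr hfin.ne)
    simpa using h4
  have hle : ‖∫ y, h y • θ y‖ₑ ≤ 0 := by
    refine ge_of_tendsto hlim ?_
    filter_upwards [Ioc_mem_nhdsGT (show (0 : ℝ) < 1 by norm_num)] with ε hε
    exact hbound ε hε.1 hε.2
  simpa using hle

theorem locallyIntegrable_of_mNorm {x : ℝ} {h : Rn n → ℝ}
    (hh : StronglyMeasurable h) (hfin : mNorm volume x (fun y => ‖h y‖ₑ) < ∞) :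
    LocallyIntegrable h := by
  intro y
  refine ⟨Metric.ball y 1, Metric.ball_mem_nhds y one_pos, hh.aestronglyMeasurable, ?_⟩
  have h1 : volume (Metric.ball y 1) ≠ 0 := (Metric.measure_ball_pos volume y one_pos).ne'
  have h2 : volume (Metric.ball y 1) ≠ ∞ := measure_ball_lt_top.ne
  refine (setLIntegral_le_mNorm x _ Metric.isOpen_ball.measurableSet h2).trans_lt
    (ENNReal.mul_lt_top hfin (lt_top_iff_ne_top.2 ?_))
  simp [ENNReal.rpow_eq_top_iff, h1, h2]

/-- A Liouville theorem: a function in a weak Lebesgue space annihilated by `(-Δ)^{α/2}` in the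
sense of distributions vanishes. -/
theorem ae_eq_zero_of_fracLaplacian {α x : ℝ} (hn : n ≠ 0) (hα : 0 < α) (hx : 0 < x) (hx1 : x ≤ 1)
    {h : Rn n → ℝ} (hh : StronglyMeasurable h) (hfin : mNorm volume x (fun y => ‖h y‖ₑ) < ∞)
    (hzero : ∀ φ : 𝓢(Rn n, ℂ), ∫ y, h y • fracLaplacian α φ y = 0) : h =ᵐ[volume] 0 := by
  refine ae_eq_zero_of_integral_contDiff_smul_eq_zero (locallyIntegrable_of_mNorm hh hfin)
    fun g hg hgs => ?_
  have hgs' : HasCompactSupport fun y => (g y : ℂ) := hgs.comp_left (g := Complex.ofReal) rfl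
  have h1 := integral_smul_schwartz_eq_zero hn hα hx hx1 hh hfin hzero
    (hgs'.toSchwartzMap (Complex.ofRealCLM.contDiff.comp hg))
  have h2 : ∫ y, h y • (g y : ℂ) = 0 := h1
  have h3 : ∀ y, h y • (g y : ℂ) = ((g y • h y : ℝ) : ℂ) := by
    intro y
    rw [Complex.real_smul, smul_eq_mul]; push_cast; ring
  simp_rw [h3] at h2
  rw [integral_complex_ofReal] at h2
  exact_mod_cast h2

end Liouville

/-! ### Weak norms of fields and the fixed point theorem -/

section FieldNorm

variable {n : ℕ} {F : Type*} [NormedAddCommGroup F]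

/-- The Marcinkiewicz norm of a field on `ℝⁿ`. -/
def wNorm (x : ℝ) (f : Rn n →ₘ[(volume : Measure (Rn n))] F) : ℝ≥0∞ :=
  mNorm volume x (fun y => ‖f y‖ₑ)

theorem wNorm_zero (x : ℝ) : wNorm x (0 : Rn n →ₘ[(volume : Measure (Rn n))] F) = 0 := by
  rw [wNorm, ← mNorm_zero (μ := (volume : Measure (Rn n))) x]
  refine mNorm_congr_ae ?_
  filter_upwards [AEEqFun.coeFn_zero (α := Rn n) (β := F) (μ := volume)] with y hy
  simp [hy]

theorem wNorm_neg (x : ℝ) (f : Rn n →ₘ[(volume : Measure (Rn n))] F) :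
    wNorm x (-f) = wNorm x f := by
  refine mNorm_congr_ae ?_
  filter_upwards [AEEqFun.coeFn_neg f] with y hy
  simp [hy]

theorem wNorm_add_le (x : ℝ) (f g : Rn n →ₘ[(volume : Measure (Rn n))] F) :
    wNorm x (f + g) ≤ wNorm x f + wNorm x g := by
  refine (mNorm_mono_ae ?_).trans (mNorm_add_le f.stronglyMeasurable.enorm.aemeasurable)
  filter_upwards [AEEqFun.coeFn_add f g] with y hy
  simp only [hy, Pi.add_apply]
  exact enorm_add_le _ _

theorem wNorm_sub_comm (x : ℝ) (f g : Rn n →ₘ[(volume : Measure (Rn n))] F) :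
    wNorm x (f - g) = wNorm x (g - f) := by
  rw [← wNorm_neg, neg_sub]

theorem wNorm_sub_le (x : ℝ) (f g : Rn n →ₘ[(volume : Measure (Rn n))] F) :
    wNorm x (f - g) ≤ wNorm x f + wNorm x g := by
  rw [sub_eq_add_neg, ← wNorm_neg x g]
  exact wNorm_add_le x f (-g)

theorem wNorm_sub_le_add (x : ℝ) (f g h : Rn n →ₘ[(volume : Measure (Rn n))] F) :
    wNorm x (f - h) ≤ wNorm x (f - g) + wNorm x (g - h) := by
  rw [← sub_add_sub_cancel f g h]
  exact wNorm_add_le x _ _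

theorem wNorm_le_add_sub (x : ℝ) (f g : Rn n →ₘ[(volume : Measure (Rn n))] F) :
    wNorm x f ≤ wNorm x g + wNorm x (f - g) := by
  conv_lhs => rw [← add_sub_cancel g f]
  exact wNorm_add_le x _ _

theorem eq_zero_of_wNorm {x : ℝ} {f : Rn n →ₘ[(volume : Measure (Rn n))] F}
    (h : wNorm x f = 0) : f = 0 := by
  refine AEEqFun.ext ?_
  filter_upwards [ae_eq_zero_of_mNorm f.stronglyMeasurable.enorm.aemeasurable h,
    AEEqFun.coeFn_zero (α := Rn n) (β := F) (μ := volume)] with y hy hy0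
  rw [hy0]
  simpa using hy

theorem eq_zero_of_wNorm_le_half {x : ℝ} {f : Rn n →ₘ[(volume : Measure (Rn n))] F}
    (hf : wNorm x f ≠ ∞) (h : wNorm x f ≤ 2⁻¹ * wNorm x f) : f = 0 := by
  refine eq_zero_of_wNorm (x := x) ?_
  by_contra h0
  have h1 : 2⁻¹ * wNorm x f < 1 * wNorm x f := by
    rw [ENNReal.mul_lt_mul_iff_left h0 hf]
    exact ENNReal.one_half_lt_one
  rw [one_mul] at h1
  exact absurd h (not_le.2 h1)

theorem wNorm_le_lorentzNorm {p : ℝ} (hp : 1 < p) (f : Rn n →ₘ[(volume : Measure (Rn n))] F) :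
    wNorm (1 / p) f ≤ ENNReal.ofReal (1 / (1 - 1 / p)) * lorentzNorm f p ∞ :=
  mNorm_le_lorentzNorm f.stronglyMeasurable hp

theorem lorentzNorm_le_wNorm {p : ℝ} (hp : 0 < p) (f : Rn n →ₘ[(volume : Measure (Rn n))] F) :
    lorentzNorm f p ∞ ≤ wNorm (1 / p) f :=
  lorentzNorm_le_mNorm f.stronglyMeasurable hp

theorem memLorentz_of_wNorm {p : ℝ} (hp : 0 < p) {f : Rn n →ₘ[(volume : Measure (Rn n))] F}
    (h : wNorm (1 / p) f < ∞) : MemLorentz f p ∞ :=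
  ⟨f.aestronglyMeasurable, (lorentzNorm_le_wNorm hp f).trans_lt h⟩

theorem tsum_half_pow_mul (M : ℝ≥0∞) (k : ℕ) :
    ∑' j : ℕ, (2⁻¹ : ℝ≥0∞) ^ (k + j) * M = 2⁻¹ ^ k * (2 * M) := by
  simp_rw [pow_add]
  rw [ENNReal.tsum_mul_right, ENNReal.tsum_mul_left, ENNReal.tsum_geometric,
    ENNReal.one_sub_inv_two, inv_inv, mul_assoc]

theorem tendsto_half_pow_mul {M : ℝ≥0∞} (hM : M ≠ ∞) :
    Filter.Tendsto (fun k : ℕ => (2⁻¹ : ℝ≥0∞) ^ k * M) Filter.atTop (nhds 0) := by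
  have h := ENNReal.Tendsto.mul_const (ENNReal.tendsto_pow_atTop_nhds_zero_of_lt_one
    ENNReal.one_half_lt_one) (.inr hM)
  simpa using h

/-- Banach's fixed point theorem in a ball for the Marcinkiewicz norm. -/
theorem exists_fixedPoint_wNorm {x : ℝ} {Φ : ScalarField n → ScalarField n} {M : ℝ≥0∞}
    (hM : M ≠ ∞) (hmaps : ∀ u, wNorm x u ≤ M → wNorm x (Φ u) ≤ M)
    (hcontr : ∀ u v, wNorm x u ≤ M → wNorm x v ≤ M →
      wNorm x (Φ u - Φ v) ≤ 2⁻¹ * wNorm x (u - v)) :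
    ∃ u, wNorm x u ≤ M ∧ Φ u = u := by
  set s : ℕ → ScalarField n := fun k => Φ^[k] 0 with hs
  have hsucc : ∀ k, s (k + 1) = Φ (s k) := fun k => Function.iterate_succ_apply' Φ k 0
  have hball : ∀ k, wNorm x (s k) ≤ M := by
    intro k
    induction k with
    | zero => simp [hs, wNorm_zero]
    | succ k ih => rw [hsucc]; exact hmaps _ ih
  have hd : ∀ k, wNorm x (s k - s (k + 1)) ≤ 2⁻¹ ^ k * M := by
    intro k
    induction k with
    | zero =>
      have : s 0 = 0 := rfl
      rw [this, zero_sub, wNorm_neg, pow_zero, one_mul]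
      exact hball 1
    | succ k ih =>
      rw [hsucc, hsucc (k + 1)]
      refine (hcontr _ _ (hball _) (hball _)).trans ?_
      rw [pow_succ', mul_assoc]
      exact mul_le_mul_right ih _
  -- The sum of the increments has finite weak norm, hence is finite almost everywhere. So the
  -- iterates converge pointwise, and the tails of the sum bound the distance to the limit in norm.
  set D : ℕ → Rn n → ℝ≥0∞ := fun k y => edist (s k y) (s (k + 1) y) with hD
  have hDm : ∀ k, Measurable (D k) := fun k =>
    ((s k).stronglyMeasurable.edist (s (k + 1)).stronglyMeasurable).measurable
  have hDn : ∀ k, mNorm volume x (D k) ≤ 2⁻¹ ^ k * M := by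
    intro k
    refine le_trans (le_of_eq (mNorm_congr_ae ?_)) (hd k)
    filter_upwards [AEEqFun.coeFn_sub (s k) (s (k + 1))] with y hy
    rw [hy, hD]
    simp [edist_eq_enorm_sub]
  have htail : ∀ k, mNorm volume x (fun y => ∑' j, D (k + j) y) ≤ 2⁻¹ ^ k * (2 * M) := by
    intro k
    refine (mNorm_tsum_le fun j => (hDm _).aemeasurable).trans ?_
    rw [← tsum_half_pow_mul]
    exact ENNReal.tsum_le_tsum fun j => hDn _
  have hfin : ∀ᵐ y, ∑' j, D j y < ∞ := by
    refine ae_lt_top_of_mNorm (x := x) (Measurable.tsum hDm).aemeasurable ?_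
    have := htail 0
    simp only [zero_add, pow_zero, one_mul] at this
    exact this.trans_lt (ENNReal.mul_lt_top (by simp) hM.lt_top)
  have hconv : ∀ᵐ y, ∃ l, Filter.Tendsto (fun k => s k y) Filter.atTop (nhds l) := by
    filter_upwards [hfin] with y hy
    exact cauchySeq_tendsto_of_complete
      (cauchySeq_of_edist_le_of_tsum_ne_top (fun k => D k y) (fun k => le_rfl) hy.ne)
  obtain ⟨f, hf, hlim⟩ := exists_stronglyMeasurable_limit_of_tendsto_ae
    (fun k => (s k).aestronglyMeasurable) hconv
  set u : ScalarField n := AEEqFun.mk f hf.aestronglyMeasurable with hu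
  have hclose : ∀ k, wNorm x (s k - u) ≤ 2⁻¹ ^ k * (2 * M) := by
    intro k
    refine le_trans (mNorm_mono_ae ?_) (htail k)
    filter_upwards [hfin, hlim, AEEqFun.coeFn_sub (s k) u, AEEqFun.coeFn_mk f hf.aestronglyMeasurable]
      with y hy hl h1 h2
    rw [h1, Pi.sub_apply, ← edist_eq_enorm_sub, hu, h2]
    exact edist_le_tsum_of_edist_le_of_tendsto (fun k => D k y) (fun k => le_rfl) hl k
  have h2M : 2 * M ≠ ∞ := ENNReal.mul_ne_top (by simp) hM
  have hlim0 := tendsto_half_pow_mul h2M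
  have huM : wNorm x u ≤ M := by
    have h1 : Filter.Tendsto (fun k : ℕ => M + 2⁻¹ ^ k * (2 * M)) Filter.atTop (nhds (M + 0)) :=
      hlim0.const_add M
    rw [add_zero] at h1
    refine ge_of_tendsto' h1 fun k => ?_
    refine (wNorm_le_add_sub x u (s k)).trans (add_le_add (hball k) ?_)
    rw [wNorm_sub_comm]
    exact hclose k
  refine ⟨u, huM, ?_⟩
  rw [← sub_eq_zero]
  refine eq_zero_of_wNorm (x := x) (le_antisymm ?_ zero_le)
  have h1 : Filter.Tendsto (fun k : ℕ => 2⁻¹ ^ k * (2 * M) + 2⁻¹ ^ (k + 1) * (2 * M))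
      Filter.atTop (nhds (0 + 0)) :=
    hlim0.add (hlim0.comp (Filter.tendsto_add_atTop_nat 1))
  rw [add_zero] at h1
  refine ge_of_tendsto' h1 fun k => ?_
  refine (wNorm_sub_le_add x _ (s (k + 1)) _).trans (add_le_add ?_ (hclose (k + 1)))
  rw [hsucc]
  refine (hcontr _ _ huM (hball k)).trans ?_
  rw [wNorm_sub_comm]
  refine (mul_le_mul_right (hclose k) _).trans ?_
  refine (mul_le_mul_left ENNReal.one_half_lt_one.le _).trans (one_mul _).le

end FieldNorm

/-! ### The bilinear Duhamel term -/

section DriftTerm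

variable {n : ℕ}

/-- The Duhamel term `-(-Δ)^{-α/2} div (w V)`. -/
def driftTerm (α : ℝ) (w : ScalarField n) (V : VectorField n) : ScalarField n :=
  AEEqFun.mk (invDiv α fun y => w y • V y)
    (stronglyMeasurable_invDiv α
      (w.stronglyMeasurable.smul V.stronglyMeasurable).measurable).aestronglyMeasurable

theorem measurable_field_smul (w : ScalarField n) (V : VectorField n) :
    Measurable fun y => w y • V y :=
  (w.stronglyMeasurable.smul V.stronglyMeasurable).measurable

theorem coeFn_driftTerm (α : ℝ) (w : ScalarField n) (V : VectorField n) :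
    driftTerm α w V =ᵐ[volume] invDiv α fun y => w y • V y :=
  AEEqFun.coeFn_mk _ _

theorem mNorm_field_smul_le {x y : ℝ} (hx : 0 < x) (hy : 0 < y) (hxy : x + y < 1)
    (w : ScalarField n) (V : VectorField n) :
    mNorm volume (x + y) (fun z => ‖w z • V z‖ₑ) ≤
      ENNReal.ofReal (1 / (1 - (x + y))) * (2 * (wNorm x w * wNorm y V)) := by
  simp_rw [enorm_smul]
  exact mNorm_mul_le w.stronglyMeasurable.enorm V.stronglyMeasurable.enorm hx hy hxy

theorem mNorm_field_smul_lt_top {x y : ℝ} (hx : 0 < x) (hy : 0 < y) (hxy : x + y < 1)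
    {w : ScalarField n} {V : VectorField n} (hw : wNorm x w < ∞) (hV : wNorm y V < ∞) :
    mNorm volume (x + y) (fun z => ‖w z • V z‖ₑ) < ∞ :=
  (mNorm_field_smul_le hx hy hxy w V).trans_lt (ENNReal.mul_lt_top ENNReal.ofReal_lt_top
    (ENNReal.mul_lt_top (by simp) (ENNReal.mul_lt_top hw hV)))

/-- Hölder puts the product at x + y, and the inverse divergence lowers this by (α-1)/n. -/
theorem exists_wNorm_driftTerm_le {α x y : ℝ} (hα : 1 < α) (hαn : α - 1 < n) (hx : 0 < x)
    (hy : 0 < y) (hxy : x + y < 1) (hb : (α - 1) / n < x + y) :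
    ∃ C : ℝ≥0, ∀ (w : ScalarField n) (V : VectorField n),
      wNorm (x + y - (α - 1) / n) (driftTerm α w V) ≤ C * (wNorm x w * wNorm y V) := by
  obtain ⟨C, hC⟩ := exists_mNorm_invDiv_le hα hαn hb hxy.le
  refine ⟨C * ((1 / (1 - (x + y))).toNNReal * 2), fun w V => ?_⟩
  have h1 : wNorm (x + y - (α - 1) / n) (driftTerm α w V) =
      mNorm volume (x + y - (α - 1) / n) (fun z => ‖invDiv α (fun y => w y • V y) z‖ₑ) := by
    refine mNorm_congr_ae ?_
    filter_upwards [coeFn_driftTerm α w V] with z hz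
    rw [hz]
  rw [h1]
  refine (hC _ (measurable_field_smul w V)).trans ?_
  refine (mul_le_mul_right (mNorm_field_smul_le hx hy hxy w V) _).trans (le_of_eq ?_)
  have e : (((1 / (1 - (x + y))).toNNReal : ℝ≥0) : ℝ≥0∞) = ENNReal.ofReal (1 / (1 - (x + y))) := rfl
  push_cast
  rw [e]
  ring

theorem driftTerm_add_left {α x y : ℝ} (hα : 1 < α) (hαn : α - 1 < n) (hx : 0 < x)
    (hy : 0 < y) (hxy : x + y < 1) (hb : (α - 1) / n < x + y) {w w' : ScalarField n}
    {V : VectorField n} (hw : wNorm x w < ∞) (hw' : wNorm x w' < ∞) (hV : wNorm y V < ∞) :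
    driftTerm α (w + w') V = driftTerm α w V + driftTerm α w' V := by
  have h1 : invDiv α (fun y => (w + w') y • V y) = invDiv α (fun y => w y • V y + w' y • V y) := by
    refine invDiv_congr_ae α ?_
    filter_upwards [AEEqFun.coeFn_add w w'] with z hz
    rw [hz, Pi.add_apply, add_smul]
  refine AEEqFun.ext ?_
  filter_upwards [coeFn_driftTerm α (w + w') V, coeFn_driftTerm α w V, coeFn_driftTerm α w' V,
    AEEqFun.coeFn_add (driftTerm α w V) (driftTerm α w' V),
    invDiv_add_ae hα hαn hb hxy.le (measurable_field_smul w V) (measurable_field_smul w' V)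
      (mNorm_field_smul_lt_top hx hy hxy hw hV) (mNorm_field_smul_lt_top hx hy hxy hw' hV)]
    with z h2 h3 h4 h5 h6
  rw [h2, h5, Pi.add_apply, h3, h4, h1, h6]

theorem driftTerm_add_right {α x y : ℝ} (hα : 1 < α) (hαn : α - 1 < n) (hx : 0 < x)
    (hy : 0 < y) (hxy : x + y < 1) (hb : (α - 1) / n < x + y) {w : ScalarField n}
    {V V' : VectorField n} (hw : wNorm x w < ∞) (hV : wNorm y V < ∞) (hV' : wNorm y V' < ∞) :
    driftTerm α w (V + V') = driftTerm α w V + driftTerm α w V' := by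
  have h1 : invDiv α (fun y => w y • (V + V') y) = invDiv α (fun y => w y • V y + w y • V' y) := by
    refine invDiv_congr_ae α ?_
    filter_upwards [AEEqFun.coeFn_add V V'] with z hz
    rw [hz, Pi.add_apply, smul_add]
  refine AEEqFun.ext ?_
  filter_upwards [coeFn_driftTerm α w (V + V'), coeFn_driftTerm α w V, coeFn_driftTerm α w V',
    AEEqFun.coeFn_add (driftTerm α w V) (driftTerm α w V'),
    invDiv_add_ae hα hαn hb hxy.le (measurable_field_smul w V) (measurable_field_smul w V')
      (mNorm_field_smul_lt_top hx hy hxy hw hV) (mNorm_field_smul_lt_top hx hy hxy hw hV')]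
    with z h2 h3 h4 h5 h6
  rw [h2, h5, Pi.add_apply, h3, h4, h1, h6]

theorem driftTerm_sub_left {α x y : ℝ} (hα : 1 < α) (hαn : α - 1 < n) (hx : 0 < x)
    (hy : 0 < y) (hxy : x + y < 1) (hb : (α - 1) / n < x + y) {w w' : ScalarField n}
    {V : VectorField n} (hw : wNorm x w < ∞) (hw' : wNorm x w' < ∞) (hV : wNorm y V < ∞) :
    driftTerm α (w - w') V = driftTerm α w V - driftTerm α w' V := by
  have hs : wNorm x (w - w') < ∞ :=
    (wNorm_sub_le x w w').trans_lt (ENNReal.add_lt_top.2 ⟨hw, hw'⟩)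
  rw [eq_sub_iff_add_eq, ← driftTerm_add_left hα hαn hx hy hxy hb hs hw' hV, sub_add_cancel]

theorem driftTerm_sub_right {α x y : ℝ} (hα : 1 < α) (hαn : α - 1 < n) (hx : 0 < x)
    (hy : 0 < y) (hxy : x + y < 1) (hb : (α - 1) / n < x + y) {w : ScalarField n}
    {V V' : VectorField n} (hw : wNorm x w < ∞) (hV : wNorm y V < ∞) (hV' : wNorm y V' < ∞) :
    driftTerm α w (V - V') = driftTerm α w V - driftTerm α w V' := by
  have hs : wNorm y (V - V') < ∞ :=
    (wNorm_sub_le y V V').trans_lt (ENNReal.add_lt_top.2 ⟨hV, hV'⟩)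
  rw [eq_sub_iff_add_eq, ← driftTerm_add_right hα hαn hx hy hxy hb hw hs hV', sub_add_cancel]

theorem integral_driftTerm_smul_fracLaplacian {α x y : ℝ} (hα : 1 < α) (hαn : α - 1 < n)
    (hx : 0 < x) (hy : 0 < y) (hxy : x + y < 1) (hb : (α - 1) / n < x + y) {w : ScalarField n}
    {V : VectorField n} (hw : wNorm x w < ∞) (hV : wNorm y V < ∞) (φ : 𝓢(Rn n, ℂ)) :
    Integrable (fun z => fderiv ℝ (φ : Rn n → ℂ) z (w z • V z)) ∧
      ∫ z, driftTerm α w V z • fracLaplacian α φ z =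
        ∫ z, fderiv ℝ (φ : Rn n → ℂ) z (w z • V z) := by
  have h := integral_invDiv_smul_fracLaplacian hα hαn hb hxy.le (measurable_field_smul w V)
    (mNorm_field_smul_lt_top hx hy hxy hw hV) φ
  refine ⟨h.1, h.2 ▸ integral_congr_ae ?_⟩
  filter_upwards [coeFn_driftTerm α w V] with z hz
  rw [hz]

end DriftTerm

/-! ### The drift operator in the Marcinkiewicz norm -/

section DriftOperator

variable {n : ℕ} {A : ScalarField n → VectorField n} {C : ℝ → ℝ≥0∞ → ℝ≥0}

/-- The factor 1/(1-x) enters only once, since the other comparison with the Lorentz quasi-norm has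
constant 1. -/
theorem IsDriftOperator.wNorm_sub_le (hA : IsDriftOperator A C) {x : ℝ} (hx : 0 < x) (hx1 : x < 1)
    {u v : ScalarField n} (hu : wNorm x u < ∞) (hv : wNorm x v < ∞) :
    wNorm x (A u - A v) ≤
      ENNReal.ofReal (1 / (1 - x)) * (C (1 / x) ∞ * wNorm x (u - v)) := by
  have h1 : 1 < 1 / x := by rwa [lt_div_iff₀ hx, one_mul]
  have h0 : 0 < 1 / x := by positivity
  have hxx : 1 / (1 / x) = x := one_div_one_div x
  have h2 := wNorm_le_lorentzNorm h1 (A u - A v)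
  have h3 := hA.lipschitz (1 / x) ∞ h1 le_top u v (memLorentz_of_wNorm h0 (by rwa [hxx]))
    (memLorentz_of_wNorm h0 (by rwa [hxx]))
  have h4 := lorentzNorm_le_wNorm h0 (u - v)
  rw [hxx] at h2 h4
  exact h2.trans (mul_le_mul_right (h3.trans (mul_le_mul_right h4 _)) _)

theorem IsDriftOperator.wNorm_le (hA : IsDriftOperator A C) {x : ℝ} (hx : 0 < x) (hx1 : x < 1)
    {u : ScalarField n} (hu : wNorm x u < ∞) :
    wNorm x (A u) ≤ ENNReal.ofReal (1 / (1 - x)) * (C (1 / x) ∞ * wNorm x u) := by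
  have h := hA.wNorm_sub_le hx hx1 hu (v := 0) (by simp [wNorm_zero])
  rwa [hA.map_zero, sub_zero, sub_zero] at h

theorem IsDriftOperator.wNorm_lt_top (hA : IsDriftOperator A C) {x : ℝ} (hx : 0 < x) (hx1 : x < 1)
    {u : ScalarField n} (hu : wNorm x u < ∞) : wNorm x (A u) < ∞ :=
  (hA.wNorm_le hx hx1 hu).trans_lt (ENNReal.mul_lt_top ENNReal.ofReal_lt_top
    (ENNReal.mul_lt_top ENNReal.coe_lt_top hu))

end DriftOperator

/-! ### Mild and weak solutions in the critical space -/

section MildSolution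

variable {n : ℕ} {α : ℝ} {A : ScalarField n → VectorField n} {f : 𝓢'(Rn n, ℂ)}
  {g : ScalarField n}

theorem coeFn_add_smul (u v : ScalarField n) (ψ : Rn n → ℂ) :
    (fun x => (u + v : ScalarField n) x • ψ x) =ᵐ[volume] fun x => u x • ψ x + v x • ψ x := by
  filter_upwards [AEEqFun.coeFn_add u v] with x hx
  rw [hx, Pi.add_apply, add_smul]

theorem coeFn_sub_smul (u v : ScalarField n) (ψ : Rn n → ℂ) :
    (fun x => (u - v : ScalarField n) x • ψ x) =ᵐ[volume] fun x => u x • ψ x - v x • ψ x := by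
  filter_upwards [AEEqFun.coeFn_sub u v] with x hx
  rw [hx, Pi.sub_apply, sub_smul]

theorem integrable_field_smul_fracLaplacian (hα : 0 < α) {x : ℝ} (hx : 0 < x) (hx1 : x ≤ 1)
    {u : ScalarField n} (hu : wNorm x u < ∞) (φ : 𝓢(Rn n, ℂ)) :
    Integrable (fun y => u y • fracLaplacian α φ y) :=
  integrable_smul_fracLaplacian hα hx hx1 u.stronglyMeasurable hu φ

/-- A mild solution is a weak solution. -/
theorem isWeakSolution_of_mild (hα : 1 < α) (hαn : α - 1 < n) {x : ℝ} (hx : (α - 1) / n ≤ x)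
    (hx2 : 2 * x < 1) {u : ScalarField n} (hu : wNorm x u < ∞) (hAu : wNorm x (A u) < ∞)
    (hdiv : IsDivFree (A u)) (hf : IsInvFracLaplacian α f g)
    (h : u = g + driftTerm α u (A u)) : IsWeakSolution α A f u := by
  have hb : 0 < (α - 1) / n := div_pos (by linarith) (by linarith)
  have hx0 : 0 < x := by linarith
  have hD := integral_driftTerm_smul_fracLaplacian (w := u) (V := A u) hα hαn hx0 hx0
    (by linarith) (by linarith) hu hAu
  have hui := integrable_field_smul_fracLaplacian (by linarith) hx0 (by linarith) hu (α := α)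
  refine ⟨hui, fun φ => (hD φ).1, fun φ => ?_, hdiv⟩
  have hi : Integrable (fun y => driftTerm α u (A u) y • fracLaplacian α φ y) := by
    have e : driftTerm α u (A u) = u - g := by rw [eq_sub_iff_add_eq, add_comm]; exact h.symm
    rw [e]
    exact ((hui φ).sub (hf φ).1).congr (coeFn_sub_smul u g _).symm
  rw [← (hD φ).2, (hf φ).2, sub_eq_iff_eq_add, ← integral_add (hf φ).1 hi,
    ← integral_congr_ae (coeFn_add_smul g _ _), ← h]

/-- A weak solution is a mild solution. -/
theorem mild_of_isWeakSolution (hα : 1 < α) (hαn : α - 1 < n) {x : ℝ} (hx : (α - 1) / n = x)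
    (hx2 : 2 * x < 1) {u : ScalarField n} (hu : wNorm x u < ∞) (hAu : wNorm x (A u) < ∞)
    (hg : wNorm x g < ∞) (hf : IsInvFracLaplacian α f g)
    (h : IsWeakSolution α A f u) : g + driftTerm α u (A u) = u := by
  have hn : (0 : ℝ) < n := by linarith
  have hb : 0 < (α - 1) / n := div_pos (by linarith) hn
  have hx0 : 0 < x := by linarith
  have hD := integral_driftTerm_smul_fracLaplacian (w := u) (V := A u) hα hαn hx0 hx0
    (by linarith) (by linarith) hu hAu
  obtain ⟨K, hK⟩ := exists_wNorm_driftTerm_le hα hαn hx0 hx0 (by linarith) (by linarith)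
  have hdt : wNorm x (driftTerm α u (A u)) < ∞ := by
    have h1 := hK u (A u)
    rw [hx, add_sub_cancel_right] at h1
    exact h1.trans_lt (ENNReal.mul_lt_top ENNReal.coe_lt_top (ENNReal.mul_lt_top hu hAu))
  have hI : ∀ {w : ScalarField n}, wNorm x w < ∞ → ∀ φ : 𝓢(Rn n, ℂ),
      Integrable (fun y => w y • fracLaplacian α φ y) :=
    fun hw => integrable_field_smul_fracLaplacian (by linarith) hx0 (by linarith) hw
  have hsum : wNorm x (g + driftTerm α u (A u)) < ∞ :=
    (wNorm_add_le _ _ _).trans_lt (ENNReal.add_lt_top.2 ⟨hg, hdt⟩)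
  have hdiff : wNorm x (g + driftTerm α u (A u) - u) < ∞ :=
    (wNorm_sub_le _ _ _).trans_lt (ENNReal.add_lt_top.2 ⟨hsum, hu⟩)
  rw [← sub_eq_zero]
  -- Both sides lie in the critical weak space and have the same image under (-Δ)^{α/2}, so the
  -- Liouville theorem identifies them.
  refine AEEqFun.ext ((ae_eq_zero_of_fracLaplacian (α := α) (by rintro rfl; simp at hn) (by linarith) hx0
    (by linarith) (g + driftTerm α u (A u) - u).stronglyMeasurable hdiff fun φ => ?_).trans
      AEEqFun.coeFn_zero.symm)
  rw [integral_congr_ae (coeFn_sub_smul _ _ _), integral_sub (hI hsum φ) (hI hu φ),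
    integral_congr_ae (coeFn_add_smul _ _ _), integral_add (hI hg φ) (hI hdt φ), (hD φ).2,
    ← (hf φ).2, ← h.equation φ]
  ring

/-- The Duhamel nonlinearity is Lipschitz on bounded sets. -/
theorem wNorm_driftTerm_sub_le (hα : 1 < α) (hαn : α - 1 < n) {x : ℝ} (hx : (α - 1) / n = x)
    (hx2 : 2 * x < 1) {K L : ℝ≥0}
    (hK : ∀ (w : ScalarField n) (V : VectorField n),
      wNorm x (driftTerm α w V) ≤ K * (wNorm x w * wNorm x V))
    (hL : ∀ u v : ScalarField n, wNorm x u < ∞ → wNorm x v < ∞ →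
      wNorm x (A u - A v) ≤ L * wNorm x (u - v)) (hA0 : A 0 = 0)
    {M : ℝ≥0∞} (hM : M ≠ ∞) {u v : ScalarField n} (hu : wNorm x u ≤ M) (hv : wNorm x v ≤ M) :
    wNorm x (driftTerm α u (A u) - driftTerm α v (A v)) ≤
      K * L * (2 * M) * wNorm x (u - v) := by
  have hn : (0 : ℝ) < n := by linarith
  have hb : 0 < (α - 1) / n := div_pos (by linarith) hn
  have hx0 : 0 < x := by linarith
  have hu' := hu.trans_lt hM.lt_top
  have hv' := hv.trans_lt hM.lt_top
  have hA1 : ∀ w : ScalarField n, wNorm x w < ∞ → wNorm x (A w) ≤ L * wNorm x w := by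
    intro w hw
    have := hL w 0 hw (by simp [wNorm_zero])
    rwa [hA0, sub_zero, sub_zero] at this
  have hAt : ∀ w : ScalarField n, wNorm x w < ∞ → wNorm x (A w) < ∞ := fun w hw =>
    (hA1 w hw).trans_lt (ENNReal.mul_lt_top ENNReal.coe_lt_top hw)
  have e : driftTerm α u (A u) - driftTerm α v (A v) =
      driftTerm α (u - v) (A u) + driftTerm α v (A u - A v) := by
    rw [driftTerm_sub_left hα hαn hx0 hx0 (by linarith) (by linarith) hu' hv' (hAt u hu'),
      driftTerm_sub_right hα hαn hx0 hx0 (by linarith) (by linarith) hv' (hAt u hu') (hAt v hv')]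
    abel
  rw [e]
  calc _ ≤ K * (wNorm x (u - v) * wNorm x (A u)) + K * (wNorm x v * wNorm x (A u - A v)) :=
        (wNorm_add_le _ _ _).trans (add_le_add (hK _ _) (hK _ _))
    _ ≤ K * (wNorm x (u - v) * (L * M)) + K * (M * (L * wNorm x (u - v))) := by
        gcongr
        · exact (hA1 u hu').trans (mul_le_mul_right hu _)
        · exact hL u v hu' hv'
    _ = _ := by ring

/-- Existence and uniqueness of small mild solutions. -/
theorem exists_mild_solution (hα : 1 < α) (hαn : α - 1 < n) {x : ℝ} (hx : (α - 1) / n = x)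
    (hx2 : 2 * x < 1) {K L : ℝ≥0}
    (hK : ∀ (w : ScalarField n) (V : VectorField n),
      wNorm x (driftTerm α w V) ≤ K * (wNorm x w * wNorm x V))
    (hL : ∀ u v : ScalarField n, wNorm x u < ∞ → wNorm x v < ∞ →
      wNorm x (A u - A v) ≤ L * wNorm x (u - v)) (hA0 : A 0 = 0)
    {N : ℝ≥0∞} (hN : N ≠ ∞) (hsmall : K * L * (2 * (2 * N)) ≤ 2⁻¹) (hg : wNorm x g ≤ N) :
    ∃ u, wNorm x u ≤ 2 * N ∧ g + driftTerm α u (A u) = u ∧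
      ∀ v, wNorm x v ≤ 2 * N → g + driftTerm α v (A v) = v → v = u := by
  have hM : 2 * N ≠ ∞ := ENNReal.mul_ne_top (by simp) hN
  have hc : ∀ u v : ScalarField n, wNorm x u ≤ 2 * N → wNorm x v ≤ 2 * N →
      wNorm x (driftTerm α u (A u) - driftTerm α v (A v)) ≤ 2⁻¹ * wNorm x (u - v) :=
    fun u v hu hv => (wNorm_driftTerm_sub_le hα hαn hx hx2 hK hL hA0 hM hu hv).trans
      (mul_le_mul_left hsmall _)
  have hd0 : driftTerm α (0 : ScalarField n) (A 0) = 0 := by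
    refine eq_zero_of_wNorm (x := x) (le_antisymm ((hK _ _).trans ?_) zero_le)
    simp [wNorm_zero]
  -- Radius 2N: the datum contributes N, and comparison with the value 0 at u = 0 bounds the Duhamel
  -- term by half the radius.
  obtain ⟨u, hu, hfix⟩ := exists_fixedPoint_wNorm (x := x) (M := 2 * N)
    (Φ := fun u => g + driftTerm α u (A u)) hM
    (fun u hu => by
      refine (wNorm_add_le _ _ _).trans ?_
      have h1 := hc u 0 hu (by simp [wNorm_zero])
      rw [hd0, sub_zero, sub_zero] at h1
      calc _ ≤ N + 2⁻¹ * (2 * N) := add_le_add hg (h1.trans (mul_le_mul_right hu _))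
        _ = 2 * N := by
            rw [← mul_assoc, ENNReal.inv_mul_cancel (by simp) (by simp), one_mul, two_mul])
    (fun u v hu hv => by simpa only [add_sub_add_left_eq_sub] using hc u v hu hv)
  refine ⟨u, hu, hfix, fun v hv hv' => ?_⟩
  rw [← sub_eq_zero]
  refine eq_zero_of_wNorm_le_half (x := x) ?_ ?_
  · exact ((wNorm_sub_le _ _ _).trans_lt (ENNReal.add_lt_top.2
      ⟨hv.trans_lt hM.lt_top, hu.trans_lt hM.lt_top⟩)).ne
  · conv_lhs => rw [← hfix, ← hv', add_sub_add_left_eq_sub]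
    simpa only [hfix, hv'] using hc v u hv hu

end MildSolution

/-! ### Layer cake estimates and truncation -/

section LayerCake

variable {X : Type*} [MeasurableSpace X] {μ : Measure X} {F : Type*} [NormedAddCommGroup F]

/-- Hölder's inequality on each test set. -/
theorem mNorm_le_lintegral_rpow {f : X → F} (hf : StronglyMeasurable f) {q : ℝ} (hq : 0 < q)
    (hq1 : q ≤ 1) : mNorm μ q (fun y => ‖f y‖ₑ) ≤ (∫⁻ y, ‖f y‖ₑ ^ (1 / q) ∂μ) ^ q := by
  refine mNorm_le fun E hE _ _ => ?_
  have hr : 1 ≤ 1 / q := by rwa [le_div_iff₀ hq, one_mul]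
  have hr0 : 0 < 1 / q := by positivity
  have h := eLpNorm_le_eLpNorm_mul_rpow_measure_univ (μ := μ.restrict E) (p := 1)
    (q := ENNReal.ofReal (1 / q)) (by simpa using hr) hf.aestronglyMeasurable.restrict
  rw [eLpNorm_one_eq_lintegral_enorm, Measure.restrict_apply_univ, ENNReal.toReal_ofReal hr0.le,
    ENNReal.toReal_one, one_div_one, one_div_one_div, eLpNorm_eq_lintegral_rpow_enorm_toReal
      (by simpa using hq) ENNReal.ofReal_ne_top, ENNReal.toReal_ofReal hr0.le, one_div_one_div] at h
  refine h.trans (mul_le_mul_left (ENNReal.rpow_le_rpow ?_ hq.le) _)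
  exact setLIntegral_le_lintegral _ _

theorem lintegral_enorm_rpow_eq_lintegral_measure {u : X → F} (hu : AEStronglyMeasurable u μ)
    {p : ℝ} (hp : 0 < p) : ∫⁻ y, ‖u y‖ₑ ^ p ∂μ = ENNReal.ofReal p *
      ∫⁻ t in Set.Ioi (0 : ℝ), μ {y | ENNReal.ofReal t < ‖u y‖ₑ} * ENNReal.ofReal (t ^ (p - 1)) := by
  have h := lintegral_rpow_eq_lintegral_meas_lt_mul μ (f := fun y => ‖u y‖)
    (Filter.Eventually.of_forall fun y => norm_nonneg _) hu.norm.aemeasurable hp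
  have e : ∀ y, ENNReal.ofReal (‖u y‖ ^ p) = ‖u y‖ₑ ^ p := fun y => by
    rw [← ENNReal.ofReal_rpow_of_nonneg (norm_nonneg _) hp.le, ofReal_norm]
  simp_rw [e] at h
  rw [h]
  congr 1
  refine setLIntegral_congr_fun measurableSet_Ioi fun t ht => ?_
  have e2 : {y | ENNReal.ofReal t < ‖u y‖ₑ} = {y | t < ‖u y‖} := by
    ext y
    simp only [Set.mem_ofPred_eq]
    rw [← ofReal_norm, ENNReal.ofReal_lt_ofReal_iff_of_nonneg (le_of_lt ht)]
  simp only [e2]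

theorem memLp_of_lintegral_measure_lt_top {u : X → F} (hu : AEStronglyMeasurable u μ) {p : ℝ}
    (hp : 0 < p) (h : ∫⁻ t in Set.Ioi (0 : ℝ), μ {y | ENNReal.ofReal t < ‖u y‖ₑ} *
      ENNReal.ofReal (t ^ (p - 1)) < ∞) : MemLp u (ENNReal.ofReal p) μ := by
  refine ⟨hu, ?_⟩
  rw [eLpNorm_lt_top_iff_lintegral_rpow_enorm_lt_top (by simpa using hp) ENNReal.ofReal_ne_top,
    ENNReal.toReal_ofReal hp.le, lintegral_enorm_rpow_eq_lintegral_measure hu hp]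
  exact ENNReal.mul_lt_top ENNReal.ofReal_lt_top h

/-- A function in two weak spaces belongs to the Lebesgue spaces strictly between them. -/
theorem memLp_of_mNorm_lt_top [SigmaFinite μ] {u : X → F} (hu : StronglyMeasurable u) {x z y : ℝ}
    (hx : 0 < x) (hxz : x < z) (hzy : z < y) (h1 : mNorm μ x (fun a => ‖u a‖ₑ) < ∞)
    (h2 : mNorm μ y (fun a => ‖u a‖ₑ) < ∞) : MemLp u (ENNReal.ofReal (1 / z)) μ := by
  have hz : 0 < z := hx.trans hxz
  have hy : 0 < y := hz.trans hzy
  refine memLp_of_lintegral_measure_lt_top hu.aestronglyMeasurable (by positivity) ?_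
  have hw : ∀ {w : ℝ}, 0 < w → ∀ t : ℝ, 0 < t →
      μ {a | ENNReal.ofReal t < ‖u a‖ₑ} * ENNReal.ofReal (t ^ (1 / z - 1)) ≤
        mNorm μ w (fun a => ‖u a‖ₑ) ^ (1 / w) * ENNReal.ofReal (t ^ (-(1 / w - 1 / z + 1))) := by
    intro w hw t ht
    refine (mul_le_mul_left (measure_lt_le_mNorm hw hu.enorm (by simpa using ht)
      ENNReal.ofReal_ne_top) _).trans (le_of_eq ?_)
    rw [div_ofReal_rpow ht _ (by positivity), mul_assoc, ← ENNReal.ofReal_mul (by positivity),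
      ← Real.rpow_add ht]
    congr 3
    ring
  -- The level-set bound from `y` is integrable at 0 because 1/y < 1/z, the one from `x` at infinity
  -- because 1/z < 1/x.
  rw [← Set.Ioc_union_Ioi_eq_Ioi zero_le_one, lintegral_union measurableSet_Ioi
    (Set.Ioc_disjoint_Ioi le_rfl)]
  refine ENNReal.add_lt_top.2 ⟨?_, ?_⟩
  · refine (setLIntegral_mono' measurableSet_Ioc fun t ht => hw hy t ht.1).trans_lt ?_
    have : 1 / y < 1 / z := one_div_lt_one_div_of_lt hz hzy
    rw [lintegral_const_mul' _ _ (ENNReal.rpow_ne_top_of_nonneg (by positivity) h2.ne),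
      lintegral_Ioc_rpow (by linarith) zero_le_one]
    exact ENNReal.mul_lt_top (ENNReal.rpow_lt_top_of_nonneg (by positivity) h2.ne)
      ENNReal.ofReal_lt_top
  · refine (setLIntegral_mono' measurableSet_Ioi fun t ht =>
      hw hx t (zero_lt_one.trans ht)).trans_lt ?_
    have : 1 / z < 1 / x := one_div_lt_one_div_of_lt hx hxz
    rw [lintegral_const_mul' _ _ (ENNReal.rpow_ne_top_of_nonneg (by positivity) h1.ne),
      lintegral_Ioi_rpow (by linarith) zero_lt_one]
    exact ENNReal.mul_lt_top (ENNReal.rpow_lt_top_of_nonneg (by positivity) h1.ne)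
      ENNReal.ofReal_lt_top

theorem lintegral_mul_setLIntegral_swap [SFinite μ] {w : ℝ → ℝ≥0∞} {f : X → ℝ≥0∞}
    (hw : Measurable w) (hf : Measurable f) {S : Set (ℝ × X)} (hS : MeasurableSet S) :
    ∫⁻ t in Set.Ioi (0 : ℝ), w t * ∫⁻ y in {y | (t, y) ∈ S}, f y ∂μ =
      ∫⁻ y, (f y * ∫⁻ t in {t | 0 < t ∧ (t, y) ∈ S}, w t) ∂μ := by
  have h1 : ∀ t : ℝ, w t * ∫⁻ y in {y | (t, y) ∈ S}, f y ∂μ =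
      ∫⁻ y, S.indicator (fun p => w p.1 * f p.2) (t, y) ∂μ := by
    intro t
    have hm : MeasurableSet {y | (t, y) ∈ S} := hS.preimage measurable_prodMk_left
    rw [← lintegral_const_mul _ hf, ← lintegral_indicator hm]
    rfl
  have h2 : ∀ y : X, f y * ∫⁻ t in {t | 0 < t ∧ (t, y) ∈ S}, w t =
      ∫⁻ t in Set.Ioi (0 : ℝ), S.indicator (fun p => w p.1 * f p.2) (t, y) := by
    intro y
    have hm : MeasurableSet {t | (t, y) ∈ S} := hS.preimage measurable_prodMk_right
    have e : {t : ℝ | 0 < t ∧ (t, y) ∈ S} = {t | (t, y) ∈ S} ∩ Set.Ioi 0 := by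
      ext t; simp [and_comm]
    rw [e, ← Measure.restrict_restrict hm, ← lintegral_const_mul _ hw, ← lintegral_indicator hm]
    refine lintegral_congr fun t => ?_
    by_cases ht : (t, y) ∈ S <;> simp [ht, mul_comm]
  simp_rw [h1, h2]
  refine lintegral_lintegral_swap ?_
  exact (((hw.comp measurable_fst).mul (hf.comp measurable_snd)).indicator hS).aemeasurable

/-- By Tonelli, the weight is integrated over t > h(y) first and gives h(y)^{p-r}/(r-p), convergent
at infinity since p < r. The companion for the part above t converges at 0 since r < p. -/
theorem lintegral_truncation_below_le [SFinite μ] {h : X → ℝ} (hh : Measurable h)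
    (h0 : ∀ y, 0 ≤ h y) {p r : ℝ} (hp : 0 < p) (hpr : p < r) :
    ∫⁻ t in Set.Ioi (0 : ℝ), ENNReal.ofReal (t ^ (-(r - p + 1))) *
      ∫⁻ y in {y | h y < t}, ENNReal.ofReal (h y ^ r) ∂μ ≤
      ENNReal.ofReal (1 / (r - p)) * ∫⁻ y, ENNReal.ofReal (h y ^ p) ∂μ := by
  have hS : MeasurableSet {q : ℝ × X | h q.2 < q.1} :=
    measurableSet_lt (hh.comp measurable_snd) measurable_fst
  have hsw := lintegral_mul_setLIntegral_swap (μ := μ)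
    (w := fun t => ENNReal.ofReal (t ^ (-(r - p + 1)))) (f := fun y => ENNReal.ofReal (h y ^ r))
    (by fun_prop) (by fun_prop) hS
  simp only [Set.mem_ofPred_eq] at hsw
  rw [hsw, ← lintegral_const_mul _ (by fun_prop)]
  refine lintegral_mono fun y => ?_
  rcases (h0 y).eq_or_lt with hy | hy
  · simp [← hy, Real.zero_rpow (show r ≠ 0 by linarith)]
  have e : {t : ℝ | 0 < t ∧ h y < t} = Set.Ioi (h y) := by
    ext t
    simp only [Set.mem_ofPred_eq, Set.mem_Ioi, and_iff_right_iff_imp]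
    exact hy.trans
  simp only [e]
  rw [lintegral_Ioi_rpow (by linarith) hy, ← ENNReal.ofReal_mul (by positivity),
    ← ENNReal.ofReal_mul (by rw [one_div]; exact inv_nonneg.2 (by linarith))]
  refine ENNReal.ofReal_le_ofReal (le_of_eq ?_)
  have e2 : h y ^ p = h y ^ r * h y ^ (1 - (r - p + 1)) := by
    rw [← Real.rpow_add hy]; congr 1; ring
  rw [e2, show r - p + 1 - 1 = r - p by ring]
  ring

theorem lintegral_truncation_above_le [SFinite μ] {h : X → ℝ} (hh : Measurable h)
    (h0 : ∀ y, 0 ≤ h y) {p r : ℝ} (hr : 0 < r) (hpr : r < p) :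
    ∫⁻ t in Set.Ioi (0 : ℝ), ENNReal.ofReal (t ^ (-(r - p + 1))) *
      ∫⁻ y in {y | t ≤ h y}, ENNReal.ofReal (h y ^ r) ∂μ ≤
      ENNReal.ofReal (1 / (p - r)) * ∫⁻ y, ENNReal.ofReal (h y ^ p) ∂μ := by
  have hS : MeasurableSet {q : ℝ × X | q.1 ≤ h q.2} :=
    measurableSet_le measurable_fst (hh.comp measurable_snd)
  have hsw := lintegral_mul_setLIntegral_swap (μ := μ)
    (w := fun t => ENNReal.ofReal (t ^ (-(r - p + 1)))) (f := fun y => ENNReal.ofReal (h y ^ r))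
    (by fun_prop) (by fun_prop) hS
  simp only [Set.mem_ofPred_eq] at hsw
  rw [hsw, ← lintegral_const_mul _ (by fun_prop)]
  refine lintegral_mono fun y => ?_
  rcases (h0 y).eq_or_lt with hy | hy
  · simp [← hy, Real.zero_rpow hr.ne']
  have e : {t : ℝ | 0 < t ∧ t ≤ h y} = Set.Ioc 0 (h y) := rfl
  simp only [e]
  rw [lintegral_Ioc_rpow (by linarith) hy.le, ← ENNReal.ofReal_mul (by positivity),
    ← ENNReal.ofReal_mul (by rw [one_div]; exact inv_nonneg.2 (by linarith))]
  refine ENNReal.ofReal_le_ofReal (le_of_eq ?_)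
  have e2 : h y ^ p = h y ^ r * h y ^ (1 - (r - p + 1)) := by
    rw [← Real.rpow_add hy]; congr 1; ring
  rw [e2, show 1 - (r - p + 1) = p - r by ring]
  ring

/-- The integration step in the proof of the Marcinkiewicz interpolation theorem. -/
theorem memLp_of_truncation [SFinite μ] {u g : X → F} (hu : AEStronglyMeasurable u μ)
    (hg : StronglyMeasurable g) {p r₀ r₁ K₀ K₁ : ℝ} (hr₁ : 0 < r₁) (h1 : r₁ < p) (h0 : p < r₀)
    (hgp : MemLp g (ENNReal.ofReal p) μ)
    (h : ∀ t : ℝ, 0 < t → μ {y | ENNReal.ofReal t < ‖u y‖ₑ} ≤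
      ENNReal.ofReal (K₀ * t ^ (-r₀)) * ∫⁻ y in {y | ‖g y‖ < t}, ENNReal.ofReal (‖g y‖ ^ r₀) ∂μ +
      ENNReal.ofReal (K₁ * t ^ (-r₁)) * ∫⁻ y in {y | t ≤ ‖g y‖}, ENNReal.ofReal (‖g y‖ ^ r₁) ∂μ) :
    MemLp u (ENNReal.ofReal p) μ := by
  have hp : 0 < p := hr₁.trans h1
  refine memLp_of_lintegral_measure_lt_top hu hp ?_
  have hgfin : ∫⁻ y, ENNReal.ofReal (‖g y‖ ^ p) ∂μ < ∞ := by
    have h2 := hgp.2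
    rw [eLpNorm_lt_top_iff_lintegral_rpow_enorm_lt_top (by simpa using hp) ENNReal.ofReal_ne_top,
      ENNReal.toReal_ofReal hp.le] at h2
    refine lt_of_eq_of_lt (lintegral_congr fun y => ?_) h2
    rw [← ENNReal.ofReal_rpow_of_nonneg (norm_nonneg _) hp.le, ofReal_norm]
  have hw : ∀ (K r t : ℝ), 0 < t → ∀ I : ℝ≥0∞,
      ENNReal.ofReal (K * t ^ (-r)) * I * ENNReal.ofReal (t ^ (p - 1)) =
        ENNReal.ofReal K * (ENNReal.ofReal (t ^ (-(r - p + 1))) * I) := by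
    intro K r t ht I
    rw [show -(r - p + 1) = -r + (p - 1) by ring, Real.rpow_add ht,
      ENNReal.ofReal_mul' (by positivity), ENNReal.ofReal_mul (by positivity)]
    ring
  have hlow := lintegral_truncation_below_le (μ := μ) hg.norm.measurable
    (fun y => norm_nonneg (g y)) hp h0
  have hhigh := lintegral_truncation_above_le (μ := μ) hg.norm.measurable
    (fun y => norm_nonneg (g y)) hr₁ h1
  refine (setLIntegral_mono' measurableSet_Ioi fun t ht =>
    (mul_le_mul_left (h t ht) _).trans_eq
      (by rw [add_mul, hw K₀ r₀ t ht, hw K₁ r₁ t ht])).trans_lt ?_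
  have hmono : Monotone fun t : ℝ => ∫⁻ y in {y | ‖g y‖ < t}, ENNReal.ofReal (‖g y‖ ^ r₀) ∂μ :=
    fun s t hst => lintegral_mono_set fun y hy => lt_of_lt_of_le hy hst
  have hpow : Measurable fun t : ℝ => ENNReal.ofReal (t ^ (-(r₀ - p + 1))) := by fun_prop
  have hmeas : Measurable fun t : ℝ => ENNReal.ofReal K₀ * (ENNReal.ofReal (t ^ (-(r₀ - p + 1))) *
      ∫⁻ y in {y | ‖g y‖ < t}, ENNReal.ofReal (‖g y‖ ^ r₀) ∂μ) :=
    (hpow.mul hmono.measurable).const_mul _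
  rw [lintegral_add_left hmeas,
    lintegral_const_mul' _ _ ENNReal.ofReal_ne_top, lintegral_const_mul' _ _ ENNReal.ofReal_ne_top]
  exact ENNReal.add_lt_top.2
    ⟨ENNReal.mul_lt_top ENNReal.ofReal_lt_top
      (hlow.trans_lt (ENNReal.mul_lt_top ENNReal.ofReal_lt_top hgfin)),
    ENNReal.mul_lt_top ENNReal.ofReal_lt_top
      (hhigh.trans_lt (ENNReal.mul_lt_top ENNReal.ofReal_lt_top hgfin))⟩

end LayerCake

/-! ### Linear equations u = g + Tu and interpolation -/

section LinearEquation

variable {n : ℕ} {T : ScalarField n → ScalarField n} {b q : ℝ}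

/-- A priori bound for `u = g + T u` in a norm in which `T` is a contraction. -/
theorem wNorm_le_of_eq_add (hsub : ∀ w w', wNorm b w < ∞ → wNorm b w' < ∞ →
      T (w - w') = T w - T w') (hTb : ∀ w, wNorm b (T w) ≤ 2⁻¹ * wNorm b w)
    (hTq : ∀ w, wNorm q (T w) ≤ 2⁻¹ * wNorm q w) {u g : ScalarField n} (hu : wNorm b u < ∞)
    (h : g + T u = u) : wNorm q u ≤ 2 * wNorm q g := by
  -- The q-norm of `u` is not known to be finite, so `T u` cannot be absorbed directly. The Picard
  -- iterates stay below 2‖g‖ in the q-norm and tend to `u` in the b-norm; the bound passes to the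
  -- limit on each test set.
  set s : ℕ → ScalarField n := fun k => (fun w => g + T w)^[k] 0 with hs
  have hsucc : ∀ k, s (k + 1) = g + T (s k) := fun k => Function.iterate_succ_apply' _ k 0
  have hs0 : s 0 = 0 := rfl
  have hd : ∀ k, wNorm b (u - s k) ≤ 2⁻¹ ^ k * wNorm b u := by
    intro k
    induction k with
    | zero => simp [hs0]
    | succ k ih =>
      have hfin : wNorm b (s k) < ∞ := by
        refine (wNorm_le_add_sub b (s k) u).trans_lt (ENNReal.add_lt_top.2 ⟨hu, ?_⟩)
        rw [wNorm_sub_comm]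
        exact ih.trans_lt (ENNReal.mul_lt_top (ENNReal.pow_lt_top (by simp)) hu)
      have e : u - s (k + 1) = T (u - s k) := by
        rw [hsub _ _ hu hfin, hsucc]
        conv_lhs => rw [← h]
        abel
      rw [e, pow_succ', mul_assoc]
      exact (hTb _).trans (mul_le_mul_right ih _)
  have hq : ∀ k, wNorm q (s k) ≤ 2 * wNorm q g := by
    intro k
    induction k with
    | zero => simp [hs0, wNorm_zero]
    | succ k ih =>
      rw [hsucc]
      calc _ ≤ wNorm q g + 2⁻¹ * (2 * wNorm q g) :=
            (wNorm_add_le _ _ _).trans (add_le_add le_rfl ((hTq _).trans (mul_le_mul_right ih _)))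
        _ = 2 * wNorm q g := by
            rw [← mul_assoc, ENNReal.inv_mul_cancel (by simp) (by simp), one_mul, two_mul]
  refine mNorm_le fun E hE h0 hE' => ?_
  have hE1 : volume E ^ (1 - b) ≠ ∞ := by simp [ENNReal.rpow_eq_top_iff, h0, hE']
  have hlim : Filter.Tendsto (fun k : ℕ => 2 * wNorm q g * volume E ^ (1 - q) +
      2⁻¹ ^ k * (wNorm b u * volume E ^ (1 - b))) Filter.atTop
      (nhds (2 * wNorm q g * volume E ^ (1 - q) + 0)) :=
    (tendsto_half_pow_mul (ENNReal.mul_ne_top hu.ne hE1)).const_add _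
  rw [add_zero] at hlim
  refine ge_of_tendsto' hlim fun k => ?_
  calc ∫⁻ y in E, ‖u y‖ₑ ≤ ∫⁻ y in E, (‖s k y‖ₑ + ‖(u - s k : ScalarField n) y‖ₑ) := by
        refine lintegral_mono_ae (ae_restrict_of_ae ?_)
        filter_upwards [AEEqFun.coeFn_sub u (s k)] with y hy
        rw [hy, Pi.sub_apply]
        calc ‖u y‖ₑ = ‖s k y + (u y - s k y)‖ₑ := by rw [add_sub_cancel]
          _ ≤ _ := enorm_add_le _ _
    _ = (∫⁻ y in E, ‖s k y‖ₑ) + ∫⁻ y in E, ‖(u - s k : ScalarField n) y‖ₑ :=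
        lintegral_add_left (s k).stronglyMeasurable.enorm _
    _ ≤ 2 * wNorm q g * volume E ^ (1 - q) + 2⁻¹ ^ k * wNorm b u * volume E ^ (1 - b) :=
        add_le_add
          ((setLIntegral_le_mNorm q _ hE hE').trans (mul_le_mul_left (hq k) _))
          ((setLIntegral_le_mNorm b _ hE hE').trans (mul_le_mul_left (hd k) _))
    _ = _ := by rw [mul_assoc (2⁻¹ ^ k)]

/-- The constant 4 is the 2 of the a priori bound times the 2 from the level t/2. -/
theorem measure_lt_le_of_wNorm {w v : ScalarField n} {S : Set (Rn n)} (hS : MeasurableSet S)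
    {g : ScalarField n} (hv : v =ᵐ[volume] S.indicator g) (hq : 0 < q) (hq1 : q ≤ 1)
    (hw : wNorm q w ≤ 2 * wNorm q v) {t : ℝ} (ht : 0 < t) :
    volume {y | ENNReal.ofReal (t / 2) < ‖w y‖ₑ} ≤
      ENNReal.ofReal (4 ^ (1 / q) * t ^ (-(1 / q))) *
        ∫⁻ y in S, ENNReal.ofReal (‖g y‖ ^ (1 / q)) := by
  have hr : 0 < 1 / q := by positivity
  have h1 : wNorm q v ≤ (∫⁻ y in S, ENNReal.ofReal (‖g y‖ ^ (1 / q))) ^ q := by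
    refine (mNorm_le_lintegral_rpow v.stronglyMeasurable hq hq1).trans (le_of_eq ?_)
    congr 1
    rw [← lintegral_indicator hS]
    refine lintegral_congr_ae ?_
    filter_upwards [hv] with y hy
    rw [hy]
    by_cases hyS : y ∈ S
    · simp only [hyS, Set.indicator_of_mem]
      rw [← ENNReal.ofReal_rpow_of_nonneg (norm_nonneg _) hr.le, ofReal_norm]
    · simp only [hyS, Set.indicator_of_notMem, not_false_eq_true, enorm_zero]
      rw [ENNReal.zero_rpow_of_pos hr]
  refine (measure_lt_le_mNorm hq w.stronglyMeasurable.enorm (by simpa using ht)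
    ENNReal.ofReal_ne_top).trans ?_
  calc (wNorm q w / ENNReal.ofReal (t / 2)) ^ (1 / q)
      ≤ (2 * (∫⁻ y in S, ENNReal.ofReal (‖g y‖ ^ (1 / q))) ^ q / ENNReal.ofReal (t / 2)) ^ (1 / q) := by
        gcongr
        exact hw.trans (mul_le_mul_right h1 _)
    _ = (2 / ENNReal.ofReal (t / 2)) ^ (1 / q) *
          ((∫⁻ y in S, ENNReal.ofReal (‖g y‖ ^ (1 / q))) ^ q) ^ (1 / q) := by
        rw [← ENNReal.mul_rpow_of_nonneg _ _ hr.le, ENNReal.mul_div_right_comm]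
    _ = _ := by
        rw [← ENNReal.rpow_mul, mul_one_div_cancel hq.ne', ENNReal.rpow_one]
        congr 1
        have e : (2 : ℝ≥0∞) / ENNReal.ofReal (t / 2) = ENNReal.ofReal (4 * t⁻¹) := by
          rw [← ENNReal.ofReal_ofNat 2, ← ENNReal.ofReal_div_of_pos (by positivity)]
          congr 1
          field_simp
          norm_num
        rw [e, ENNReal.ofReal_rpow_of_nonneg (by positivity) hr.le,
          Real.mul_rpow (by norm_num) (by positivity), Real.inv_rpow ht.le, Real.rpow_neg ht.le]

/-- Lebesgue regularity for `u = g + T u` between two norms in which `T` is a contraction. -/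
theorem memLp_of_eq_add (hsub : ∀ w w', wNorm b w < ∞ → wNorm b w' < ∞ →
      T (w - w') = T w - T w') (hTb : ∀ w, wNorm b (T w) ≤ 2⁻¹ * wNorm b w) {q₀ q₁ z : ℝ}
    (h0 : 0 < q₀) (h0z : q₀ < z) (hz1 : z < q₁) (h1 : q₁ ≤ 1)
    (hT0 : ∀ w, wNorm q₀ (T w) ≤ 2⁻¹ * wNorm q₀ w)
    (hT1 : ∀ w, wNorm q₁ (T w) ≤ 2⁻¹ * wNorm q₁ w) {u g : ScalarField n} (hu : wNorm b u < ∞)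
    (hg : wNorm b g < ∞) (h : g + T u = u) (hgp : MemLp g (ENNReal.ofReal (1 / z)) volume) :
    MemLp u (ENNReal.ofReal (1 / z)) volume := by
  have hz : 0 < z := h0.trans h0z
  have hq1 : 0 < q₁ := hz.trans hz1
  refine memLp_of_truncation (r₀ := 1 / q₀) (r₁ := 1 / q₁) (K₀ := 4 ^ (1 / q₀))
    (K₁ := 4 ^ (1 / q₁)) u.aestronglyMeasurable g.stronglyMeasurable (by positivity)
    (one_div_lt_one_div_of_lt hz hz1) (one_div_lt_one_div_of_lt h0 h0z) hgp fun t ht => ?_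
  have hS : MeasurableSet {y | ‖g y‖ < t} :=
    measurableSet_lt g.stronglyMeasurable.norm.measurable measurable_const
  have hS' : MeasurableSet {y | t ≤ ‖g y‖} :=
    measurableSet_le measurable_const g.stronglyMeasurable.norm.measurable
  -- Real interpolation by cutting the datum at height t. With `w` the solution for the low part,
  -- linearity makes `u - w` a solution for the high part; the two are estimated at q₀ and q₁
  -- respectively.
  set g₀ : ScalarField n := AEEqFun.mk ({y | ‖g y‖ < t}.indicator g)
    (g.stronglyMeasurable.indicator hS).aestronglyMeasurable with hg₀
  have hg₀c : g₀ =ᵐ[volume] {y | ‖g y‖ < t}.indicator g := AEEqFun.coeFn_mk _ _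
  have hg₁c : (g - g₀ : ScalarField n) =ᵐ[volume] {y | t ≤ ‖g y‖}.indicator g := by
    filter_upwards [AEEqFun.coeFn_sub g g₀, hg₀c] with y h1 h2
    rw [h1, Pi.sub_apply, h2]
    by_cases hy : ‖g y‖ < t
    · rw [Set.indicator_of_mem (show y ∈ {y | ‖g y‖ < t} from hy),
        Set.indicator_of_notMem (show y ∉ {y | t ≤ ‖g y‖} from not_le.2 hy), sub_self]
    · rw [Set.indicator_of_notMem (show y ∉ {y | ‖g y‖ < t} from hy),
        Set.indicator_of_mem (show y ∈ {y | t ≤ ‖g y‖} from not_lt.1 hy), sub_zero]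
  have hg₀b : wNorm b g₀ ≤ wNorm b g := by
    refine mNorm_mono_ae ?_
    filter_upwards [hg₀c] with y hy
    rw [hy]
    exact enorm_indicator_le_enorm_self _ _
  obtain ⟨w, hwb, hw⟩ := exists_fixedPoint_wNorm (x := b) (M := 2 * wNorm b g)
    (Φ := fun w => g₀ + T w) (ENNReal.mul_ne_top (by simp) hg.ne)
    (fun w hw => by
      calc _ ≤ wNorm b g + 2⁻¹ * (2 * wNorm b g) := (wNorm_add_le _ _ _).trans
            (add_le_add hg₀b ((hTb _).trans (mul_le_mul_right hw _)))
        _ = 2 * wNorm b g := by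
            rw [← mul_assoc, ENNReal.inv_mul_cancel (by simp) (by simp), one_mul, two_mul])
    (fun v w hv hw => by
      have hM : 2 * wNorm b g < ∞ := ENNReal.mul_lt_top (by simp) hg
      rw [add_sub_add_left_eq_sub, ← hsub _ _ (hv.trans_lt hM) (hw.trans_lt hM)]
      exact hTb _)
  have hwt : wNorm b w < ∞ := hwb.trans_lt (ENNReal.mul_lt_top (by simp) hg)
  have hw' : g - g₀ + T (u - w) = u - w := by
    rw [hsub _ _ hu hwt]
    conv_rhs => rw [← h, ← hw]
    abel
  have hut : wNorm b (u - w) < ∞ := (wNorm_sub_le _ _ _).trans_lt (ENNReal.add_lt_top.2 ⟨hu, hwt⟩)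
  have hb0 := measure_lt_le_of_wNorm hS hg₀c h0 (h0z.le.trans (hz1.le.trans h1))
    (wNorm_le_of_eq_add hsub hTb hT0 hwt hw) ht
  have hb1 := measure_lt_le_of_wNorm hS' hg₁c hq1 h1
    (wNorm_le_of_eq_add hsub hTb hT1 hut hw') ht
  refine le_trans ?_ (add_le_add hb0 hb1)
  refine le_trans (measure_mono_ae ?_) (measure_union_le _ _)
  filter_upwards [AEEqFun.coeFn_sub u w] with y hy hlt
  change ENNReal.ofReal (t / 2) < ‖w y‖ₑ ∨ ENNReal.ofReal (t / 2) < ‖(u - w : ScalarField n) y‖ₑ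
  by_contra! hcon
  have h3 : ‖u y‖ₑ ≤ ‖w y‖ₑ + ‖(u - w : ScalarField n) y‖ₑ := by
    rw [hy, Pi.sub_apply]
    calc ‖u y‖ₑ = ‖w y + (u y - w y)‖ₑ := by rw [add_sub_cancel]
      _ ≤ _ := enorm_add_le _ _
  have h4 : ‖u y‖ₑ ≤ ENNReal.ofReal t := by
    refine h3.trans ((add_le_add hcon.1 hcon.2).trans (le_of_eq ?_))
    rw [← ENNReal.ofReal_add (by positivity) (by positivity), add_halves]
  exact absurd (show ENNReal.ofReal t < ‖u y‖ₑ from hlt) (not_lt.2 h4)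

end LinearEquation

/-! ### Lebesgue regularity of mild solutions -/

section Regularity

variable {n : ℕ} {α : ℝ} {A : ScalarField n → VectorField n} {C : ℝ → ℝ≥0∞ → ℝ≥0}
  {u g : ScalarField n}

theorem wNorm_lt_top_of_memLp {z : ℝ} (hz : 0 < z) (hz1 : z ≤ 1)
    (h : MemLp g (ENNReal.ofReal (1 / z)) volume) : wNorm z g < ∞ := by
  have hr : 0 < 1 / z := by positivity
  have h2 := h.2
  rw [eLpNorm_lt_top_iff_lintegral_rpow_enorm_lt_top (by simpa using hz) ENNReal.ofReal_ne_top,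
    ENNReal.toReal_ofReal hr.le] at h2
  exact (mNorm_le_lintegral_rpow g.stronglyMeasurable hz hz1).trans_lt
    (ENNReal.rpow_lt_top_of_nonneg hz.le h2.ne)

/-- The Duhamel nonlinearity doubles the deviation of the exponent from the critical one. -/
theorem wNorm_driftTerm_lt_top (hA : IsDriftOperator A C) (hα : 1 < α) (hαn : α - 1 < n)
    {x : ℝ} (hx : 0 < x) (hx2 : 2 * x < 1) (hb : (α - 1) / n < 2 * x) (hu : wNorm x u < ∞) :
    wNorm (2 * x - (α - 1) / n) (driftTerm α u (A u)) < ∞ := by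
  obtain ⟨K, hK⟩ := exists_wNorm_driftTerm_le hα hαn hx hx (by linarith) (by linarith)
  rw [two_mul]
  exact (hK u (A u)).trans_lt (ENNReal.mul_lt_top ENNReal.coe_lt_top
    (ENNReal.mul_lt_top hu (hA.wNorm_lt_top hx (by linarith) hu)))

theorem wNorm_lt_top_of_combination {x y z θ : ℝ} (h0 : 0 ≤ θ) (h1 : θ ≤ 1)
    (hz : z = x + θ * (y - x)) (hx : wNorm x u < ∞) (hy : wNorm y u < ∞) : wNorm z u < ∞ :=
  mNorm_lt_top_of_mem_segment
    ⟨1 - θ, θ, by linarith, h0, by ring, by simp only [smul_eq_mul]; rw [hz]; ring⟩ hx hy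

/-- Bootstrap along the segment from the critical exponent `b` to `z`. -/
theorem wNorm_lt_top_of_bootstrap (hA : IsDriftOperator A C) (hα : 1 < α) (hαn : α - 1 < n)
    {b z : ℝ} (hb : (α - 1) / n = b) (hb2 : 2 * b < 1) (hz : 0 < z) (hzb : z + b < 1)
    (hub : wNorm b u < ∞) (hgb : wNorm b g < ∞) (hgz : wNorm z g < ∞)
    (h : g + driftTerm α u (A u) = u) (k : ℕ) : ∀ τ : ℝ, 0 ≤ τ → τ ≤ 1 → 1 ≤ 2 ^ k * τ →
      wNorm (b + τ * (z - b)) u < ∞ → wNorm z u < ∞ := by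
  have hb0 : 0 < b := by rw [← hb]; exact div_pos (by linarith) (by linarith)
  induction k with
  | zero =>
    intro τ _ h1 h2 hτ
    obtain rfl : τ = 1 := le_antisymm h1 (by simpa using h2)
    simpa using hτ
  | succ k ih =>
    intro τ h0 h1 h2 hτ
    have hτ0 : 0 < τ := by
      rcases h0.eq_or_lt with rfl | h3
      · norm_num at h2
      · exact h3
    -- One round doubles the position τ on the segment, stopped at the endpoint `z`; `k` bounds the
    -- rounds left.
    obtain ⟨σ, hσ0, hσ1, hστ, hσ2⟩ : ∃ σ : ℝ, 0 ≤ σ ∧ σ ≤ 1 ∧ σ ≤ 2 * τ ∧ 1 ≤ 2 ^ k * σ := by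
      refine ⟨min 1 (2 * τ), by positivity, min_le_left _ _, min_le_right _ _, ?_⟩
      rcases le_total 1 (2 * τ) with h3 | h3
      · rw [min_eq_left h3, mul_one]
        exact one_le_pow₀ one_le_two
      · rw [min_eq_right h3, ← mul_assoc, ← pow_succ]
        exact h2
    have hpos : 0 < b + σ * (z - b) := by
      rcases le_total z b with h3 | h3
      · linarith [mul_nonneg (sub_nonneg.2 hσ1) (sub_nonneg.2 h3)]
      · linarith [mul_nonneg hσ0 (sub_nonneg.2 h3)]
    have hlt : b + σ * (z - b) + b < 1 := by
      rcases le_total z b with h3 | h3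
      · linarith [mul_nonneg hσ0 (sub_nonneg.2 h3)]
      · linarith [mul_nonneg (sub_nonneg.2 hσ1) (sub_nonneg.2 h3)]
    refine ih σ hσ0 hσ1 hσ2 ?_
    -- Since σ/2 ≤ τ, `u` is controlled here by interpolation, and 2x - b is the new point b + σ(z -
    -- b).
    set x := b + σ / 2 * (z - b) with hx
    have hx2 : 2 * x = b + σ * (z - b) + b := by rw [hx]; ring
    have hux : wNorm x u < ∞ := by
      refine wNorm_lt_top_of_combination (x := b) (y := b + τ * (z - b)) (θ := σ / (2 * τ))
        (by positivity) ((div_le_one (by positivity)).2 hστ) ?_ hub hτ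
      rw [hx]
      field_simp
      ring
    have hd := wNorm_driftTerm_lt_top hA hα hαn (x := x) (by linarith) (by linarith)
      (by rw [hb]; linarith) hux
    rw [hb, hx2, add_sub_cancel_right] at hd
    have hg : wNorm (b + σ * (z - b)) g < ∞ :=
      wNorm_lt_top_of_combination hσ0 hσ1 rfl hgb hgz
    rw [← h]
    exact (wNorm_add_le _ _ _).trans_lt (ENNReal.add_lt_top.2 ⟨hg, hd⟩)

/-- Away from the critical exponent, the Duhamel nonlinearity gains strong integrability. -/
theorem memLp_driftTerm (hA : IsDriftOperator A C) (hα : 1 < α) (hαn : α - 1 < n)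
    {b z : ℝ} (hb : (α - 1) / n = b) (hb2 : 2 * b < 1) (hz : 0 < z) (hzb : z + b < 1)
    (hne : z ≠ b) (hub : wNorm b u < ∞) (huz : wNorm z u < ∞) :
    MemLp (driftTerm α u (A u)) (ENNReal.ofReal (1 / z)) volume := by
  have hb0 : 0 < b := by rw [← hb]; exact div_pos (by linarith) (by linarith)
  have hdb : wNorm b (driftTerm α u (A u)) < ∞ := by
    have := wNorm_driftTerm_lt_top hA hα hαn hb0 hb2 (by linarith) hub
    rwa [hb, two_mul, add_sub_cancel_right] at this
  -- A slight overshoot beyond `z`, away from `b`: δ ≤ 1 keeps the exponent x below between `b` and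
  -- `z`, while 2x - b lies past `z`. Then `z` is strictly between two weak exponents of the Duhamel
  -- term.
  obtain ⟨δ, hδ, hδ1, hpos, hlt⟩ : ∃ δ : ℝ, 0 < δ ∧ δ ≤ 1 ∧ 0 < z + δ * (z - b) ∧
      z + δ * (z - b) + b < 1 := by
    have c1 : ContinuousAt (fun δ : ℝ => z + δ * (z - b)) 0 := by fun_prop
    have h1 : ∀ᶠ δ in nhds (0 : ℝ), z + δ * (z - b) ∈ Set.Ioo 0 (1 - b) :=
      c1 (by simpa using Ioo_mem_nhds hz (by linarith))
    have h2 : ∀ᶠ δ in nhds (0 : ℝ), δ ≤ 1 := eventually_le_nhds zero_lt_one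
    have h3 := ((h1.and h2).filter_mono (nhdsWithin_le_nhds (s := Set.Ioi 0))).and
      self_mem_nhdsWithin
    obtain ⟨δ, ⟨⟨h4, h5⟩, h6⟩, h7⟩ := h3.exists
    exact ⟨δ, h7, h6, h4, by linarith⟩
  set x := b + (1 + δ) / 2 * (z - b) with hx
  have hx2 : 2 * x = z + δ * (z - b) + b := by rw [hx]; ring
  have hux : wNorm x u < ∞ :=
    wNorm_lt_top_of_combination (by positivity) (by linarith) rfl hub huz
  have hd := wNorm_driftTerm_lt_top hA hα hαn (x := x) (by linarith) (by linarith)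
    (by rw [hb]; linarith) hux
  rw [hb, hx2, add_sub_cancel_right] at hd
  rcases hne.lt_or_gt with hlt' | hgt
  · exact memLp_of_mNorm_lt_top (driftTerm α u (A u)).stronglyMeasurable hpos (by nlinarith) hlt'
      hd hdb
  · exact memLp_of_mNorm_lt_top (driftTerm α u (A u)).stronglyMeasurable hb0 hgt (by nlinarith)
      hdb hd

/-- Lebesgue regularity of small mild solutions. -/
theorem memLp_of_mild (hA : IsDriftOperator A C) (hα : 1 < α) (hαn : α - 1 < n)
    {b z : ℝ} (hb : (α - 1) / n = b) (hb2 : 2 * b < 1) (hz : 0 < z) (hzb : z + b < 1)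
    (hub : wNorm b u < ∞) (hgb : wNorm b g < ∞)
    (hT : ∀ w, wNorm b (driftTerm α w (A u)) ≤ 2⁻¹ * wNorm b w)
    (hT0 : ∀ w, wNorm (b / 2) (driftTerm α w (A u)) ≤ 2⁻¹ * wNorm (b / 2) w)
    (hT1 : ∀ w, wNorm (1 / 2) (driftTerm α w (A u)) ≤ 2⁻¹ * wNorm (1 / 2) w)
    (h : g + driftTerm α u (A u) = u) (hg : MemLp g (ENNReal.ofReal (1 / z)) volume) :
    MemLp u (ENNReal.ofReal (1 / z)) volume := by
  have hb0 : 0 < b := by rw [← hb]; exact div_pos (by linarith) (by linarith)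
  have hAu : wNorm b (A u) < ∞ := hA.wNorm_lt_top hb0 (by linarith) hub
  have hsub : ∀ w w' : ScalarField n, wNorm b w < ∞ → wNorm b w' < ∞ →
      driftTerm α (w - w') (A u) = driftTerm α w (A u) - driftTerm α w' (A u) :=
    fun w w' hw hw' => driftTerm_sub_left hα hαn hb0 hb0 (by linarith) (by linarith) hw hw' hAu
  -- Between the fixed contraction exponents linear interpolation suffices, and this case includes z
  -- = b, where doubling the deviation gains nothing.
  by_cases hmid : b / 2 < z ∧ z < 1 / 2
  · exact memLp_of_eq_add hsub hT (by linarith) hmid.1 hmid.2 (by norm_num) hT0 hT1 hub hgb h hg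
  have hgz := wNorm_lt_top_of_memLp hz (by linarith) hg
  obtain ⟨hne, τ, hτ0, hτ1, huτ⟩ : z ≠ b ∧ ∃ τ : ℝ, 0 < τ ∧ τ ≤ 1 ∧
      wNorm (b + τ * (z - b)) u < ∞ := by
    -- Outside that range, q = b/2 or q = 1/2 lies between `b` and `z` (possibly at `z`). Its
    -- relative position on the segment is the positive τ from which the bootstrap starts.
    have key : ∀ q : ℝ, (∀ w, wNorm q (driftTerm α w (A u)) ≤ 2⁻¹ * wNorm q w) →
        z - b ≠ 0 → 0 < (q - b) / (z - b) → (q - b) / (z - b) ≤ 1 → z ≠ b ∧ ∃ τ : ℝ, 0 < τ ∧ τ ≤ 1 ∧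
          wNorm (b + τ * (z - b)) u < ∞ := by
      intro q hq hne h0 h1
      have e : q = b + (q - b) / (z - b) * (z - b) := by field_simp; ring
      refine ⟨sub_ne_zero.1 hne, (q - b) / (z - b), h0, h1, ?_⟩
      rw [← e]
      have hgq : wNorm q g < ∞ := wNorm_lt_top_of_combination h0.le h1 e hgb hgz
      exact (wNorm_le_of_eq_add hsub hT hq hub h).trans_lt (ENNReal.mul_lt_top (by simp) hgq)
    rcases le_or_gt z (b / 2) with h1 | h1
    · refine key (b / 2) hT0 (by linarith) (div_pos_of_neg_of_neg (by linarith) (by linarith)) ?_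
      rw [div_le_one_of_neg (by linarith)]
      linarith
    · have h2 : 1 / 2 ≤ z := not_lt.1 fun h2 => hmid ⟨h1, h2⟩
      refine key (1 / 2) hT1 (by linarith) (div_pos (by linarith) (by linarith)) ?_
      rw [div_le_one (by linarith)]
      linarith
  obtain ⟨k, hk⟩ := pow_unbounded_of_one_lt (1 / τ) one_lt_two
  have huz : wNorm z u < ∞ := wNorm_lt_top_of_bootstrap hA hα hαn hb hb2 hz hzb hub hgb hgz h k τ
    hτ0.le hτ1 (by rw [div_lt_iff₀ hτ0] at hk; exact hk.le) huτ
  have hd := memLp_driftTerm hA hα hαn hb hb2 hz hzb hne hub huz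
  exact (hg.add hd).ae_eq ((AEEqFun.coeFn_add _ _).symm.trans (by rw [h]))

end Regularity

/-- Bounds for the Duhamel term with a field of critical integrability. -/
theorem exists_wNorm_driftTerm_critical_le {n : ℕ} {α b q : ℝ} (hα : 1 < α) (hαn : α - 1 < n)
    (hb : (α - 1) / n = b) (hq : 0 < q) (hqb : q + b < 1) :
    ∃ K : ℝ≥0, ∀ (w : ScalarField n) (V : VectorField n),
      wNorm q (driftTerm α w V) ≤ K * (wNorm q w * wNorm b V) := by
  have hb0 : 0 < b := by rw [← hb]; exact div_pos (by linarith) (by linarith)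
  obtain ⟨K, hK⟩ := exists_wNorm_driftTerm_le hα hαn hq hb0 hqb (by rw [hb]; linarith)
  rw [hb, add_sub_cancel_right] at hK
  exact ⟨K, hK⟩

end

/-! ### Choice of the threshold and conclusion -/

theorem proposition1 (n : ℕ) (α : ℝ) (hα : 1 < α) (hαn : α < (n : ℝ) / 2 + 1) (c : ℝ≥0) :
    ∃ η₀ : ℝ, 0 < η₀ ∧
      ∀ (A : ScalarField n → VectorField n) (C : ℝ → ℝ≥0∞ → ℝ≥0),
        IsDriftOperator A C → C ((n : ℝ) / (α - 1)) ∞ ≤ c →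
      ∀ p : ℝ, (n : ℝ) / ((n : ℝ) + 1 - α) < p →
      ∀ (f : 𝓢'(Rn n, ℂ)) (g : ScalarField n), IsInvFracLaplacian α f g →
        MemLorentz g ((n : ℝ) / (α - 1)) ∞ → MemLp g (ENNReal.ofReal p) volume →
      ∀ R : ℝ, 0 < R →
        max (lorentzNorm g ((n : ℝ) / (α - 1)) ∞) (eLpNorm g (ENNReal.ofReal p) volume)
          ≤ ENNReal.ofReal R →
        R ≤ η₀ →
      ∃ u : ScalarField n,
        MemLorentz u ((n : ℝ) / (α - 1)) ∞ ∧ MemLp u (ENNReal.ofReal p) volume ∧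
        IsWeakSolution α A f u ∧
        lorentzNorm (u - g : ScalarField n) ((n : ℝ) / (α - 1)) ∞ ≤ ENNReal.ofReal R ∧
        ∀ v : ScalarField n, MemLorentz v ((n : ℝ) / (α - 1)) ∞ → IsWeakSolution α A f v →
          lorentzNorm (v - g : ScalarField n) ((n : ℝ) / (α - 1)) ∞ ≤ ENNReal.ofReal R →
          v = u := by
  have hn : (0 : ℝ) < n := by linarith
  have hα0 : 0 < α - 1 := by linarith
  have hαn' : α - 1 < n := by linarith
  obtain ⟨b, hb⟩ : ∃ b : ℝ, (α - 1) / n = b := ⟨_, rfl⟩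
  have hb0 : 0 < b := by rw [← hb]; positivity
  have hb2 : 2 * b < 1 := by rw [← hb, ← mul_div_assoc, div_lt_one hn]; linarith
  have hpc : (n : ℝ) / (α - 1) = 1 / b := by rw [← hb, one_div_div]
  have hpc1 : 1 < 1 / b := by rw [lt_div_iff₀ hb0]; linarith
  have hpc0 : 0 < 1 / b := by linarith
  have hpcc : 1 / (1 / b) = b := one_div_one_div b
  -- Operator bounds at the reciprocal exponents b, b/2 and 1/2 only, chosen before `p`, so that η₀
  -- does not depend on it.
  obtain ⟨K₀, hK₀⟩ := exists_wNorm_driftTerm_critical_le hα hαn' hb hb0 (by linarith)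
  obtain ⟨K₁, hK₁⟩ := exists_wNorm_driftTerm_critical_le (q := b / 2) hα hαn' hb (by linarith)
    (by linarith)
  obtain ⟨K₂, hK₂⟩ := exists_wNorm_driftTerm_critical_le (q := 1 / 2) hα hαn' hb (by norm_num)
    (by linarith)
  obtain ⟨κ, hκ⟩ : ∃ κ : ℝ≥0, (κ : ℝ≥0∞) = ENNReal.ofReal (1 / (1 - b)) := ⟨_, rfl⟩
  set L : ℝ≥0 := κ * c with hL
  -- Here κ converts Lorentz bounds to `wNorm` and L is the Lipschitz constant of A. The 1 in 1 + κ
  -- serves the contraction estimates, the κ serves the final bound on u - g.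
  set Q : ℝ≥0 := (K₀ + K₁ + K₂) * L * 4 * κ * (1 + κ) with hQ
  refine ⟨1 / (2 * (Q + 1)), by positivity, ?_⟩
  intro A C hA hC p hp f g hf hg hgp R hR hmax hRη
  rw [hpc] at hC hg hmax ⊢
  set r : ℝ≥0∞ := ENNReal.ofReal R with hr
  have hrt : r ≠ ∞ := ENNReal.ofReal_ne_top
  have hsmall : Q * r ≤ 2⁻¹ := by
    rw [hr, ← ENNReal.ofReal_coe_nnreal, ← ENNReal.ofReal_mul (by positivity),
      ← ENNReal.ofReal_ofNat 2, ← ENNReal.ofReal_inv_of_pos (by norm_num)]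
    refine ENNReal.ofReal_le_ofReal ?_
    have hQ0 : (0 : ℝ) ≤ Q := Q.2
    calc (Q : ℝ) * R ≤ Q * (1 / (2 * (Q + 1))) := mul_le_mul_of_nonneg_left hRη hQ0
      _ ≤ 2⁻¹ := by
        rw [mul_one_div, div_le_iff₀ (by positivity)]
        linarith
  have hQr : ∀ X : ℝ≥0, X ≤ Q → X * r ≤ 2⁻¹ := fun X hX =>
    (mul_le_mul_left (ENNReal.coe_le_coe.2 hX) r).trans hsmall
  have hlor : ∀ w : ScalarField n, lorentzNorm w (1 / b) ∞ ≤ r → wNorm b w ≤ κ * r := by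
    intro w hw
    have h1 := wNorm_le_lorentzNorm hpc1 w
    rw [hpcc, ← hκ] at h1
    exact h1.trans (mul_le_mul_right hw _)
  have hlip : ∀ u v : ScalarField n, wNorm b u < ∞ → wNorm b v < ∞ →
      wNorm b (A u - A v) ≤ L * wNorm b (u - v) := by
    intro u v hu hv
    refine (hA.wNorm_sub_le hb0 (by linarith) hu hv).trans ?_
    rw [← hκ, hL, ENNReal.coe_mul, mul_assoc]
    gcongr
  have hgN : wNorm b g ≤ κ * r := hlor g ((le_max_left _ _).trans hmax)
  have hN : κ * r ≠ ∞ := ENNReal.mul_ne_top ENNReal.coe_ne_top hrt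
  have hgb : wNorm b g < ∞ := hgN.trans_lt hN.lt_top
  have hX : ∀ K : ℝ≥0, K ≤ K₀ + K₁ + K₂ → K * L * (2 * (2 * (κ * r))) ≤ 2⁻¹ := by
    intro K hK
    refine le_of_eq_of_le ?_ (hQr (K * L * 4 * κ) ?_)
    · push_cast
      ring
    · rw [hQ]
      calc K * L * 4 * κ ≤ (K₀ + K₁ + K₂) * L * 4 * κ * 1 := by rw [mul_one]; gcongr
        _ ≤ _ := by gcongr; exact le_self_add
  have hK₀' : K₀ ≤ K₀ + K₁ + K₂ := le_self_add.trans le_self_add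
  have hK₁' : K₁ ≤ K₀ + K₁ + K₂ := le_add_self.trans le_self_add
  have hK₂' : K₂ ≤ K₀ + K₁ + K₂ := le_add_self
  obtain ⟨u, hu, hfix, huniq⟩ := exists_mild_solution (A := A) (g := g) hα hαn' hb hb2 hK₀ hlip
    hA.map_zero hN (hX K₀ hK₀') hgN
  have hub : wNorm b u < ∞ := hu.trans_lt (ENNReal.mul_lt_top (by simp) hN.lt_top)
  have hAu : wNorm b (A u) < ∞ := hA.wNorm_lt_top hb0 (by linarith) hub
  have hAuL : wNorm b (A u) ≤ L * (2 * (κ * r)) := by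
    have := hlip u 0 hub (by simp [wNorm_zero])
    rw [hA.map_zero, sub_zero, sub_zero] at this
    exact this.trans (mul_le_mul_right hu _)
  have hcon : ∀ {q : ℝ} {K : ℝ≥0}, K ≤ K₀ + K₁ + K₂ →
      (∀ (w : ScalarField n) (V : VectorField n),
        wNorm q (driftTerm α w V) ≤ K * (wNorm q w * wNorm b V)) →
      ∀ w, wNorm q (driftTerm α w (A u)) ≤ 2⁻¹ * wNorm q w := by
    intro q K hK h w
    calc _ ≤ K * (wNorm q w * (L * (2 * (κ * r)))) :=
          (h w (A u)).trans (mul_le_mul_right (mul_le_mul_right hAuL _) _)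
      _ = K * L * (2 * (κ * r)) * wNorm q w := by ring
      _ ≤ K * L * (2 * (2 * (κ * r))) * wNorm q w := by
          have h2 : 2 * (κ * r) ≤ 2 * (2 * (κ * r)) := by
            rw [two_mul (2 * (κ * r))]
            exact le_self_add
          gcongr
      _ ≤ 2⁻¹ * wNorm q w := mul_le_mul_left (hX K hK) _
  have hmem : MemLorentz u (1 / b) ∞ := memLorentz_of_wNorm hpc0 (by rwa [hpcc])
  have hnα : 0 < (n : ℝ) + 1 - α := by linarith
  have hp0 : 0 < p := (div_pos hn hnα).trans hp
  refine ⟨u, hmem, ?_, ?_, ?_, fun v hv hvw hvR => huniq v ?_ ?_⟩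
  · have h1 := memLp_of_mild (z := 1 / p) hA hα hαn' hb hb2 (by positivity) ?_ hub hgb
      (hcon hK₀' hK₀) (hcon hK₁' hK₁) (hcon hK₂' hK₂) hfix (by rwa [one_div_one_div])
    · rwa [one_div_one_div] at h1
    · rw [div_lt_iff₀ hnα] at hp
      rw [← hb, div_add_div _ _ hp0.ne' hn.ne', div_lt_one (by positivity)]
      linarith
  · exact isWeakSolution_of_mild hα hαn' hb.le hb2 hub hAu (hA.divFree (1 / b) ∞ hpc1 le_top u hmem)
      hf hfix.symm
  · have e : u - g = driftTerm α u (A u) := by rw [sub_eq_iff_eq_add', hfix]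
    have h1 := lorentzNorm_le_wNorm hpc0 (u - g)
    rw [hpcc, e] at h1
    rw [e]
    -- The Duhamel term is quadratic in the data: smallness absorbs one factor r and leaves exactly
    -- the required bound r.
    have h2 : K₀ * L * (4 * κ * κ) * r ≤ 1 := by
      refine le_trans (le_of_eq_of_le ?_ (hQr (K₀ * L * (4 * κ * κ)) ?_)) ENNReal.one_half_lt_one.le
      · push_cast
        ring
      · rw [hQ]
        calc K₀ * L * (4 * κ * κ) = K₀ * L * 4 * κ * κ := by ring
          _ ≤ _ := by gcongr; exact le_add_self
    calc _ ≤ K₀ * (wNorm b u * wNorm b (A u)) := h1.trans (hK₀ _ _)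
      _ ≤ K₀ * (2 * (κ * r) * (L * (2 * (κ * r)))) := by gcongr
      _ = K₀ * L * (4 * κ * κ) * r * r := by ring
      _ ≤ 1 * r := mul_le_mul_left h2 _
      _ = r := one_mul r
  -- Any competitor lies in the uniqueness ball: g and v - g each contribute at most κr.
  · refine (wNorm_le_add_sub b v g).trans ?_
    rw [two_mul]
    exact add_le_add hgN (hlor _ hvR)
  · have hvb : wNorm b v < ∞ := (wNorm_le_add_sub b v g).trans_lt
      (ENNReal.add_lt_top.2 ⟨hgb, (hlor _ hvR).trans_lt hN.lt_top⟩)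
    exact mild_of_isWeakSolution hα hαn' hb hb2 hvb (hA.wNorm_lt_top hb0 (by linarith) hvb) hgb hf hvw
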